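/- Let $\alpha\in(0,1)$, let $Y\in\mathbb R^d$ and $Z\in\mathbb R^q$ be independent random variables, let $\varphi:\mathbb R^d\times\mathbb R^q\to\mathbb R$ be measurable with $\mathbb E[|\varphi(Y,Z)|^{2+\delta}]<\infty$ for some $\delta>0$, and put $X_0=\mathbb E[\varphi(Y,Z)\mid Y]$. For $h\in\mathcal H=\{1/K: K=1,2,\dots\}$, $h=1/K$, put $X_h=\frac1K\sum_{k=1}^K\varphi(Y,Z^{(k)})$ with $Z^{(1)},Z^{(2)},\dots$ i.i.d. copies of $Z$ independent of $Y$. Write $F_X$ for the cdf of $X$, $\mathrm{VaR}_a(X)=\inf\{\xi: F_X(\xi)\ge a\}$, $$\xi^0_\star=\mathrm{VaR}_\alpha(X_0),\qquad \chi^0_\star=\frac1{1-\alpha}\int_\alpha^1\mathrm{VaR}_a(X_0)\,\mathrm da,\qquad V_0(\xi)=\xi+\frac1{1-\alpha}\mathbb E[(X_0-\xi)^+].$$ Assume the following. (i) There are functions $v$ and $w(\cdot,h)$, $h\in\mathcal H$, with $F_{X_h}(\xi)-F_{X_0}(\xi)=v(\xi)h+w(\xi,h)h$ for all $\xi\in\mathbb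 R$, $h\in\mathcal H$, such that for every minimizer $\xi$ of $V_0$, $v$ is integrable on $(\xi,\infty)$ and $w(\xi,h)\to0$, $\int_\xi^\infty w(x,h)\,\mathrm dx\to0$ as $\mathcal H\ni h\downarrow0$. (ii) For every $h\in\mathcal H\cup\{0\}$, $X_h$ has a continuous pdf $f_{X_h}$, and $f_{X_h}\to f_{X_0}$ locally uniformly as $\mathcal H\ni h\downarrow0$. (iii) For every $R>0$, $\inf\{f_{X_h}(\xi): h\in\mathcal H\cup\{0\},\ |\xi-\xi^0_\star|<R\}>0$. (iv) The pdfs $f_{X_h}$, $h\in\mathcal H\cup\{0\}$, are uniformly bounded and uniformly Lipschitz. (v) For every $h\in\mathcal H$, $\xi^h_0$ is a real random variable independent of a sequence $X_h^{(1)},X_h^{(2)},\dots$ of i.i.d. copies of $X_h$, and with $c_\alpha=1\vee\frac{\alpha}{1-\alpha}$, $$\sup_{h\in\mathcal H}\mathbb E\Big[|\xi^h_0|^2\exp\Big(\frac4{1-\alpha}c_\alpha\sup_{h'\in\mathcal H}\|f_{X_{h'}}\|_\infty|\xi^h_0|\Big)\Big]<\infty .$$ Let $\gamma_1>0$ and $\beta\in(\frac12,1)$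 be arbitrary, and $\gamma_n=\gamma_1n^{-\beta}$. The averaged nested stochastic approximation (ANSA) estimators $(\overline\xi^h_n,\chi^h_n)$ are given by $\chi^h_0=0$ and, for $n\ge0$, $$\xi^h_{n+1}=\xi^h_n-\gamma_{n+1}\Big(1-\tfrac1{1-\alpha}\mathbf 1_{X_h^{(n+1)}\ge\xi^h_n}\Big),\qquad \chi^h_{n+1}=\chi^h_n-\tfrac1{n+1}\Big(\chi^h_n-\xi^h_n-\tfrac1{1-\alpha}(X_h^{(n+1)}-\xi^h_n)^+\Big),$$ and $\overline\xi^h_n=\frac1n\sum_{k=1}^n\xi^h_k$ for $n\geq 1$. For $\varepsilon\in(0,1)$ set $$h=\frac1{\lceil\varepsilon^{-1}\rceil},\qquad n=\lceil h^{-2}\rceil .$$ Then $n=\lceil\varepsilon^{-1}\rceil^2$, $h\sim\varepsilon$ and $n\sim\varepsilon^{-2}$ as $\varepsilon\downarrow0$, and ANSA converges in distribution at a rate of order $\varepsilon$, namely $$\varepsilon^{-1}\begin{pmatrix}\overline\xi^h_n-\xi^0_\star\\ \chi^h_n-\chi^0_\star\end{pmatrix}\ \xrightarrow{\ \mathcal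 L\ }\ \mathcal N\left(\begin{pmatrix}-\frac{v(\xi^0_\star)}{f_{X_0}(\xi^0_\star)}\\ -\int_{\xi^0_\star}^\infty\frac{v(\xi)}{1-\alpha}\mathrm d\xi\end{pmatrix},\ \overline\Sigma\right)\quad\text{as }\varepsilon\downarrow0,$$ $$\overline\Sigma=\begin{pmatrix}\frac{\alpha(1-\alpha)}{f_{X_0}(\xi^0_\star)^2}&\frac{\alpha}{1-\alpha}\frac{\mathbb E[(X_0-\xi^0_\star)^+]}{f_{X_0}(\xi^0_\star)}\\ \frac{\alpha}{1-\alpha}\frac{\mathbb E[(X_0-\xi^0_\star)^+]}{f_{X_0}(\xi^0_\star)}&\frac{\mathrm{Var}((X_0-\xi^0_\star)^+)}{(1-\alpha)^2}\end{pmatrix}.$$ Moreover, consider the program that runs these recursions, simulating each innovation $X_h^{(n)}$ as an empirical mean of $1/h$ evaluations of $\varphi$ at one drawn copy of $Y$ and $1/h$ drawn copies of $Z$, where the draw of the initial value, each draw of $Y$, each draw of $Z$, each evaluation of $\varphi$ and each elementary operation on real numbers has a fixed cost. It computes $(\overline\xi^h_n,\chi^h_n)$, and there is a constant $0<C<\infty$,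 independent of $\varepsilon$, such that for every $\varepsilon\in(0,1)$ its total cost satisfies $$\mathrm{Cost}_{\mathrm{ANSA}}\le C\varepsilon^{-3}.$$ -/

import Mathlib

open MeasureTheory ProbabilityTheory Filter Topology Set
open scoped ENNReal NNReal Asymptotics

noncomputable section

namespace RiskSA

/-! ### Value-at-risk and expected shortfall of a real random variable -/

section Risk

variable {Ω : Type*} [MeasurableSpace Ω]

/-- The cumulative distribution function `F_X(ξ) = P(X ≤ ξ)`. -/
def cdfOf (μ : Measure Ω) (X : Ω → ℝ) (ξ : ℝ) : ℝ := μ.real {ω | X ω ≤ ξ}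

/-- `VaR_a(X) = inf {ξ : P(X ≤ ξ) ≥ a}`. -/
def VaR (μ : Measure Ω) (X : Ω → ℝ) (a : ℝ) : ℝ := sInf {ξ : ℝ | a ≤ cdfOf μ X ξ}

/-- `ES_α(X) = (1 - α)⁻¹ ∫_α^1 VaR_a(X) da`. -/
def ES (μ : Measure Ω) (X : Ω → ℝ) (α : ℝ) : ℝ := (1 - α)⁻¹ * ∫ a in α..1, VaR μ X a

/-- The objective `V(ξ) = ξ + (1 - α)⁻¹ E[(X - ξ)⁺]`. -/
def objective (μ : Measure Ω) (X : Ω → ℝ) (α ξ : ℝ) : ℝ :=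
  ξ + (1 - α)⁻¹ * ∫ ω, max (X ω - ξ) 0 ∂μ

/-- The set of minimizers of the objective. -/
def argminObjective (μ : Measure Ω) (X : Ω → ℝ) (α : ℝ) : Set ℝ :=
  {ξ | ∀ x, objective μ X α ξ ≤ objective μ X α x}

/-- `f` is a continuous probability density, with respect to Lebesgue measure, of the law
of `X`. -/
structure IsContinuousPdf (μ : Measure Ω) (X : Ω → ℝ) (f : ℝ → ℝ) : Prop where
  continuous : Continuous f
  nonneg : ∀ x, 0 ≤ f x
  law : μ.map X = volume.withDensity (fun x => ENNReal.ofReal (f x))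

end Risk

/-! ### The nested loss -/

section Loss

variable {Ω : Type*} [MeasurableSpace Ω] {d q : ℕ}

/-- `X₀ = E[φ(Y, Z) | Y]`. -/
def condLoss (μ : Measure Ω) (φ : (Fin d → ℝ) → (Fin q → ℝ) → ℝ)
    (Y : Ω → Fin d → ℝ) (Z : Ω → Fin q → ℝ) : Ω → ℝ :=
  μ[fun ω => φ (Y ω) (Z ω) | MeasurableSpace.comap Y inferInstance]

/-- The empirical mean `K⁻¹ ∑_{k ≤ K} φ(y, z_k)`. -/
def innerMean (φ : (Fin d → ℝ) → (Fin q → ℝ) → ℝ) (K : ℕ) (y : Fin d → ℝ)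
    (z : ℕ → Fin q → ℝ) : ℝ :=
  (∑ k ∈ Finset.range K, φ y (z k)) / K

/-- `X_h = K⁻¹ ∑_{k ≤ K} φ(Y, Z⁽ᵏ⁾)`, where `h = 1 / K`. -/
def nestedLoss (φ : (Fin d → ℝ) → (Fin q → ℝ) → ℝ) (Y : Ω → Fin d → ℝ)
    (Zs : ℕ → Ω → Fin q → ℝ) (K : ℕ) : Ω → ℝ :=
  fun ω => innerMean φ K (Y ω) (fun k => Zs k ω)

end Loss

/-! ### The averaged nested stochastic approximation scheme

Below `x n` is the innovation consumed by step `n + 1`, usually written `X⁽ⁿ⁺¹⁾`. -/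

/-- `H₁(ξ, x) = 1 - (1 - α)⁻¹ 1_{x ≥ ξ}`. -/
def H₁ (α ξ x : ℝ) : ℝ := 1 - (1 - α)⁻¹ * (if ξ ≤ x then 1 else 0)

/-- `H₂(ξ, χ, x) = χ - (ξ + (1 - α)⁻¹ (x - ξ)⁺)`. -/
def H₂ (α ξ χ x : ℝ) : ℝ := χ - (ξ + (1 - α)⁻¹ * max (x - ξ) 0)

/-- The learning rate `γ_n = γ₁ n^{-β}`. -/
def rate (γ₁ β : ℝ) (n : ℕ) : ℝ := γ₁ * (n : ℝ) ^ (-β)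

/-- The VaR iterates `ξ_{n+1} = ξ_n - γ_{n+1} H₁(ξ_n, X⁽ⁿ⁺¹⁾)`. -/
def xiIter (α γ₁ β ξ₀ : ℝ) (x : ℕ → ℝ) : ℕ → ℝ
  | 0 => ξ₀
  | n + 1 => xiIter α γ₁ β ξ₀ x n - rate γ₁ β (n + 1) * H₁ α (xiIter α γ₁ β ξ₀ x n) (x n)

/-- The ES iterates `χ_{n+1} = χ_n - (n + 1)⁻¹ H₂(ξ_n, χ_n, X⁽ⁿ⁺¹⁾)`, `χ_0 = 0`. -/
def chiIter (α γ₁ β ξ₀ : ℝ) (x : ℕ → ℝ) : ℕ → ℝ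
  | 0 => 0
  | n + 1 => chiIter α γ₁ β ξ₀ x n -
      1 / ((n : ℝ) + 1) * H₂ α (xiIter α γ₁ β ξ₀ x n) (chiIter α γ₁ β ξ₀ x n) (x n)

/-- The averaged VaR estimator `n⁻¹ ∑_{k=1}^n ξ_k`. -/
def xiAvg (α γ₁ β ξ₀ : ℝ) (x : ℕ → ℝ) (n : ℕ) : ℝ :=
  1 / (n : ℝ) * ∑ k ∈ Finset.Icc 1 n, xiIter α γ₁ β ξ₀ x k

/-! ### Choice of the parameters for an accuracy `ε` -/

/-- The number `K = ⌈ε⁻¹⌉` of inner samples. -/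
def innerCount (ε : ℝ) : ℕ := ⌈ε⁻¹⌉₊

/-- The bias parameter `h = 1 / ⌈ε⁻¹⌉`. -/
def biasParam (ε : ℝ) : ℝ := 1 / (innerCount ε : ℝ)

/-- The number of iterations `n = ⌈h⁻²⌉`. -/
def iterCount (ε : ℝ) : ℕ := ⌈biasParam ε ^ (-2 : ℤ)⌉₊

/-! ### Cost model

The algorithm is written as a program over the real numbers in which every primitive (drawing the
initial value, drawing a copy of `Y`, drawing a copy of `Z`, evaluating `φ` at a point, one
elementary operation on reals) charges a fixed cost. The random draws are read from given
streams, so that the program can be run on any realization of the samples. -/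

/-- A value together with the cost spent to produce it. -/
structure Timed (β : Type) where
  val : β
  cost : ℕ

/-- Sequential composition adds the costs. -/
instance : Monad Timed where
  pure b := ⟨b, 0⟩
  bind m g := ⟨(g m.val).val, m.cost + (g m.val).cost⟩

/-- Return `b`, spending `c`. -/
def Timed.charge {β : Type} (c : ℕ) (b : β) : Timed β := ⟨b, c⟩

/-- The costs of the primitives. -/
structure UnitCosts where
  drawInit : ℕ
  drawY : ℕ
  drawZ : ℕ
  evalPhi : ℕ
  realOp : ℕ

section Program

variable {d q : ℕ}

/-- Computes `φ(y, z_0) + ⋯ + φ(y, z_{k-1})`, drawing the `z_i` one by one. -/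
def innerSumProg (c : UnitCosts) (φ : (Fin d → ℝ) → (Fin q → ℝ) → ℝ) (y : Fin d → ℝ)
    (z : ℕ → Fin q → ℝ) : ℕ → Timed ℝ
  | 0 => Timed.charge c.realOp 0
  | k + 1 => do
    let s ← innerSumProg c φ y z k
    let zk ← Timed.charge c.drawZ (z k)
    let p ← Timed.charge c.evalPhi (φ y zk)
    Timed.charge c.realOp (s + p)

/-- Simulates one innovation `X_h`, `h = 1 / K`. -/
def innovationProg (c : UnitCosts) (φ : (Fin d → ℝ) → (Fin q → ℝ) → ℝ) (K : ℕ)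
    (y : Fin d → ℝ) (z : ℕ → Fin q → ℝ) : Timed ℝ := do
  let y' ← Timed.charge c.drawY y
  let s ← innerSumProg c φ y' z K
  Timed.charge c.realOp (s / K)

/-- Runs `n` steps of the scheme; returns `(ξ_n, χ_n, ξ̄_n)`. -/
def ansaLoop (c : UnitCosts) (φ : (Fin d → ℝ) → (Fin q → ℝ) → ℝ) (α γ₁ β : ℝ) (K : ℕ)
    (ξ₀ : ℝ) (y : ℕ → Fin d → ℝ) (z : ℕ → ℕ → Fin q → ℝ) : ℕ → Timed (ℝ × ℝ × ℝ)
  | 0 => do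
    let ξ ← Timed.charge c.drawInit ξ₀
    let χ ← Timed.charge c.realOp 0
    let a ← Timed.charge c.realOp 0
    pure (ξ, χ, a)
  | n + 1 => do
    let (ξ, χ, a) ← ansaLoop c φ α γ₁ β K ξ₀ y z n
    let x ← innovationProg c φ K (y n) (z n)
    let k ← Timed.charge c.realOp ((n : ℝ) + 1)
    let p ← Timed.charge c.realOp (k ^ (-β))
    let γ ← Timed.charge c.realOp (γ₁ * p)
    let b ← Timed.charge c.realOp (1 - α)
    let r ← Timed.charge c.realOp (1 / b)
    let i ← Timed.charge c.realOp (if ξ ≤ x then r else 0)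
    let g ← Timed.charge c.realOp (1 - i)
    let s ← Timed.charge c.realOp (γ * g)
    let ξ' ← Timed.charge c.realOp (ξ - s)
    let u ← Timed.charge c.realOp (x - ξ)
    let v ← Timed.charge c.realOp (max u 0)
    let v' ← Timed.charge c.realOp (r * v)
    let t ← Timed.charge c.realOp (ξ + v')
    let e ← Timed.charge c.realOp (χ - t)
    let e' ← Timed.charge c.realOp (e / k)
    let χ' ← Timed.charge c.realOp (χ - e')
    let w ← Timed.charge c.realOp (1 / k)
    let w' ← Timed.charge c.realOp (1 - w)
    let a₁ ← Timed.charge c.realOp (w' * a)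
    let a₂ ← Timed.charge c.realOp (w * ξ')
    let a' ← Timed.charge c.realOp (a₁ + a₂)
    pure (ξ', χ', a')

/-- The ANSA algorithm with `K = 1 / h` inner samples and `n` iterations; returns the pair of
estimators `(ξ̄_n, χ_n)`. -/
def ansaProg (c : UnitCosts) (φ : (Fin d → ℝ) → (Fin q → ℝ) → ℝ) (α γ₁ β : ℝ) (K n : ℕ)
    (ξ₀ : ℝ) (y : ℕ → Fin d → ℝ) (z : ℕ → ℕ → Fin q → ℝ) : Timed (ℝ × ℝ) := do
  let (_, χ, a) ← ansaLoop c φ α γ₁ β K ξ₀ y z n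
  pure (a, χ)

end Program

/-- The covariance matrix of the limiting Gaussian law; `f₀` is the pdf of `X`, `ξ` its VaR. -/
def limitCov {Ω : Type*} [MeasurableSpace Ω] (μ : Measure Ω) (X : Ω → ℝ) (f₀ : ℝ → ℝ)
    (α ξ : ℝ) : Matrix (Fin 2) (Fin 2) ℝ :=
  !![α * (1 - α) / f₀ ξ ^ 2,
      α / (1 - α) * ((∫ ω, max (X ω - ξ) 0 ∂μ) / f₀ ξ);
    α / (1 - α) * ((∫ ω, max (X ω - ξ) 0 ∂μ) / f₀ ξ),
      variance (fun ω => max (X ω - ξ) 0) μ / (1 - α) ^ 2]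

/-- The mean of the limiting Gaussian law. -/
def limitMean (f₀ v : ℝ → ℝ) (α ξ : ℝ) : EuclideanSpace ℝ (Fin 2) :=
  !₂[-(v ξ / f₀ ξ), -∫ x in Set.Ioi ξ, v x / (1 - α)]

end RiskSA

end

noncomputable section

namespace RiskSA

set_option linter.unusedSectionVars false

/-! ### Deterministic sequences -/

/-! Write K = 1/h and let q_K be the α-quantile of X_h. Since n = K² and ε⁻¹ is equivalent to K =
√n, the random fluctuations and the bias live on the same scale, and both survive in the limit. For
each test vector, `inner_scaledError` splits the scaled error exactly into a normalized sum of K²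
i.i.d. centred terms, a remainder, and a deterministic bias.

Remainder. The mean field of the VaR recursion is (F(ξ) - α)/(1 - α), which is bounded, so it pulls
back from afar with only a constant force. A hyperbolic cosine is a Lyapunov function adapted to
this: its derivative is comparable to itself at infinity. It yields E|ξ_k - q_K|² = O(k^(-β)), with
a constant that does not depend on K (`IsInnovation.lyapunov_step`, `recursion_bound`,
`exists_integral_sq_le`). Following Polyak and Juditsky, the recursion is divided by the step and
summed by parts, so that the averaged VaR error is a sum of gradients frozen at q_K, up to boundary
terms, a quadratic linearization error and a small martingale (`grad_remainder_eq`). The ES iterate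
is exactly an empirical mean of losses, and the objective is flat at its minimizer, so there too ξ_k
may be replaced by q_K. All of these errors are o(√n) in L¹, uniformly in K (`exists_remainder_le`);
this is where 1/2 < β < 1 enters.

Leading sum. Its summands have a law that varies with K, hence a triangular array. Because X_h → X₀
in L² at rate 1/K for the squared distance (`integral_nestedLoss_sub_sq`), the summands converge in
L² too. For centred variables, closeness in L² makes characteristic functions at 1/K close to order
o(K⁻²), so their K²-th powers have the limit of the ordinary central limit theorem for X₀
(`norm_charFun_map_sub_le`, `tendsto_charFun_pow_sq`).

Bias. The expansion of the cdf, inverted near the quantile with uniformly Lipschitz densities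
bounded below, gives the limit of K(q_K - ξ⋆). Integrating the same expansion over (ξ⋆, ∞) gives the
bias of the objective, and moving from q_K to ξ⋆ costs only O((q_K - ξ⋆)²)
(`exists_regular_quantiles`).

The three parts are assembled through characteristic functions (`tendsto_charFun_scaledError`) and
then transferred from K to ε by Slutsky's lemma. The cost is read off the program: K² iterations of
cost O(K). -/

/-- Bernoulli's inequality for the concave power 1 - s bounds each summand by an increment of n ^ (1
- s) / (1 - s), and the increments telescope. -/
lemma sum_rpow_neg_le {s : ℝ} (hs0 : 0 ≤ s) (hs : s < 1) (n : ℕ) :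
    ∑ k ∈ Finset.range n, ((k : ℝ) + 1) ^ (-s) ≤ (n : ℝ) ^ (1 - s) / (1 - s) := by
  induction n with
  | zero => simp [Real.zero_rpow (by linarith : (1 - s) ≠ 0)]
  | succ n ih =>
    rw [Finset.sum_range_succ]
    have h1 : (0 : ℝ) < (n : ℝ) + 1 := by positivity
    have hs' : 0 < 1 - s := by linarith
    have hB := rpow_one_add_le_one_add_mul_self (s := -1 / ((n : ℝ) + 1)) (p := 1 - s)
      (by rw [le_div_iff₀ h1]; linarith) hs'.le (by linarith)
    have h2 : 1 + -1 / ((n : ℝ) + 1) = (n : ℝ) / (n + 1) := by field_simp; ring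
    rw [h2, Real.div_rpow (by positivity) h1.le, div_le_iff₀ (by positivity)] at hB
    have h3 : ((n : ℝ) + 1) ^ (1 - s) = ((n : ℝ) + 1) ^ (-s) * ((n : ℝ) + 1) := by
      rw [← Real.rpow_add_one h1.ne']; ring_nf
    push_cast
    rw [le_div_iff₀ hs']
    rw [le_div_iff₀ hs'] at ih
    have h4 : (1 + (1 - s) * (-1 / ((n : ℝ) + 1))) * ((n : ℝ) + 1) ^ (1 - s)
        = ((n : ℝ) + 1) ^ (1 - s) - (1 - s) * ((n : ℝ) + 1) ^ (-s) := by
      rw [h3]; field_simp; ring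
    rw [h4] at hB
    nlinarith

lemma tendsto_rpow_div_sqrt {s : ℝ} (hs : s < 1 / 2) :
    Tendsto (fun n : ℕ => (n : ℝ) ^ s / √(n : ℝ)) atTop (𝓝 0) := by
  have h : Tendsto (fun n : ℕ => (n : ℝ) ^ (-(1 / 2 - s))) atTop (𝓝 0) :=
    (tendsto_rpow_neg_atTop (by linarith)).comp tendsto_natCast_atTop_atTop
  refine h.congr' ?_
  filter_upwards [eventually_ge_atTop 1] with n hn
  have hn' : (0 : ℝ) < n := by exact_mod_cast hn
  rw [Real.sqrt_eq_rpow, ← Real.rpow_sub hn']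
  ring_nf

/-- The order of the remainder terms, negligible before `√n`. -/
def remOrder (β : ℝ) (n : ℕ) : ℝ :=
  (n : ℝ) ^ (1 - β) + (n : ℝ) ^ (β / 2) + (n : ℝ) ^ (1 / 2 - β / 4)

/-- The first power lies below 1/2 because β > 1/2, the second because β < 1. -/
lemma tendsto_remOrder_div_sqrt {β : ℝ} (hβ : β ∈ Ioo (1 / 2 : ℝ) 1) :
    Tendsto (fun n : ℕ => remOrder β n / √(n : ℝ)) atTop (𝓝 0) := by
  have h := ((tendsto_rpow_div_sqrt (s := 1 - β) (by linarith [hβ.1])).add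
    (tendsto_rpow_div_sqrt (s := β / 2) (by linarith [hβ.2]))).add
    (tendsto_rpow_div_sqrt (s := 1 / 2 - β / 4) (by linarith [hβ.1]))
  simp only [add_zero] at h
  refine h.congr fun n => ?_
  simp only [remOrder]; ring

/-- `(n + 1) ^ (-β)`. -/
def stepPow (β : ℝ) (n : ℕ) : ℝ := ((n : ℝ) + 1) ^ (-β)

lemma stepPow_pos (β : ℝ) (n : ℕ) : 0 < stepPow β n := by unfold stepPow; positivity

lemma stepPow_le_one {β : ℝ} (hβ : 0 ≤ β) (n : ℕ) : stepPow β n ≤ 1 :=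
  Real.rpow_le_one_of_one_le_of_nonpos (by simp) (by linarith)

lemma stepPow_anti {β : ℝ} (hβ : 0 ≤ β) : Antitone (stepPow β) := fun a b hab =>
  Real.rpow_le_rpow_of_nonpos (by positivity) (by simpa using hab) (by linarith)

lemma tendsto_stepPow {β : ℝ} (hβ : 0 < β) : Tendsto (stepPow β) atTop (𝓝 0) :=
  (tendsto_rpow_neg_atTop hβ).comp
    (tendsto_atTop_add_const_right _ _ tendsto_natCast_atTop_atTop)

lemma rate_succ (γ₁ β : ℝ) (n : ℕ) : rate γ₁ β (n + 1) = γ₁ * stepPow β n := by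
  simp [rate, stepPow]

lemma stepPow_succ_ge {β : ℝ} (hβ : β ≤ 1) (n : ℕ) :
    stepPow β n * (1 - 1 / ((n : ℝ) + 1)) ≤ stepPow β (n + 1) := by
  have h1 : (0 : ℝ) < (n : ℝ) + 1 := by positivity
  have h2 : (0 : ℝ) < (n : ℝ) + 1 + 1 := by positivity
  have h3 : (((n : ℝ) + 1 + 1) / (n + 1)) ^ (-β) ≥ ((n : ℝ) + 1) / (n + 1 + 1) := by
    rw [Real.rpow_neg (by positivity), ge_iff_le, ← inv_div]
    refine inv_anti₀ (by positivity) ?_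
    calc (((n : ℝ) + 1 + 1) / (n + 1)) ^ β ≤ (((n : ℝ) + 1 + 1) / (n + 1)) ^ (1 : ℝ) :=
          Real.rpow_le_rpow_of_exponent_le (by rw [le_div_iff₀ h1]; linarith) hβ
      _ = _ := Real.rpow_one _
  have h4 : stepPow β (n + 1) = stepPow β n * (((n : ℝ) + 1 + 1) / (n + 1)) ^ (-β) := by
    unfold stepPow
    push_cast
    rw [Real.div_rpow h2.le h1.le]
    field_simp
  rw [h4]
  refine mul_le_mul_of_nonneg_left (le_trans ?_ h3) (stepPow_pos β n).le
  rw [le_div_iff₀ h2]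
  field_simp
  nlinarith

/-- Before the steps become small, the recursion may expand by a factor of at most 1 + C. The bound
depends on C, B and N alone, not on the sequence; this is what keeps the final estimates uniform in
the law of the innovations. -/
lemma recursion_bound_aux {C : ℝ} (hC : 0 ≤ C) (B : ℝ) (N : ℕ) :
    ∃ D : ℝ, 0 ≤ D ∧ ∀ u g : ℕ → ℝ, u 0 ≤ B → (∀ n, 0 ≤ u n) → (∀ n, 0 ≤ g n) → (∀ n, g n ≤ 1) →
      (∀ c : ℝ, 0 ≤ c → (∀ n, u (n + 1) ≤ (1 - c * g n + C * g n ^ 2) * u n + C * g n ^ 2) →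
        ∀ n ≤ N, u n ≤ D) := by
  induction N with
  | zero =>
    refine ⟨max B 0, le_max_right _ _, fun u g h0 _ _ _ _ _ _ n hn => ?_⟩
    rw [Nat.le_zero.1 hn]
    exact h0.trans (le_max_left _ _)
  | succ N ih =>
    obtain ⟨D, hD, h⟩ := ih
    refine ⟨(1 + C) * D + C, by positivity, fun u g h0 hu hg hg1 c hc hrec n hn => ?_⟩
    have hih := h u g h0 hu hg hg1 c hc hrec
    have hDle : D ≤ (1 + C) * D + C := by nlinarith
    rcases Nat.le_succ_iff.1 hn with hn | rfl
    · exact (hih n hn).trans hDle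
    · have hu' := hih N le_rfl
      have hg2 : g N ^ 2 ≤ 1 := pow_le_one₀ (hg N) (hg1 N)
      have h1 : (1 - c * g N + C * g N ^ 2) ≤ 1 + C := by
        nlinarith [mul_nonneg hc (hg N), mul_le_mul_of_nonneg_left hg2 hC]
      calc u (N + 1) ≤ _ := hrec N
        _ ≤ (1 + C) * u N + C := by
          have := mul_le_mul_of_nonneg_right h1 (hu N)
          nlinarith [mul_le_mul_of_nonneg_left hg2 hC]
        _ ≤ _ := by nlinarith

/-- Once the steps g are small, the contraction c g beats both the quadratic error and the relative
decay of g from one index to the next, so `u ≤ A * g` propagates by induction. The constant A must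
exceed 4C/c for the induction and D/g_N to cover the initial stretch. -/
lemma recursion_bound {c C β : ℝ} (hc : 0 < c) (hC : 0 ≤ C) (hβ0 : 0 < β) (hβ : β < 1) (B : ℝ) :
    ∃ A : ℝ, 0 ≤ A ∧ ∀ u : ℕ → ℝ, u 0 ≤ B → (∀ n, 0 ≤ u n) →
      (∀ n, u (n + 1) ≤ (1 - c * stepPow β n + C * stepPow β n ^ 2) * u n
        + C * stepPow β n ^ 2) →
      ∀ n, u n ≤ A * stepPow β n := by
  have hg := tendsto_stepPow hβ0
  have hlim : Tendsto (fun n : ℕ => ((n : ℝ) + 1) ^ (-(1 - β))) atTop (𝓝 0) :=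
    tendsto_stepPow (by linarith)
  have hev : ∀ᶠ n : ℕ in atTop, C * stepPow β n ≤ c / 4 ∧ c * stepPow β n ≤ 1 ∧
      ((n : ℝ) + 1) ^ (-(1 - β)) ≤ c / 4 := by
    have e1 := (hg.const_mul C).eventually_le_const (u := c / 4) (by simpa using by positivity)
    have e2 := (hg.const_mul c).eventually_le_const (u := 1) (by simp)
    have e3 := hlim.eventually_le_const (u := c / 4) (by positivity)
    filter_upwards [e1, e2, e3] with n h1 h2 h3 using ⟨h1, h2, h3⟩
  obtain ⟨N, hN⟩ := eventually_atTop.1 hev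
  obtain ⟨D, hD, hDb⟩ := recursion_bound_aux hC B N
  refine ⟨max (4 * C / c) (D / stepPow β N), le_max_of_le_left (by positivity),
    fun u h0 hu hrec => ?_⟩
  set A := max (4 * C / c) (D / stepPow β N) with hA
  have hA0 : 0 ≤ A := le_max_of_le_left (by positivity)
  have hAC : C ≤ A * c / 4 := by
    have : 4 * C / c ≤ A := le_max_left _ _
    rw [div_le_iff₀ hc] at this; linarith
  have hsmall : ∀ n ≤ N, u n ≤ A * stepPow β n := fun n hn => by
    have h1 := hDb u (stepPow β) h0 hu (fun n => (stepPow_pos β n).le)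
      (stepPow_le_one hβ0.le) c hc.le hrec n hn
    have h2 : D / stepPow β N ≤ A := le_max_right _ _
    rw [div_le_iff₀ (stepPow_pos β N)] at h2
    exact h1.trans (h2.trans (mul_le_mul_of_nonneg_left (stepPow_anti hβ0.le hn) hA0))
  intro n
  rcases le_total n N with hn | hn
  · exact hsmall n hn
  induction n, hn using Nat.le_induction with
  | base => exact hsmall N le_rfl
  | succ n hn ih =>
    obtain ⟨h1, h2, h3⟩ := hN n hn
    have hgp := stepPow_pos β n
    set g := stepPow β n with hgdef
    -- The relative decrease of g is at most 1/(n+1) = (n+1)^(-(1-β)) g, negligible against g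
    -- exactly because β < 1.
    have hinv : 1 / ((n : ℝ) + 1) ≤ c / 4 * g := by
      have : 1 / ((n : ℝ) + 1) = ((n : ℝ) + 1) ^ (-(1 - β)) * g := by
        rw [hgdef, stepPow, ← Real.rpow_add (by positivity)]
        rw [show -(1 - β) + -β = -1 by ring, Real.rpow_neg_one, one_div]
      rw [this]
      exact mul_le_mul_of_nonneg_right h3 hgp.le
    have hfac : 0 ≤ 1 - c * g + C * g ^ 2 := by nlinarith [mul_nonneg hC (sq_nonneg g)]
    calc u (n + 1) ≤ (1 - c * g + C * g ^ 2) * u n + C * g ^ 2 := hrec n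
      _ ≤ (1 - c * g + C * g ^ 2) * (A * g) + C * g ^ 2 := by gcongr
      _ ≤ A * (g * (1 - 1 / ((n : ℝ) + 1))) := by
        have k1 : A * g * (1 / ((n : ℝ) + 1)) ≤ A * g * (c / 4 * g) :=
          mul_le_mul_of_nonneg_left hinv (by positivity)
        have k2 : A * g * g * (C * g) ≤ A * g * g * (c / 4) :=
          mul_le_mul_of_nonneg_left h1 (by positivity)
        have k3 : C * g ^ 2 ≤ A * c / 4 * g ^ 2 := by gcongr
        have k4 : 0 ≤ A * g ^ 2 * c := by positivity
        nlinarith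
      _ ≤ _ := mul_le_mul_of_nonneg_left (stepPow_succ_ge hβ.le n) hA0

/-! ### The hyperbolic cosine as a Lyapunov function -/

/-- Apply exp(±b) ≤ 1 ± b + b² to the two exponentials of the cosine. The remainder is proportional
to the cosine itself, so it can be absorbed in the recursion. -/
lemma cosh_sub_le {a b : ℝ} (hb : |b| ≤ 1) :
    Real.cosh (a - b) ≤ Real.cosh a - b * Real.sinh a + b ^ 2 * Real.cosh a := by
  have h1 := (abs_le.1 (Real.abs_exp_sub_one_sub_id_le hb)).2
  have h2 := (abs_le.1 (Real.abs_exp_sub_one_sub_id_le (x := -b) (by rwa [abs_neg]))).2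
  rw [Real.cosh_eq (a - b), Real.cosh_eq a, Real.sinh_eq a, neg_sub, sub_eq_add_neg, Real.exp_add,
    sub_eq_add_neg b a, Real.exp_add, mul_comm (Real.exp b)]
  have ha := Real.exp_pos a
  have ha' := Real.exp_pos (-a)
  nlinarith [mul_le_mul_of_nonneg_left h1 ha'.le, mul_le_mul_of_nonneg_left h2 ha.le]

lemma cosh_sub_one_le_mul_sinh {t : ℝ} (ht : 0 ≤ t) : Real.cosh t - 1 ≤ t * Real.sinh t := by
  have hmono : MonotoneOn (fun s => s * Real.sinh s - Real.cosh s + 1) (Ici 0) := by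
    refine monotoneOn_of_deriv_nonneg (convex_Ici 0) (by fun_prop) (by fun_prop) ?_
    intro x hx
    rw [interior_Ici] at hx
    have : HasDerivAt (fun s => s * Real.sinh s - Real.cosh s + 1)
        (1 * Real.sinh x + x * Real.cosh x - Real.sinh x) x :=
      (((hasDerivAt_id x).mul (Real.hasDerivAt_sinh x)).sub (Real.hasDerivAt_cosh x)).add_const 1
    rw [this.deriv]
    nlinarith [mul_pos (mem_Ioi.1 hx) (Real.cosh_pos x)]
  have := hmono (mem_Ici.2 le_rfl) (mem_Ici.2 ht) ht
  simp at this
  linarith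

lemma cosh_sub_one_le_sinh {t : ℝ} (ht : 0 ≤ t) : Real.cosh t - 1 ≤ Real.sinh t := by
  have := Real.cosh_sub_sinh t
  have h2 := Real.exp_le_one_iff.2 (neg_nonpos.2 ht)
  linarith

/-- A restoring force that saturates at distance 1 still contracts `cosh - 1` at a proportional
rate: near the origin t sinh t dominates cosh t - 1, and far away sinh t alone does. A quadratic
Lyapunov function would lack the second property. -/
lemma drift_cosh_le {l x : ℝ} (hl : 0 < l) :
    min l 1 * (Real.cosh (l * x) - 1) ≤ l * (min |x| 1 * Real.sinh (l * |x|)) := by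
  have hx := abs_nonneg x
  have hc : Real.cosh (l * x) = Real.cosh (l * |x|) := by
    rw [← Real.cosh_abs (l * x), abs_mul, abs_of_pos hl]
  rw [hc]
  have h0 : 0 ≤ Real.cosh (l * |x|) - 1 := by linarith [Real.one_le_cosh (l * |x|)]
  have hlx : 0 ≤ l * |x| := by positivity
  rcases le_total |x| 1 with h | h
  · rw [min_eq_left h]
    have := cosh_sub_one_le_mul_sinh hlx
    nlinarith [min_le_right l 1]
  · rw [min_eq_right h]
    have := cosh_sub_one_le_sinh hlx
    have h3 := min_le_left l 1
    calc min l 1 * (Real.cosh (l * |x|) - 1) ≤ l * (Real.cosh (l * |x|) - 1) := by gcongr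
      _ ≤ _ := by nlinarith

lemma sq_le_cosh_sub_one (t : ℝ) : t ^ 2 / 2 ≤ Real.cosh t - 1 := by
  have h1 : Real.cosh t = 1 + 2 * Real.sinh (t / 2) ^ 2 := by
    rw [show t = 2 * (t / 2) by ring, Real.cosh_two_mul, Real.cosh_sq]; ring_nf
  have h2 : (t / 2) ^ 2 ≤ Real.sinh (t / 2) ^ 2 := by
    refine sq_le_sq.2 ?_
    rcases le_total 0 (t / 2) with h | h
    · rw [abs_of_nonneg h]; exact (Real.self_le_sinh_iff.2 h).trans (le_abs_self _)
    · rw [abs_of_nonpos h]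
      exact (neg_le_neg (Real.sinh_le_self_iff.2 h)).trans (neg_le_abs _)
  linarith

lemma cosh_sub_le_mul_exp (a b : ℝ) : Real.cosh (a - b) ≤ Real.cosh a * Real.exp |b| := by
  have h1 : Real.exp (a - b) ≤ Real.exp a * Real.exp |b| := by
    rw [← Real.exp_add]; exact Real.exp_le_exp.2 (by linarith [neg_abs_le b])
  have h2 : Real.exp (-(a - b)) ≤ Real.exp (-a) * Real.exp |b| := by
    rw [← Real.exp_add]; exact Real.exp_le_exp.2 (by linarith [le_abs_self b])
  rw [Real.cosh_eq, Real.cosh_eq]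
  linarith

/-! ### The program and its cost -/

section Program

variable {d q : ℕ} (c : UnitCosts) (φ : (Fin d → ℝ) → (Fin q → ℝ) → ℝ)

@[simp] lemma Timed.bind_val {β γ : Type} (m : Timed β) (g : β → Timed γ) :
    (m >>= g).val = (g m.val).val := rfl

@[simp] lemma Timed.bind_cost {β γ : Type} (m : Timed β) (g : β → Timed γ) :
    (m >>= g).cost = m.cost + (g m.val).cost := rfl

@[simp] lemma Timed.charge_val {β : Type} (k : ℕ) (b : β) : (Timed.charge k b).val = b := rfl

@[simp] lemma Timed.charge_cost {β : Type} (k : ℕ) (b : β) : (Timed.charge k b).cost = k := rfl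

@[simp] lemma Timed.pure_val {β : Type} (b : β) : (pure b : Timed β).val = b := rfl

@[simp] lemma Timed.pure_cost {β : Type} (b : β) : (pure b : Timed β).cost = 0 := rfl

lemma innerSumProg_val (y : Fin d → ℝ) (z : ℕ → Fin q → ℝ) (k : ℕ) :
    (innerSumProg c φ y z k).val = ∑ i ∈ Finset.range k, φ y (z i) := by
  induction k with
  | zero => simp [innerSumProg]
  | succ k ih => simp [innerSumProg, ih, Finset.sum_range_succ]

lemma innerSumProg_cost (y : Fin d → ℝ) (z : ℕ → Fin q → ℝ) (k : ℕ) :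
    (innerSumProg c φ y z k).cost = c.realOp + k * (c.drawZ + c.evalPhi + c.realOp) := by
  induction k with
  | zero => simp [innerSumProg]
  | succ k ih => simp [innerSumProg, ih]; ring

lemma innovationProg_val (K : ℕ) (y : Fin d → ℝ) (z : ℕ → Fin q → ℝ) :
    (innovationProg c φ K y z).val = innerMean φ K y z := by
  simp [innovationProg, innerSumProg_val, innerMean]

lemma innovationProg_cost (K : ℕ) (y : Fin d → ℝ) (z : ℕ → Fin q → ℝ) :
    (innovationProg c φ K y z).cost
      = c.drawY + 2 * c.realOp + K * (c.drawZ + c.evalPhi + c.realOp) := by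
  simp [innovationProg, innerSumProg_cost]; ring

variable (α γ₁ β : ℝ)

lemma xiAvg_succ (ξ₀ : ℝ) (x : ℕ → ℝ) (n : ℕ) :
    xiAvg α γ₁ β ξ₀ x (n + 1) = (1 - 1 / ((n : ℝ) + 1)) * xiAvg α γ₁ β ξ₀ x n
      + 1 / ((n : ℝ) + 1) * xiIter α γ₁ β ξ₀ x (n + 1) := by
  unfold xiAvg
  rw [Finset.sum_Icc_succ_top (by omega), mul_add]
  congr 1
  -- At n = 0 the old average carries the weight 1 - 1/1 = 0, so the convention 1/0 = 0 in its
  -- definition is harmless.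
  · rcases n.eq_zero_or_pos with rfl | hn
    · simp
    · have : (n : ℝ) ≠ 0 := by positivity
      push_cast
      field_simp
      ring
  · push_cast; rfl

lemma ansaLoop_val (K : ℕ) (ξ₀ : ℝ) (y : ℕ → Fin d → ℝ) (z : ℕ → ℕ → Fin q → ℝ) (n : ℕ) :
    (ansaLoop c φ α γ₁ β K ξ₀ y z n).val =
      (xiIter α γ₁ β ξ₀ (fun i => innerMean φ K (y i) (z i)) n,
        chiIter α γ₁ β ξ₀ (fun i => innerMean φ K (y i) (z i)) n,
        xiAvg α γ₁ β ξ₀ (fun i => innerMean φ K (y i) (z i)) n) := by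
  induction n with
  | zero => simp [ansaLoop, xiIter, chiIter, xiAvg]
  | succ n ih =>
    have hξ : xiIter α γ₁ β ξ₀ (fun i => innerMean φ K (y i) (z i)) (n + 1) = _ := rfl
    simp only [ansaLoop, Timed.bind_val, ih, Timed.charge_val, innovationProg_val, Timed.pure_val,
      Prod.mk.injEq]
    rw [xiAvg_succ]
    simp only [xiIter, chiIter, rate, H₁, H₂, Nat.cast_add, Nat.cast_one, one_div, mul_ite, mul_one,
      mul_zero, true_and]
    refine ⟨?_, trivial⟩
    rw [div_eq_inv_mul]

lemma ansaLoop_cost (K : ℕ) (ξ₀ : ℝ) (y : ℕ → Fin d → ℝ) (z : ℕ → ℕ → Fin q → ℝ) (n : ℕ) :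
    (ansaLoop c φ α γ₁ β K ξ₀ y z n).cost = c.drawInit + 2 * c.realOp
      + n * (c.drawY + 23 * c.realOp + K * (c.drawZ + c.evalPhi + c.realOp)) := by
  induction n with
  | zero => simp [ansaLoop]; ring
  | succ n ih =>
    simp only [ansaLoop, Timed.bind_cost, ih, Timed.charge_cost, innovationProg_cost,
      Timed.pure_cost]
    ring

lemma ansaProg_val (K n : ℕ) (ξ₀ : ℝ) (y : ℕ → Fin d → ℝ) (z : ℕ → ℕ → Fin q → ℝ) :
    (ansaProg c φ α γ₁ β K n ξ₀ y z).val =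
      (xiAvg α γ₁ β ξ₀ (fun i => innerMean φ K (y i) (z i)) n,
        chiIter α γ₁ β ξ₀ (fun i => innerMean φ K (y i) (z i)) n) := by
  simp [ansaProg, ansaLoop_val]

lemma ansaProg_cost (K n : ℕ) (ξ₀ : ℝ) (y : ℕ → Fin d → ℝ) (z : ℕ → ℕ → Fin q → ℝ) :
    (ansaProg c φ α γ₁ β K n ξ₀ y z).cost = c.drawInit + 2 * c.realOp
      + n * (c.drawY + 23 * c.realOp + K * (c.drawZ + c.evalPhi + c.realOp)) := by
  simp [ansaProg, ansaLoop_cost]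

end Program

/-! ### The parameters -/

/-- The outer ceiling does nothing, since h⁻² is already the integer K². -/
lemma iterCount_eq (ε : ℝ) : iterCount ε = innerCount ε ^ 2 := by
  have h : biasParam ε ^ (-2 : ℤ) = ((innerCount ε ^ 2 : ℕ) : ℝ) := by
    simp [biasParam, zpow_neg]
  rw [iterCount, h, Nat.ceil_natCast]

lemma tendsto_innerCount_mul :
    Tendsto (fun ε : ℝ => (innerCount ε : ℝ) * ε) (𝓝[>] 0) (𝓝 1) := by
  have h := (tendsto_nat_ceil_div_atTop (R := ℝ)).comp tendsto_inv_nhdsGT_zero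
  refine h.congr fun ε => ?_
  simp [innerCount]

lemma tendsto_innerCount : Tendsto innerCount (𝓝[>] 0) atTop :=
  tendsto_nat_ceil_atTop.comp tendsto_inv_nhdsGT_zero

lemma innerCount_pos {ε : ℝ} (hε : 0 < ε) : 1 ≤ innerCount ε :=
  Nat.one_le_iff_ne_zero.2 (Nat.ceil_pos.2 (inv_pos.2 hε)).ne'

lemma biasParam_isEquivalent : biasParam ~[𝓝[>] 0] fun ε : ℝ => ε := by
  have hne : ∀ᶠ ε : ℝ in 𝓝[>] 0, ε ≠ 0 := by
    filter_upwards [self_mem_nhdsWithin] with ε hε using (mem_Ioi.1 hε).ne'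
  rw [Asymptotics.isEquivalent_iff_tendsto_one hne]
  have h := tendsto_innerCount_mul.inv₀ one_ne_zero
  rw [inv_one] at h
  refine h.congr fun ε => ?_
  simp [biasParam, div_eq_mul_inv, mul_comm]

lemma iterCount_isEquivalent :
    (fun ε : ℝ => (iterCount ε : ℝ)) ~[𝓝[>] 0] fun ε : ℝ => ε ^ (-2 : ℤ) := by
  have hne : ∀ᶠ ε : ℝ in 𝓝[>] 0, ε ^ (-2 : ℤ) ≠ 0 := by
    filter_upwards [self_mem_nhdsWithin] with ε hε using zpow_ne_zero _ (mem_Ioi.1 hε).ne'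
  rw [Asymptotics.isEquivalent_iff_tendsto_one hne]
  have h := tendsto_innerCount_mul.pow 2
  rw [one_pow] at h
  refine h.congr fun ε => ?_
  simp only [iterCount_eq, Pi.div_apply, zpow_neg, div_inv_eq_mul]
  push_cast
  rw [zpow_ofNat]
  ring

lemma innerCount_le {ε : ℝ} (hε : ε ∈ Ioo (0 : ℝ) 1) : (innerCount ε : ℝ) ≤ 2 * ε⁻¹ := by
  have h1 : 1 ≤ ε⁻¹ := (one_le_inv₀ hε.1).2 hε.2.le
  have h2 := (Nat.ceil_lt_add_one (inv_nonneg.2 hε.1.le)).le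
  unfold innerCount
  linarith

lemma exists_cost_le {d q : ℕ} (c : UnitCosts) (φ : (Fin d → ℝ) → (Fin q → ℝ) → ℝ)
    (α γ₁ β : ℝ) :
    ∃ C : ℝ, 0 < C ∧ ∀ ε ∈ Ioo (0 : ℝ) 1,
      ∀ (x₀ : ℝ) (y : ℕ → Fin d → ℝ) (z : ℕ → ℕ → Fin q → ℝ),
        ((ansaProg c φ α γ₁ β (innerCount ε) (iterCount ε) x₀ y z).cost : ℝ)
          ≤ C * ε ^ (-3 : ℤ) := by
  set D : ℕ := (c.drawInit + 2 * c.realOp) + (c.drawY + 23 * c.realOp)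
    + (c.drawZ + c.evalPhi + c.realOp) + 1 with hD
  refine ⟨8 * D, by rw [hD]; positivity, fun ε hε x₀ y z => ?_⟩
  have hK1 := innerCount_pos hε.1
  have hle : (ansaProg c φ α γ₁ β (innerCount ε) (iterCount ε) x₀ y z).cost
      ≤ D * innerCount ε ^ 3 := by
    rw [ansaProg_cost, iterCount_eq]
    set K := innerCount ε
    have h2 : K ^ 2 ≤ K ^ 3 := Nat.pow_le_pow_right hK1 (by norm_num)
    have h3 : 1 ≤ K ^ 3 := Nat.one_le_pow _ _ hK1
    calc _ = (c.drawInit + 2 * c.realOp) * 1 + (c.drawY + 23 * c.realOp) * K ^ 2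
          + (c.drawZ + c.evalPhi + c.realOp) * K ^ 3 := by ring
      _ ≤ (c.drawInit + 2 * c.realOp) * K ^ 3 + (c.drawY + 23 * c.realOp) * K ^ 3
          + (c.drawZ + c.evalPhi + c.realOp) * K ^ 3 := by gcongr
      _ ≤ _ := by rw [hD]; nlinarith
  calc ((ansaProg c φ α γ₁ β (innerCount ε) (iterCount ε) x₀ y z).cost : ℝ)
      ≤ D * (innerCount ε : ℝ) ^ 3 := by exact_mod_cast hle
    _ ≤ D * (2 * ε⁻¹) ^ 3 := by gcongr; exact innerCount_le hε
    _ = 8 * D * ε ^ (-3 : ℤ) := by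
      rw [zpow_neg, zpow_ofNat]
      field_simp
      norm_num

/-! ### Laws on the line with a continuous density -/

section Density

variable {P : Measure ℝ} [IsProbabilityMeasure P] {f : ℝ → ℝ}

lemma measureReal_Iic_sub_eq_integral (hf : Continuous f) (hf0 : ∀ x, 0 ≤ f x)
    (hP : P = volume.withDensity fun x => ENNReal.ofReal (f x)) {a b : ℝ} (hab : a ≤ b) :
    P.real (Iic b) - P.real (Iic a) = ∫ x in a..b, f x := by
  have h1 : P.real (Iic b) - P.real (Iic a) = P.real (Ioc a b) := by
    rw [← Iic_sdiff_Iic, measureReal_sdiff (Iic_subset_Iic.2 hab) measurableSet_Iic]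
  rw [h1, intervalIntegral.integral_of_le hab, measureReal_def]
  conv_lhs => rw [hP]
  rw [withDensity_apply _ measurableSet_Ioc,
    ← integral_eq_lintegral_of_nonneg_ae (ae_of_all _ hf0) hf.aestronglyMeasurable]

lemma hasDerivAt_measureReal_Iic (hf : Continuous f) (hf0 : ∀ x, 0 ≤ f x)
    (hP : P = volume.withDensity fun x => ENNReal.ofReal (f x)) (x : ℝ) :
    HasDerivAt (fun y => P.real (Iic y)) (f x) x := by
  have h1 : HasDerivAt (fun y => ∫ t in (x - 1)..y, f t) (f x) x :=
    (hf.integral_hasStrictDerivAt _ _).hasDerivAt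
  refine (h1.const_add (P.real (Iic (x - 1)))).congr_of_eventuallyEq ?_
  filter_upwards [Ici_mem_nhds (show x - 1 < x by linarith)] with y hy
  rw [← measureReal_Iic_sub_eq_integral hf hf0 hP hy]; ring

/-- Mean value theorem for the cdf, without fixing the order of the two points. -/
lemma exists_measureReal_Iic_sub (hf : Continuous f) (hf0 : ∀ x, 0 ≤ f x)
    (hP : P = volume.withDensity fun x => ENNReal.ofReal (f x)) (x y : ℝ) :
    ∃ c, |c - y| ≤ |x - y| ∧ P.real (Iic x) - P.real (Iic y) = f c * (x - y) := by
  have hd := hasDerivAt_measureReal_Iic hf hf0 hP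
  have hc : Continuous fun y => P.real (Iic y) :=
    continuous_iff_continuousAt.2 fun x => (hd x).continuousAt
  rcases lt_trichotomy x y with h | rfl | h
  · obtain ⟨c, hc1, hc2⟩ := exists_hasDerivAt_eq_slope _ f h hc.continuousOn fun z _ => hd z
    refine ⟨c, ?_, ?_⟩
    · rw [abs_of_neg (by linarith [hc1.2]), abs_of_neg (by linarith)]; linarith [hc1.1]
    · have : y - x ≠ 0 := by linarith
      rw [hc2]; field_simp; ring
  · exact ⟨x, le_rfl, by simp⟩
  · obtain ⟨c, hc1, hc2⟩ := exists_hasDerivAt_eq_slope _ f h hc.continuousOn fun z _ => hd z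
    refine ⟨c, ?_, ?_⟩
    · rw [abs_of_pos (by linarith [hc1.1]), abs_of_pos (by linarith)]; linarith [hc1.2]
    · rw [hc2, div_mul_cancel₀ _ (by linarith)]

end Density

lemma measureReal_Iic_mono (P : Measure ℝ) [IsProbabilityMeasure P] :
    Monotone fun x => P.real (Iic x) := fun _ _ h => measureReal_mono (Iic_subset_Iic.2 h)

/-- Regularity of a law `P` around its quantile `ξ` of order `α`, in terms of its distribution
function. -/
structure RegularLaw (P : Measure ℝ) (α ξ s m M L : ℝ) : Prop where
  quantile : P.real (Iic ξ) = α
  lip : ∀ x y, |P.real (Iic x) - P.real (Iic y)| ≤ M * |x - y|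
  drift : ∀ x, m * min |x - ξ| 1 ≤ |P.real (Iic x) - α|
  linear : ∀ x, |P.real (Iic x) - α - s * (x - ξ)| ≤ L * (x - ξ) ^ 2
  slope : m ≤ s
  slope_le : s ≤ M
  integrable : Integrable id P

/-- Within distance 1 of the quantile every estimate is the mean value theorem together with the
bounds on the density. Beyond it the lower bound persists because the cdf is monotone, so positivity
of the density is needed only locally. -/
lemma regularLaw_of_density {P : Measure ℝ} [IsProbabilityMeasure P] {f : ℝ → ℝ}
    (hf : Continuous f) (hf0 : ∀ x, 0 ≤ f x)
    (hP : P = volume.withDensity fun x => ENNReal.ofReal (f x)) {α ξ m M : ℝ} {L : ℝ≥0}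
    (hq : P.real (Iic ξ) = α) (hM : ∀ x, f x ≤ M) (hL : LipschitzWith L f)
    (hm : ∀ x, |x - ξ| ≤ 1 → m ≤ f x) (hint : Integrable id P) :
    RegularLaw P α ξ (f ξ) m M L where
  quantile := hq
  lip x y := by
    obtain ⟨c, -, hc⟩ := exists_measureReal_Iic_sub hf hf0 hP x y
    rw [hc, abs_mul, abs_of_nonneg (hf0 c)]
    exact mul_le_mul_of_nonneg_right (hM c) (abs_nonneg _)
  drift x := by
    have hmono := measureReal_Iic_mono P
    have hclose : ∀ y, |y - ξ| ≤ 1 → m * |y - ξ| ≤ |P.real (Iic y) - α| := fun y hy => by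
      obtain ⟨c, hc1, hc⟩ := exists_measureReal_Iic_sub hf hf0 hP y ξ
      rw [← hq, hc, abs_mul, abs_of_nonneg (hf0 c)]
      exact mul_le_mul_of_nonneg_right (hm c (hc1.trans hy)) (abs_nonneg _)
    rcases le_total |x - ξ| 1 with h | h
    · rw [min_eq_left h]; exact hclose x h
    · rw [min_eq_right h]
      rcases le_total 0 (x - ξ) with hx | hx
      · rw [abs_of_nonneg hx] at h
        have h1 := hclose (ξ + 1) (by simp)
        have h2 := hmono (show ξ ≤ ξ + 1 by linarith)
        have h3 := hmono (show ξ + 1 ≤ x by linarith)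
        simp only [add_sub_cancel_left, abs_one] at h1 h2 h3
        rw [abs_of_nonneg (by linarith)] at h1
        exact h1.trans ((by linarith : _ ≤ P.real (Iic x) - α).trans (le_abs_self _))
      · rw [abs_of_nonpos hx] at h
        have h1 := hclose (ξ - 1) (by simp)
        have h2 := hmono (show ξ - 1 ≤ ξ by linarith)
        have h3 := hmono (show x ≤ ξ - 1 by linarith)
        simp only [sub_sub_cancel_left, abs_neg, abs_one] at h1 h2 h3
        rw [abs_of_nonpos (by linarith)] at h1
        exact h1.trans ((by linarith : _ ≤ -(P.real (Iic x) - α)).trans (neg_le_abs _))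
  linear x := by
    obtain ⟨c, hc1, hc⟩ := exists_measureReal_Iic_sub hf hf0 hP x ξ
    have h1 : |f c - f ξ| ≤ L * |x - ξ| := by
      have := hL.dist_le_mul c ξ
      rw [Real.dist_eq, Real.dist_eq] at this
      exact this.trans (mul_le_mul_of_nonneg_left hc1 L.2)
    rw [← hq, hc, ← sub_mul, abs_mul, ← sq_abs (x - ξ), sq, ← mul_assoc]
    exact mul_le_mul_of_nonneg_right h1 (abs_nonneg _)
  slope := hm ξ (by simp)
  slope_le := hM ξ
  integrable := hint

lemma RegularLaw.bound_nonneg {P : Measure ℝ} {α ξ s m M L : ℝ}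
    (h : RegularLaw P α ξ s m M L) : 0 ≤ M := by
  have := (abs_nonneg _).trans (h.lip 1 0)
  simpa using this

/-! ### The gradients of the objective -/

/-- The integrand `ξ + (1 - α)⁻¹ (x - ξ)⁺` of the objective. -/
def lossG (α ξ x : ℝ) : ℝ := ξ + (1 - α)⁻¹ * max (x - ξ) 0

/-- The objective of a law `P`. -/
def lawObjective (P : Measure ℝ) (α ξ : ℝ) : ℝ := ∫ x, lossG α ξ x ∂P

/-- A bound for the gradients. -/
def gradBound (α : ℝ) : ℝ := 1 + (1 - α)⁻¹

lemma measurable_H₁ (α : ℝ) : Measurable (Function.uncurry (H₁ α)) := by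
  unfold H₁ Function.uncurry
  refine measurable_const.sub (measurable_const.mul ?_)
  exact Measurable.ite (measurableSet_le measurable_fst measurable_snd) measurable_const
    measurable_const

lemma measurable_lossG (α : ℝ) : Measurable (Function.uncurry (lossG α)) := by
  unfold lossG Function.uncurry
  fun_prop

lemma gradBound_pos {α : ℝ} (hα : α ∈ Ioo (0 : ℝ) 1) : 0 < gradBound α := by
  have : 0 < 1 - α := by linarith [hα.2]
  unfold gradBound; positivity

lemma abs_H₁_le {α : ℝ} (hα : α ∈ Ioo (0 : ℝ) 1) (ξ x : ℝ) : |H₁ α ξ x| ≤ gradBound α := by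
  have : 0 < (1 - α)⁻¹ := inv_pos.2 (by linarith [hα.2])
  unfold H₁ gradBound
  split_ifs <;> rw [abs_le] <;> constructor <;> linarith

/-- Convexity: `H₁ α ξ x` is a subgradient at ξ of the convex function `lossG α · x`. The estimates
on the objective below all come from this inequality. -/
lemma lossG_sub_ge {α : ℝ} (hα : α ∈ Ioo (0 : ℝ) 1) (ξ y x : ℝ) :
    H₁ α ξ x * (y - ξ) ≤ lossG α y x - lossG α ξ x := by
  have h : 0 < (1 - α)⁻¹ := inv_pos.2 (by linarith [hα.2])
  have key : max (x - ξ) 0 - (if ξ ≤ x then 1 else 0) * (y - ξ) ≤ max (x - y) 0 := by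
    split_ifs with hx
    · rw [max_eq_left (by linarith)]
      exact le_trans (by linarith) (le_max_left _ _)
    · rw [max_eq_right (by linarith)]
      exact le_trans (by linarith) (le_max_right _ _)
  have := mul_le_mul_of_nonneg_left key h.le
  unfold H₁ lossG
  nlinarith

lemma abs_lossG_sub_le {α : ℝ} (hα : α ∈ Ioo (0 : ℝ) 1) (ξ y x : ℝ) :
    |lossG α y x - lossG α ξ x| ≤ gradBound α * |y - ξ| := by
  have h : ∀ a b, lossG α b x - lossG α a x ≤ gradBound α * |b - a| := fun a b => by
    have h1 := lossG_sub_ge hα b a x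
    have h2 : -(H₁ α b x * (a - b)) ≤ |H₁ α b x| * |a - b| := by
      rw [← abs_mul]; exact neg_le_abs _
    have h3 := mul_le_mul_of_nonneg_right (abs_H₁_le hα b x) (abs_nonneg (a - b))
    rw [abs_sub_comm] at h3
    rw [abs_sub_comm] at h2
    linarith
  rw [abs_le]
  have h1 := h ξ y
  have h2 := h y ξ
  rw [abs_sub_comm] at h2
  constructor <;> linarith

/-- The difference takes only the values 0 and (1 - α)⁻¹, so its second moment is linear, not
quadratic, in the distance of the thresholds. -/
lemma H₁_sub_sq {α : ℝ} {ξ y : ℝ} (h : ξ ≤ y) (x : ℝ) :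
    (H₁ α y x - H₁ α ξ x) ^ 2 = (1 - α)⁻¹ * (H₁ α y x - H₁ α ξ x) := by
  unfold H₁
  split_ifs <;> first | ring1 | (exfalso; linarith)

/-! ### Mean gradient and mean objective under a regular law -/

section Law

variable {P : Measure ℝ} [IsProbabilityMeasure P] {α ξ s m M L : ℝ}

lemma integrable_H₁ (hα : α ∈ Ioo (0 : ℝ) 1) (y : ℝ) : Integrable (H₁ α y) P :=
  Integrable.of_bound ((measurable_H₁ α).of_uncurry_left).aestronglyMeasurable (gradBound α)
    (ae_of_all _ fun x => abs_H₁_le hα y x)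

lemma integrable_lossG (h : Integrable id P) (y : ℝ) : Integrable (lossG α y) P :=
  (integrable_const y).add (((h.sub (integrable_const y)).pos_part).const_mul _)

namespace RegularLaw

/-- A Lipschitz cdf has no jump. This lets the indicator of x ≥ ξ in `H₁` be read off the cdf. -/
lemma measure_singleton (h : RegularLaw P α ξ s m M L) (y : ℝ) : P.real {y} = 0 := by
  refine le_antisymm (le_of_forall_pos_le_add fun e he => ?_) measureReal_nonneg
  have hM := h.bound_nonneg
  have hd : 0 < e / (M + 1) := by positivity
  have h1 : P.real {y} ≤ P.real (Iic y) - P.real (Iic (y - e / (M + 1))) := by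
    rw [← measureReal_sdiff (Iic_subset_Iic.2 (by linarith)) measurableSet_Iic, Iic_sdiff_Iic]
    refine measureReal_mono ?_
    rintro _ rfl
    exact ⟨by linarith, le_rfl⟩
  have h2 := (le_abs_self _).trans (h.lip y (y - e / (M + 1)))
  rw [sub_sub_cancel, abs_of_pos hd] at h2
  have h3 : M * (e / (M + 1)) ≤ e := by
    rw [← mul_div_assoc, div_le_iff₀ (by positivity)]; nlinarith
  linarith

lemma measureReal_Ici (h : RegularLaw P α ξ s m M L) (y : ℝ) :
    P.real (Ici y) = 1 - P.real (Iic y) := by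
  have h1 : P.real (Iio y) = P.real (Iic y) := by
    refine le_antisymm (measureReal_mono Iio_subset_Iic_self) ?_
    rw [← Iio_union_right]
    exact (measureReal_union_le _ _).trans (by rw [h.measure_singleton]; simp)
  rw [← h1, ← compl_Iio, probReal_compl_eq_one_sub measurableSet_Iio]

lemma integral_H₁ (hα : α ∈ Ioo (0 : ℝ) 1) (h : RegularLaw P α ξ s m M L) (y : ℝ) :
    ∫ x, H₁ α y x ∂P = (P.real (Iic y) - α) / (1 - α) := by
  have hα' : 1 - α ≠ 0 := by linarith [hα.2]
  have h1 : ∀ x, H₁ α y x = 1 - (1 - α)⁻¹ * (Ici y).indicator 1 x := fun x => by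
    simp [H₁, indicator_apply]
  simp_rw [h1]
  have hi : Integrable ((Ici y).indicator (1 : ℝ → ℝ)) P :=
    (integrable_const (1 : ℝ)).indicator measurableSet_Ici
  rw [integral_sub (integrable_const _) (hi.const_mul _), integral_const_mul,
    integral_indicator_one measurableSet_Ici, h.measureReal_Ici]
  simp
  field_simp
  ring

lemma integral_H₁_sub_sq_le (hα : α ∈ Ioo (0 : ℝ) 1) (h : RegularLaw P α ξ s m M L) (y z : ℝ) :
    ∫ x, (H₁ α y x - H₁ α z x) ^ 2 ∂P ≤ (1 - α)⁻¹ ^ 2 * (M * |y - z|) := by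
  have hα' : 0 < 1 - α := by linarith [hα.2]
  have key : ∀ y z, z ≤ y →
      ∫ x, (H₁ α y x - H₁ α z x) ^ 2 ∂P ≤ (1 - α)⁻¹ ^ 2 * (M * |y - z|) := fun y z hzy => by
    simp_rw [H₁_sub_sq hzy]
    rw [integral_const_mul, integral_sub (integrable_H₁ hα _) (integrable_H₁ hα _),
      h.integral_H₁ hα, h.integral_H₁ hα]
    have := (le_abs_self _).trans (h.lip y z)
    calc _ = (1 - α)⁻¹ ^ 2 * (P.real (Iic y) - P.real (Iic z)) := by field_simp; ring
      _ ≤ _ := by gcongr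
  rcases le_total z y with hzy | hzy
  · exact key y z hzy
  · have := key z y hzy
    rw [abs_sub_comm]
    simpa only [sub_sq_comm] using this

lemma lawObjective_sub_ge (hα : α ∈ Ioo (0 : ℝ) 1) (h : RegularLaw P α ξ s m M L) (y z : ℝ) :
    (P.real (Iic z) - α) / (1 - α) * (y - z) ≤ lawObjective P α y - lawObjective P α z := by
  unfold lawObjective
  rw [← h.integral_H₁ hα, ← integral_sub (integrable_lossG h.integrable _)
    (integrable_lossG h.integrable _), ← integral_mul_const]
  exact integral_mono ((integrable_H₁ hα _).mul_const _)
    ((integrable_lossG h.integrable _).sub (integrable_lossG h.integrable _))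
    fun x => lossG_sub_ge hα z y x

lemma lawObjective_sub_nonneg (hα : α ∈ Ioo (0 : ℝ) 1) (h : RegularLaw P α ξ s m M L) (y : ℝ) :
    0 ≤ lawObjective P α y - lawObjective P α ξ := by
  have := h.lawObjective_sub_ge hα y ξ
  rw [h.quantile] at this
  simpa using this

/-- The subgradient inequality taken at y, with a derivative that is Lipschitz and vanishes at ξ:
the objective is quadratically flat at its minimizer. This removes any first-order effect of the VaR
error on the ES. -/
lemma lawObjective_sub_le (hα : α ∈ Ioo (0 : ℝ) 1) (h : RegularLaw P α ξ s m M L) (y : ℝ) :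
    lawObjective P α y - lawObjective P α ξ ≤ M / (1 - α) * (y - ξ) ^ 2 := by
  have hα' : 0 < 1 - α := by linarith [hα.2]
  have h1 := h.lawObjective_sub_ge hα ξ y
  have h2 := h.lip y ξ
  rw [h.quantile] at h2
  have h3 : (P.real (Iic y) - α) * (y - ξ) ≤ M * (y - ξ) ^ 2 := by
    calc _ ≤ |P.real (Iic y) - α| * |y - ξ| := by rw [← abs_mul]; exact le_abs_self _
      _ ≤ M * |y - ξ| * |y - ξ| := by gcongr
      _ = _ := by rw [mul_assoc, ← sq, sq_abs]
  have h4 : (P.real (Iic y) - α) / (1 - α) * (y - ξ) ≤ M / (1 - α) * (y - ξ) ^ 2 := by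
    rw [div_mul_eq_mul_div, div_mul_eq_mul_div]; gcongr
  linarith

end RegularLaw

end Law

/-! ### Expected shortfall -/

/-- Layer-cake formula, shifted by ξ. It turns the expansion of the cdf into an expansion of the
objective. -/
lemma integral_max_sub (P : Measure ℝ) [IsProbabilityMeasure P] (hint : Integrable id P) (ξ : ℝ) :
    IntegrableOn (fun t => 1 - P.real (Iic t)) (Ioi ξ) ∧
      ∫ x, max (x - ξ) 0 ∂P = ∫ t in Ioi ξ, (1 - P.real (Iic t)) := by
  have hi : Integrable (fun x => max (x - ξ) 0) P := (hint.sub (integrable_const ξ)).pos_part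
  have hnn : 0 ≤ᵐ[P] fun x => max (x - ξ) 0 := ae_of_all _ fun x => le_max_right _ _
  have hset : ∀ t : ℝ, 0 < t → {a : ℝ | t < max (a - ξ) 0} = Ioi (t + ξ) := fun t ht => by
    ext a
    simp only [mem_ofPred_eq, lt_max_iff, mem_Ioi, lt_sub_iff_add_lt, or_iff_left_iff_imp]
    intro h; linarith
  have hcompl : ∀ t : ℝ, P.real (Ioi t) = 1 - P.real (Iic t) := fun t => by
    rw [← compl_Iic, probReal_compl_eq_one_sub measurableSet_Iic]
  have hpre : (fun t : ℝ => t + ξ) ⁻¹' Ioi ξ = Ioi 0 := by ext t; simp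
  have hmeas : Measurable fun t => 1 - P.real (Iic t) :=
    measurable_const.sub (measureReal_Iic_mono P).measurable
  have hmp := measurePreserving_add_right (volume : Measure ℝ) ξ
  have hemb := measurableEmbedding_addRight ξ
  constructor
  · rw [← hmp.integrableOn_comp_preimage hemb, hpre]
    refine ⟨(hmeas.comp (measurable_add_const ξ)).aestronglyMeasurable, ?_⟩
    rw [hasFiniteIntegral_iff_ofReal (f := (fun t => 1 - P.real (Iic t)) ∘ fun x => x + ξ)
      (ae_of_all _ fun t => sub_nonneg.2 measureReal_le_one)]
    have h1 := lintegral_eq_lintegral_meas_lt P hnn hi.aemeasurable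
    have h2 : ∫⁻ t in Ioi (0 : ℝ), P {a | t < max (a - ξ) 0} < ∞ := by
      rw [← h1]; exact hi.lintegral_lt_top
    refine lt_of_eq_of_lt (setLIntegral_congr_fun measurableSet_Ioi fun t ht => ?_) h2
    simp only [hset t ht, Function.comp, ← hcompl]
    exact ofReal_measureReal
  · rw [hi.integral_eq_integral_meas_lt hnn, ← hmp.setIntegral_preimage_emb hemb _ (Ioi ξ), hpre]
    refine setIntegral_congr_fun measurableSet_Ioi fun t ht => ?_
    simp only [hset t ht, hcompl]

section Continuous

variable {P : Measure ℝ} [IsProbabilityMeasure P] {f : ℝ → ℝ}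

lemma exists_measureReal_Iic_eq (hc : Continuous fun x => P.real (Iic x)) {a : ℝ}
    (ha : a ∈ Ioo (0 : ℝ) 1) : ∃ x, P.real (Iic x) = a := by
  have h1 := tendsto_cdf_atTop P
  have h0 := tendsto_cdf_atBot P
  have he : ∀ x, cdf P x = P.real (Iic x) := fun x => cdf_eq_real P x
  obtain ⟨y, hy⟩ := (h1.eventually_const_lt ha.2).exists
  obtain ⟨z, hz⟩ := (h0.eventually_lt_const ha.1).exists
  rw [he] at hy hz
  exact mem_range_of_exists_le_of_exists_ge hc ⟨z, hz.le⟩ ⟨y, hy.le⟩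

lemma strictMono_measureReal_Iic (hf : Continuous f) (hpos : ∀ x, 0 < f x)
    (hP : P = volume.withDensity fun x => ENNReal.ofReal (f x)) :
    StrictMono fun x => P.real (Iic x) :=
  strictMono_of_deriv_pos fun x => by
    rw [(hasDerivAt_measureReal_Iic hf (fun x => (hpos x).le) hP x).deriv]; exact hpos x

end Continuous

/-! ### Quantiles and expected shortfall through the objective -/

section Var

variable {Ω : Type*} [MeasurableSpace Ω] {μ : Measure Ω} {X : Ω → ℝ}

lemma cdfOf_eq_map (hX : AEMeasurable X μ) (ξ : ℝ) : cdfOf μ X ξ = (μ.map X).real (Iic ξ) := by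
  rw [cdfOf, map_measureReal_apply_of_aemeasurable hX measurableSet_Iic]; rfl

lemma VaR_of_strictMono (hmono : StrictMono (cdfOf μ X)) (x : ℝ) : VaR μ X (cdfOf μ X x) = x := by
  have : {ξ | cdfOf μ X x ≤ cdfOf μ X ξ} = Ici x := by
    ext ξ; simp [hmono.le_iff_le]
  rw [VaR, this, csInf_Ici]

variable [IsProbabilityMeasure μ]

lemma objective_eq_lawObjective {α : ℝ} (hX : AEMeasurable X μ) (hint : Integrable X μ) (ξ : ℝ) :
    objective μ X α ξ = lawObjective (μ.map X) α ξ := by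
  have hi : Integrable (fun ω => max (X ω - ξ) 0) μ := (hint.sub (integrable_const ξ)).pos_part
  have : IsProbabilityMeasure (μ.map X) := Measure.isProbabilityMeasure_map hX
  rw [lawObjective, integral_map hX
    ((measurable_lossG α).of_uncurry_left).aestronglyMeasurable]
  simp only [lossG]
  rw [integral_add (integrable_const _) (hi.const_mul _), integral_const_mul]
  simp [objective]

/-- Substitute a = F(x) in the integral of the quantiles: VaR at F(x) is x and the Jacobian is the
density, so the integral becomes E[X; X > ξ]. Splitting off ξ P(X > ξ) = ξ (1 - α) gives the
objective. -/
lemma ES_eq_objective {α : ℝ} (hα : α ∈ Ioo (0 : ℝ) 1) {f : ℝ → ℝ} (hX : AEMeasurable X μ)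
    (hint : Integrable X μ) (hf : IsContinuousPdf μ X f) (hpos : ∀ x, 0 < f x) {ξ : ℝ}
    (hξ : cdfOf μ X ξ = α) : ES μ X α = objective μ X α ξ := by
  have : IsProbabilityMeasure (μ.map X) := Measure.isProbabilityMeasure_map hX
  have hα' : 1 - α ≠ 0 := by linarith [hα.2]
  have hF : cdfOf μ X = fun x => (μ.map X).real (Iic x) := funext fun x => cdfOf_eq_map hX x
  have hmono : StrictMono (cdfOf μ X) := by
    rw [hF]; exact strictMono_measureReal_Iic hf.continuous hpos hf.law
  have hd : ∀ x, HasDerivAt (cdfOf μ X) (f x) x := by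
    rw [hF]; exact hasDerivAt_measureReal_Iic hf.continuous hf.nonneg hf.law
  have hc : Continuous (cdfOf μ X) := continuous_iff_continuousAt.2 fun x => (hd x).continuousAt
  have himg : cdfOf μ X '' Ioi ξ = Ioo α 1 := by
    ext a
    constructor
    · rintro ⟨x, hx, rfl⟩
      refine ⟨hξ ▸ hmono hx, (hmono (lt_add_one x)).trans_le ?_⟩
      rw [hF]; exact measureReal_le_one
    · rintro ⟨ha1, ha2⟩
      obtain ⟨x, hx⟩ := exists_measureReal_Iic_eq (P := μ.map X) (hF ▸ hc)
        ⟨hα.1.trans ha1, ha2⟩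
      have hx' : cdfOf μ X x = a := by rw [hF]; exact hx
      exact ⟨x, hmono.lt_iff_lt.1 (by rw [hξ, hx']; exact ha1), hx'⟩
  have hVaR : ∫ a in α..1, VaR μ X a = ∫ x in Ioi ξ, x ∂(μ.map X) := by
    rw [intervalIntegral.integral_of_le hα.2.le, integral_Ioc_eq_integral_Ioo, ← himg,
      integral_image_eq_integral_abs_deriv_smul measurableSet_Ioi
        (fun x _ => (hd x).hasDerivWithinAt) hmono.injective.injOn, hf.law,
      setIntegral_withDensity_eq_setIntegral_toReal_smul₀
        hf.continuous.measurable.ennreal_ofReal.aemeasurable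
        (ae_of_all _ fun x => ENNReal.ofReal_lt_top) _ measurableSet_Ioi]
    refine setIntegral_congr_fun measurableSet_Ioi fun x _ => ?_
    simp only [VaR_of_strictMono hmono, abs_of_pos (hpos x), ENNReal.toReal_ofReal (hpos x).le]
  have hid : Integrable id (μ.map X) := (integrable_map_measure (by fun_prop) hX).2 hint
  have hmax : ∫ ω, max (X ω - ξ) 0 ∂μ = ∫ x in Ioi ξ, (x - ξ) ∂(μ.map X) := by
    rw [← integral_map (f := fun x => max (x - ξ) 0) hX (by fun_prop),
      ← integral_indicator measurableSet_Ioi]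
    refine integral_congr_ae (ae_of_all _ fun x => ?_)
    simp only [indicator_apply, mem_Ioi]
    split_ifs with h
    · exact max_eq_left (by linarith)
    · exact max_eq_right (by linarith)
  have hIoi : (μ.map X).real (Ioi ξ) = 1 - α := by
    rw [← compl_Iic, probReal_compl_eq_one_sub measurableSet_Iic, ← cdfOf_eq_map hX, hξ]
  rw [ES, hVaR, objective, hmax,
    integral_sub (f := fun x => x) (g := fun _ => ξ) hid.integrableOn (integrable_const _),
    setIntegral_const, hIoi, smul_eq_mul]
  field_simp
  ring

end Var

/-! ### Innovations and iterates -/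

/-- `X` is an i.i.d. sequence of law `P`, independent of the initial value `ξ₀`. -/
structure IsInnovation {Ω : Type*} [MeasurableSpace Ω] (μ : Measure Ω) (P : Measure ℝ)
    (ξ₀ : Ω → ℝ) (X : ℕ → Ω → ℝ) : Prop where
  measurable_init : Measurable ξ₀
  measurable : ∀ n, Measurable (X n)
  law : ∀ n, μ.map (X n) = P
  indep : iIndepFun X μ
  indep_init : IndepFun ξ₀ (fun ω n => X n ω) μ

/-- The first `n` terms of a sequence, followed by zeros. -/
def truncSeq (n : ℕ) (x : ℕ → ℝ) : ℕ → ℝ := fun i => if i < n then x i else 0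

lemma measurable_truncSeq (n : ℕ) : Measurable (truncSeq n) := by
  refine measurable_pi_lambda _ fun i => ?_
  unfold truncSeq
  split_ifs <;> fun_prop

lemma xiIter_congr (α γ₁ β a : ℝ) {x y : ℕ → ℝ} {n : ℕ} (h : ∀ i < n, x i = y i) :
    xiIter α γ₁ β a x n = xiIter α γ₁ β a y n := by
  induction n with
  | zero => rfl
  | succ n ih =>
    simp only [xiIter]
    rw [ih fun i hi => h i (by omega), h n (by omega)]

lemma truncSeq_of_lt {n i : ℕ} (h : i < n) (x : ℕ → ℝ) : truncSeq n x i = x i := by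
  simp [truncSeq, h]

lemma measurable_xiIter (α γ₁ β : ℝ) (n : ℕ) :
    Measurable fun p : ℝ × (ℕ → ℝ) => xiIter α γ₁ β p.1 p.2 n := by
  induction n with
  | zero => exact measurable_fst
  | succ n ih =>
    simp only [xiIter]
    exact ih.sub (((measurable_H₁ α).comp
      (ih.prodMk ((measurable_pi_apply n).comp measurable_snd))).const_mul _)

lemma measurable_chiIter (α γ₁ β : ℝ) (n : ℕ) :
    Measurable fun p : ℝ × (ℕ → ℝ) => chiIter α γ₁ β p.1 p.2 n := by
  induction n with
  | zero => exact measurable_const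
  | succ n ih =>
    have h1 := measurable_xiIter α γ₁ β n
    have h2 : Measurable fun p : ℝ × (ℕ → ℝ) => p.2 n :=
      (measurable_pi_apply n).comp measurable_snd
    simp only [chiIter, H₂]
    fun_prop

lemma measurable_xiAvg (α γ₁ β : ℝ) (n : ℕ) :
    Measurable fun p : ℝ × (ℕ → ℝ) => xiAvg α γ₁ β p.1 p.2 n := by
  unfold xiAvg
  exact (Finset.measurable_sum _ fun k _ => measurable_xiIter α γ₁ β k).const_mul _

/-- The VaR iterates as random variables. -/
def xiProc {Ω : Type*} (α γ₁ β : ℝ) (ξ₀ : Ω → ℝ) (X : ℕ → Ω → ℝ) (n : ℕ) (ω : Ω) : ℝ :=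
  xiIter α γ₁ β (ξ₀ ω) (fun i => X i ω) n

lemma xiProc_succ {Ω : Type*} {ξ₀ : Ω → ℝ} {X : ℕ → Ω → ℝ} {α γ₁ β : ℝ} (n : ℕ)
    (ω : Ω) : xiProc α γ₁ β ξ₀ X (n + 1) ω =
    xiProc α γ₁ β ξ₀ X n ω - γ₁ * stepPow β n * H₁ α (xiProc α γ₁ β ξ₀ X n ω) (X n ω) := by
  rw [← rate_succ]; rfl

lemma IsInnovation.measurable_xiProc {Ω : Type*} [MeasurableSpace Ω] {μ : Measure Ω}
    {P : Measure ℝ} {ξ₀ : Ω → ℝ} {X : ℕ → Ω → ℝ} {α γ₁ β : ℝ} (h : IsInnovation μ P ξ₀ X) (n : ℕ) :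
    Measurable (xiProc α γ₁ β ξ₀ X n) :=
  (measurable_xiIter α γ₁ β n).comp
    (h.measurable_init.prodMk (measurable_pi_lambda _ h.measurable))

section Innovation

variable {Ω : Type*} [MeasurableSpace Ω] {μ : Measure Ω} [IsProbabilityMeasure μ]

lemma indepFun_assoc {E F G : Type*} [MeasurableSpace E] [MeasurableSpace F] [MeasurableSpace G]
    {U : Ω → E} {V : Ω → F} {W : Ω → G} (hU : AEMeasurable U μ)
    (hV : AEMeasurable V μ) (hW : AEMeasurable W μ) (h : IndepFun U (fun ω => (V ω, W ω)) μ)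
    (hVW : IndepFun V W μ) :
    IndepFun (fun ω => (U ω, V ω)) W μ := by
  have hUV : IndepFun U V μ := h.comp measurable_id measurable_fst
  rw [indepFun_iff_map_prod_eq_prod_map_map (by fun_prop) (by fun_prop)] at h hVW hUV ⊢
  have := Measure.isProbabilityMeasure_map (μ := μ) hU
  have := Measure.isProbabilityMeasure_map (μ := μ) hV
  have := Measure.isProbabilityMeasure_map (μ := μ) hW
  apply MeasurableEquiv.prodAssoc.map_measurableEquiv_injective
  rw [hUV, Measure.prodAssoc_prod, ← hVW, ← h,
    AEMeasurable.map_map_of_aemeasurable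
      MeasurableEquiv.prodAssoc.measurable.aemeasurable (by fun_prop)]
  rfl

/-- Replaces adaptedness to a filtration: a functional of the initial value and of the first n
innovations, expressed by invariance under `truncSeq n`, is independent of the next innovation. -/
lemma IsInnovation.indepFun_of_trunc {P : Measure ℝ} {ξ₀ : Ω → ℝ} {X : ℕ → Ω → ℝ}
    (h : IsInnovation μ P ξ₀ X) {E : Type*} [MeasurableSpace E] {Φ : ℝ × (ℕ → ℝ) → E}
    (hΦ : Measurable Φ) (n : ℕ) (htr : ∀ a x, Φ (a, x) = Φ (a, truncSeq n x)) :
    IndepFun (fun ω => Φ (ξ₀ ω, fun i => X i ω)) (X n) μ := by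
  have hX := h.measurable
  have hXs : Measurable fun ω i => X i ω := measurable_pi_lambda _ hX
  have h1 : IndepFun (fun ω => truncSeq n (fun i => X i ω)) (X n) μ := by
    have h0 := h.indep.indepFun_finset (Finset.range n) {n} (by simp) hX
    -- Padding with zeros, which expresses the truncated sequence as a function of finitely many
    -- coordinates.
    let f : (Finset.range n → ℝ) → ℕ → ℝ := fun y i => if hi : i < n then y ⟨i, by simpa⟩ else 0
    have hf : Measurable f := by
      refine measurable_pi_lambda _ fun i => ?_
      by_cases hi : i < n
      · simpa only [f, hi, dite_true] using measurable_pi_apply _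
      · simpa only [f, hi, dite_false] using measurable_const
    have h2 := h0.comp hf
      (measurable_pi_apply (⟨n, by simp⟩ : ({n} : Finset ℕ)))
    convert h2 using 1
    · funext ω i
      simp [f, truncSeq]
    · rfl
  have h3 : IndepFun ξ₀ (fun ω => (truncSeq n (fun i => X i ω), X n ω)) μ :=
    h.indep_init.comp measurable_id
      ((measurable_truncSeq n).prodMk (measurable_pi_apply n))
  have h4 := indepFun_assoc h.measurable_init.aemeasurable
    ((measurable_truncSeq n).comp hXs).aemeasurable (hX n).aemeasurable h3 h1
  have h5 := h4.comp hΦ measurable_id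
  convert h5 using 1
  · funext ω
    exact htr _ _
  · rfl

/-! ### Fubini's theorem for independent pairs, in place of conditional expectations -/

section Iterated

variable {E F : Type*} [MeasurableSpace E] [MeasurableSpace F] {W : Ω → E} {X : Ω → F}
  {Ψ : E × F → ℝ}

lemma integrable_prod_of_indepFun (hW : AEMeasurable W μ) (hX : AEMeasurable X μ)
    (h : IndepFun W X μ) (hΨ : Measurable Ψ) (hint : Integrable (fun ω => Ψ (W ω, X ω)) μ) :
    Integrable Ψ ((μ.map W).prod (μ.map X)) := by
  rw [indepFun_iff_map_prod_eq_prod_map_map (by fun_prop) (by fun_prop)] at h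
  rw [← h]
  exact (integrable_map_measure hΨ.aestronglyMeasurable (by fun_prop)).2 hint

lemma integrable_integral_of_indepFun (hW : AEMeasurable W μ) (hX : AEMeasurable X μ)
    (h : IndepFun W X μ) (hΨ : Measurable Ψ) (hint : Integrable (fun ω => Ψ (W ω, X ω)) μ) :
    Integrable (fun ω => ∫ x, Ψ (W ω, x) ∂(μ.map X)) μ := by
  have := Measure.isProbabilityMeasure_map (μ := μ) hX
  have := Measure.isProbabilityMeasure_map (μ := μ) hW
  have h1 := (integrable_prod_of_indepFun hW hX h hΨ hint).integral_prod_left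
  exact (integrable_map_measure h1.aestronglyMeasurable hW).1 h1

lemma integral_eq_iterated_of_indepFun (hW : AEMeasurable W μ) (hX : AEMeasurable X μ)
    (h : IndepFun W X μ) (hΨ : Measurable Ψ) (hint : Integrable (fun ω => Ψ (W ω, X ω)) μ) :
    ∫ ω, Ψ (W ω, X ω) ∂μ = ∫ ω, ∫ x, Ψ (W ω, x) ∂(μ.map X) ∂μ := by
  have := Measure.isProbabilityMeasure_map (μ := μ) hX
  have := Measure.isProbabilityMeasure_map (μ := μ) hW
  have h0 := integrable_prod_of_indepFun hW hX h hΨ hint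
  have h1 := h0.integral_prod_left
  rw [indepFun_iff_map_prod_eq_prod_map_map (by fun_prop) (by fun_prop)] at h
  rw [← integral_map (f := fun w => ∫ x, Ψ (w, x) ∂(μ.map X)) hW
    h1.aestronglyMeasurable, ← integral_prod _ h0, ← h,
    integral_map (by fun_prop) hΨ.aestronglyMeasurable]

end Iterated

variable {P : Measure ℝ} {ξ₀ : Ω → ℝ} {X : ℕ → Ω → ℝ} {α γ₁ β : ℝ}

lemma IsInnovation.indepFun_xiProc (h : IsInnovation μ P ξ₀ X) (n : ℕ) :
    IndepFun (xiProc α γ₁ β ξ₀ X n) (X n) μ :=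
  h.indepFun_of_trunc (measurable_xiIter α γ₁ β n) n fun a x =>
    xiIter_congr α γ₁ β a fun _ hi => (truncSeq_of_lt hi x).symm

/-! ### The Lyapunov bound -/

variable [IsProbabilityMeasure P] {ξ s m M L l : ℝ}

/-- One step moves l ξ_n by at most 1, by the choice of l, so the cosine grows by a factor of at
most e. -/
lemma IsInnovation.integrable_cosh (hα : α ∈ Ioo (0 : ℝ) 1) (hγ₁ : 0 < γ₁) (hβ : 0 ≤ β)
    (hl : 0 < l) (hlγ : l * (γ₁ * gradBound α) ≤ 1) (h : IsInnovation μ P ξ₀ X)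
    (h0 : Integrable (fun ω => Real.cosh (l * (ξ₀ ω - ξ))) μ) (n : ℕ) :
    Integrable (fun ω => Real.cosh (l * (xiProc α γ₁ β ξ₀ X n ω - ξ))) μ := by
  induction n with
  | zero => exact h0
  | succ n ih =>
    have hm := h.measurable_xiProc (α := α) (γ₁ := γ₁) (β := β) (n + 1)
    refine (ih.mul_const (Real.exp 1)).mono' (by fun_prop) (ae_of_all _ fun ω => ?_)
    rw [Real.norm_of_nonneg (Real.cosh_pos _).le, xiProc_succ]
    set y := xiProc α γ₁ β ξ₀ X n ω
    have hb : |l * (γ₁ * stepPow β n * H₁ α y (X n ω))| ≤ 1 := by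
      have hs := stepPow_pos β n
      rw [abs_mul, abs_mul, abs_of_pos hl, abs_of_pos (by positivity)]
      refine le_trans ?_ hlγ
      have h1 : γ₁ * stepPow β n ≤ γ₁ := mul_le_of_le_one_right hγ₁.le (stepPow_le_one hβ n)
      have h2 := abs_H₁_le hα y (X n ω)
      gcongr
    rw [show l * (y - γ₁ * stepPow β n * H₁ α y (X n ω) - ξ)
      = l * (y - ξ) - l * (γ₁ * stepPow β n * H₁ α y (X n ω)) by ring]
    refine (cosh_sub_le_mul_exp _ _).trans ?_
    gcongr

lemma abs_sinh_le_cosh (x : ℝ) : |Real.sinh x| ≤ Real.cosh x := by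
  rw [abs_le]
  have h1 := Real.sinh_lt_cosh x
  have h2 := Real.sinh_lt_cosh (-x)
  rw [Real.sinh_neg, Real.cosh_neg] at h2
  constructor <;> linarith

lemma RegularLaw.drift_cosh (hl : 0 < l) (h : RegularLaw P α ξ s m M L) (hm : 0 ≤ m) (y : ℝ) :
    m * (min l 1 * (Real.cosh (l * (y - ξ)) - 1))
      ≤ l * ((P.real (Iic y) - α) * Real.sinh (l * (y - ξ))) := by
  have hmono := measureReal_Iic_mono P
  have h1 : (P.real (Iic y) - α) * Real.sinh (l * (y - ξ))
      = |P.real (Iic y) - α| * Real.sinh (l * |y - ξ|) := by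
    rcases le_total ξ y with hy | hy
    · have := hmono hy
      simp only [h.quantile] at this
      rw [abs_of_nonneg (by linarith), abs_of_nonneg (by linarith)]
    · have := hmono hy
      simp only [h.quantile] at this
      rw [abs_of_nonpos (by linarith), abs_of_nonpos (by linarith : y - ξ ≤ 0), mul_neg,
        Real.sinh_neg]
      ring
  have hs : 0 ≤ Real.sinh (l * |y - ξ|) := Real.sinh_nonneg_iff.2 (by positivity)
  rw [h1]
  calc m * (min l 1 * (Real.cosh (l * (y - ξ)) - 1))
      ≤ m * (l * (min |y - ξ| 1 * Real.sinh (l * |y - ξ|))) :=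
        mul_le_mul_of_nonneg_left (drift_cosh_le hl) hm
    _ = l * ((m * min |y - ξ| 1) * Real.sinh (l * |y - ξ|)) := by ring
    _ ≤ _ := by gcongr; exact h.drift y

/-- Expand the cosine to second order along one step. Integrating out the fresh innovation turns the
first-order term into the mean field, which contracts by `RegularLaw.drift_cosh`; the second-order
term is bounded because `H₁` is. -/
lemma IsInnovation.lyapunov_step (hα : α ∈ Ioo (0 : ℝ) 1) (hγ₁ : 0 < γ₁) (hβ : 0 ≤ β)
    (hl : 0 < l) (hlγ : l * (γ₁ * gradBound α) ≤ 1) (hm : 0 ≤ m) (h : IsInnovation μ P ξ₀ X)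
    (hP : RegularLaw P α ξ s m M L)
    (h0 : Integrable (fun ω => Real.cosh (l * (ξ₀ ω - ξ))) μ) (n : ℕ) :
    ∫ ω, (Real.cosh (l * (xiProc α γ₁ β ξ₀ X (n + 1) ω - ξ)) - 1) ∂μ ≤
      (1 - γ₁ * m * min l 1 / (1 - α) * stepPow β n
          + (l * (γ₁ * gradBound α)) ^ 2 * stepPow β n ^ 2)
        * ∫ ω, (Real.cosh (l * (xiProc α γ₁ β ξ₀ X n ω - ξ)) - 1) ∂μ
      + (l * (γ₁ * gradBound α)) ^ 2 * stepPow β n ^ 2 := by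
  have hα' : 0 < 1 - α := by linarith [hα.2]
  have hg := stepPow_pos β n
  have hc := h.integrable_cosh (β := β) hα hγ₁ hβ hl hlγ h0 n
  have hc1 := h.integrable_cosh (β := β) hα hγ₁ hβ hl hlγ h0 (n + 1)
  have hξm := h.measurable_xiProc (α := α) (γ₁ := γ₁) (β := β) n
  have hXm := h.measurable n
  set Y := xiProc α γ₁ β ξ₀ X n with hY
  set g := stepPow β n with hgdef
  have hHm : Measurable fun p : ℝ × ℝ => H₁ α p.1 p.2 := measurable_H₁ α
  have hb : ∀ ω, |l * (γ₁ * g * H₁ α (Y ω) (X n ω))| ≤ l * (γ₁ * gradBound α) * g := fun ω => by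
    rw [abs_mul, abs_mul, abs_of_pos hl, abs_of_pos (by positivity)]
    have h2 := abs_H₁_le hα (Y ω) (X n ω)
    calc l * (γ₁ * g * |H₁ α (Y ω) (X n ω)|) ≤ l * (γ₁ * g * gradBound α) := by gcongr
      _ = _ := by ring
  have hq : 0 ≤ l * (γ₁ * gradBound α) := by
    have := gradBound_pos hα
    positivity
  have hb1 : ∀ ω, |l * (γ₁ * g * H₁ α (Y ω) (X n ω))| ≤ 1 := fun ω =>
    (hb ω).trans (by
      have := stepPow_le_one hβ n
      calc _ ≤ 1 * 1 := mul_le_mul hlγ this hg.le zero_le_one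
        _ = 1 := one_mul 1)
  have hsH : Integrable (fun ω => H₁ α (Y ω) (X n ω) * Real.sinh (l * (Y ω - ξ))) μ := by
    refine (hc.const_mul (gradBound α)).mono'
      ((hHm.comp (hξm.prodMk hXm)).mul (by fun_prop)).aestronglyMeasurable (ae_of_all _ fun ω => ?_)
    rw [norm_mul, Real.norm_eq_abs, Real.norm_eq_abs]
    exact mul_le_mul (abs_H₁_le hα _ _) (abs_sinh_le_cosh _) (abs_nonneg _) (gradBound_pos hα).le
  have hint := integral_eq_iterated_of_indepFun
    (Ψ := fun p => H₁ α p.1 p.2 * Real.sinh (l * (p.1 - ξ))) hξm.aemeasurable hXm.aemeasurable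
    (h.indepFun_xiProc n) (hHm.mul (by fun_prop)) hsH
  have hint2 := integrable_integral_of_indepFun
    (Ψ := fun p => H₁ α p.1 p.2 * Real.sinh (l * (p.1 - ξ))) hξm.aemeasurable hXm.aemeasurable
    (h.indepFun_xiProc n) (hHm.mul (by fun_prop)) hsH
  simp only [integral_mul_const, h.law n, hP.integral_H₁ hα] at hint hint2
  have hdrift : γ₁ * m * min l 1 / (1 - α) * g * ∫ ω, (Real.cosh (l * (Y ω - ξ)) - 1) ∂μ
      ≤ l * γ₁ * g * ∫ ω, H₁ α (Y ω) (X n ω) * Real.sinh (l * (Y ω - ξ)) ∂μ := by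
    rw [hint, ← integral_const_mul, ← integral_const_mul]
    refine integral_mono ((hc.sub (integrable_const 1)).const_mul _) (hint2.const_mul _)
      fun ω => ?_
    have h1 := hP.drift_cosh hl hm (Y ω)
    have h2 : 0 ≤ γ₁ * g / (1 - α) := by positivity
    calc γ₁ * m * min l 1 / (1 - α) * g * (Real.cosh (l * (Y ω - ξ)) - 1)
        = γ₁ * g / (1 - α) * (m * (min l 1 * (Real.cosh (l * (Y ω - ξ)) - 1))) := by ring
      _ ≤ γ₁ * g / (1 - α) * (l * ((P.real (Iic (Y ω)) - α) * Real.sinh (l * (Y ω - ξ)))) :=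
        mul_le_mul_of_nonneg_left h1 h2
      _ = _ := by ring
  have hstep : ∫ ω, (Real.cosh (l * (xiProc α γ₁ β ξ₀ X (n + 1) ω - ξ)) - 1) ∂μ
      ≤ ∫ ω, ((Real.cosh (l * (Y ω - ξ)) - 1
        - l * γ₁ * g * (H₁ α (Y ω) (X n ω) * Real.sinh (l * (Y ω - ξ))))
        + (l * (γ₁ * gradBound α) * g) ^ 2 * Real.cosh (l * (Y ω - ξ))) ∂μ := by
    refine integral_mono (hc1.sub (integrable_const 1))
      (((hc.sub (integrable_const 1)).sub (hsH.const_mul _)).add (hc.const_mul _)) fun ω => ?_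
    have e : l * (xiProc α γ₁ β ξ₀ X (n + 1) ω - ξ)
        = l * (Y ω - ξ) - l * (γ₁ * g * H₁ α (Y ω) (X n ω)) := by rw [xiProc_succ]; ring
    have h1 := cosh_sub_le (a := l * (Y ω - ξ)) (hb1 ω)
    have h2 : (l * (γ₁ * g * H₁ α (Y ω) (X n ω))) ^ 2 ≤ (l * (γ₁ * gradBound α) * g) ^ 2 :=
      sq_le_sq.2 ((hb ω).trans (le_abs_self _))
    have h3 := mul_le_mul_of_nonneg_right h2 (Real.cosh_pos (l * (Y ω - ξ))).le
    simp only [e]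
    linarith
  have hi1 : Integrable (fun ω => Real.cosh (l * (Y ω - ξ)) - 1) μ := hc.sub (integrable_const 1)
  have hi2 : Integrable (fun ω => Real.cosh (l * (Y ω - ξ)) - 1
      - l * γ₁ * g * (H₁ α (Y ω) (X n ω) * Real.sinh (l * (Y ω - ξ)))) μ :=
    hi1.sub (hsH.const_mul _)
  rw [integral_add hi2 (hc.const_mul _), integral_sub hi1 (hsH.const_mul _), integral_const_mul,
    integral_const_mul] at hstep
  -- Writing cosh = (cosh - 1) + 1 splits the second-order error into the multiplicative and the
  -- additive term of the recursion.
  have hone : ∫ ω, Real.cosh (l * (Y ω - ξ)) ∂μ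
      = ∫ ω, (Real.cosh (l * (Y ω - ξ)) - 1) ∂μ + 1 := by
    rw [integral_sub hc (integrable_const 1)]; simp
  rw [hone] at hstep
  nlinarith

lemma IsInnovation.integrable_sq (hα : α ∈ Ioo (0 : ℝ) 1) (hγ₁ : 0 < γ₁) (hβ : 0 ≤ β)
    (hl : 0 < l) (hlγ : l * (γ₁ * gradBound α) ≤ 1) (h : IsInnovation μ P ξ₀ X)
    (h0 : Integrable (fun ω => Real.cosh (l * (ξ₀ ω - ξ))) μ) (n : ℕ) :
    Integrable (fun ω => (xiProc α γ₁ β ξ₀ X n ω - ξ) ^ 2) μ := by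
  have hc := h.integrable_cosh (β := β) hα hγ₁ hβ hl hlγ h0 n
  have hm := h.measurable_xiProc (α := α) (γ₁ := γ₁) (β := β) n
  refine ((hc.sub (integrable_const 1)).const_mul (2 / l ^ 2)).mono' (by fun_prop)
    (ae_of_all _ fun ω => ?_)
  rw [Real.norm_of_nonneg (sq_nonneg _)]
  have := sq_le_cosh_sub_one (l * (xiProc α γ₁ β ξ₀ X n ω - ξ))
  simp only [Pi.sub_apply]
  rw [div_mul_eq_mul_div, le_div_iff₀ (by positivity)]
  nlinarith

end Innovation

/-- The order of the quantifiers is the point: A is chosen before the law, the initial value and the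
target, so a single rate serves every bias level h. -/
lemma exists_integral_sq_le {Ω : Type*} [MeasurableSpace Ω] (μ : Measure Ω)
    [IsProbabilityMeasure μ] {α γ₁ β l m : ℝ} (hα : α ∈ Ioo (0 : ℝ) 1) (hγ₁ : 0 < γ₁)
    (hβ : β ∈ Ioo (1 / 2 : ℝ) 1) (hl : 0 < l) (hlγ : l * (γ₁ * gradBound α) ≤ 1) (hm : 0 < m)
    (B : ℝ) :
    ∃ A : ℝ, 0 ≤ A ∧ ∀ (P : Measure ℝ) [IsProbabilityMeasure P] (ξ₀ : Ω → ℝ) (X : ℕ → Ω → ℝ)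
      (ξ s M L : ℝ), IsInnovation μ P ξ₀ X → RegularLaw P α ξ s m M L →
      Integrable (fun ω => Real.cosh (l * (ξ₀ ω - ξ))) μ →
      ∫ ω, Real.cosh (l * (ξ₀ ω - ξ)) ∂μ ≤ B →
      ∀ n, ∫ ω, (xiProc α γ₁ β ξ₀ X n ω - ξ) ^ 2 ∂μ ≤ A * stepPow β n := by
  have hα' : 0 < 1 - α := by linarith [hα.2]
  have hβ0 : 0 < β := by linarith [hβ.1]
  obtain ⟨A, hA, hrec⟩ := recursion_bound (c := γ₁ * m * min l 1 / (1 - α))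
    (C := (l * (γ₁ * gradBound α)) ^ 2) (β := β) (by have := lt_min hl one_pos; positivity)
    (sq_nonneg _) hβ0 hβ.2 B
  refine ⟨2 / l ^ 2 * A, by positivity, fun P _ ξ₀ X ξ s M L h hP h0 hB n => ?_⟩
  have hc := h.integrable_cosh (β := β) hα hγ₁ hβ0.le hl hlγ h0
  have hu := hrec (fun n => ∫ ω, (Real.cosh (l * (xiProc α γ₁ β ξ₀ X n ω - ξ)) - 1) ∂μ)
    (le_trans (integral_mono ((hc 0).sub (integrable_const 1)) (hc 0) fun ω => by
      simp) hB)
    (fun n => integral_nonneg fun ω => sub_nonneg.2 (Real.one_le_cosh _))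
    (fun n => h.lyapunov_step hα hγ₁ hβ0.le hl hlγ hm.le hP h0 n) n
  calc ∫ ω, (xiProc α γ₁ β ξ₀ X n ω - ξ) ^ 2 ∂μ
      ≤ ∫ ω, 2 / l ^ 2 * (Real.cosh (l * (xiProc α γ₁ β ξ₀ X n ω - ξ)) - 1) ∂μ := by
        refine integral_mono (h.integrable_sq hα hγ₁ hβ0.le hl hlγ h0 n)
          (((hc n).sub (integrable_const 1)).const_mul _) fun ω => ?_
        have := sq_le_cosh_sub_one (l * (xiProc α γ₁ β ξ₀ X n ω - ξ))
        rw [div_mul_eq_mul_div, le_div_iff₀ (by positivity)]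
        nlinarith
    _ ≤ 2 / l ^ 2 * (A * stepPow β n) := by
        rw [integral_const_mul]
        exact mul_le_mul_of_nonneg_left hu (by positivity)
    _ = _ := by ring

/-! ### Remainders of the averaged scheme -/

section SecondMoment

variable {Ω : Type*} [MeasurableSpace Ω] {μ : Measure Ω} [IsProbabilityMeasure μ]

lemma integral_sub_integral_sq_le {f : Ω → ℝ} (hf : MemLp f 2 μ) :
    ∫ ω, (f ω - ∫ x, f x ∂μ) ^ 2 ∂μ ≤ ∫ ω, f ω ^ 2 ∂μ := by
  rw [← variance_eq_integral hf.aestronglyMeasurable.aemeasurable]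
  exact variance_le_expectation_sq hf.aestronglyMeasurable

lemma integral_abs_le_sqrt {f : Ω → ℝ} (hf : MemLp f 2 μ) :
    ∫ ω, |f ω| ∂μ ≤ √(∫ ω, f ω ^ 2 ∂μ) := by
  refine Real.le_sqrt_of_sq_le ?_
  have h := variance_nonneg (fun ω => |f ω|) μ
  rw [variance_eq_sub (X := fun ω => |f ω|) hf.abs] at h
  simpa using h

end SecondMoment

/-! ### Orthogonality of martingale increments -/

section Martingale

variable {Ω : Type*} [MeasurableSpace Ω] {μ : Measure Ω} [IsProbabilityMeasure μ]
  {P : Measure ℝ} {ξ₀ : Ω → ℝ} {X : ℕ → Ω → ℝ} {α γ₁ β : ℝ} {D : ℝ → ℝ → ℝ}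

/-- Given the past, each increment is centred because D is centred in the innovation for every
frozen iterate; hence the cross terms vanish. The pair formed by the current iterate and the partial
sum depends on the first n innovations only. -/
lemma IsInnovation.integral_sum_sq (h : IsInnovation μ P ξ₀ X)
    (hD : Measurable (Function.uncurry D)) (hD0 : ∀ y, ∫ x, D y x ∂P = 0)
    (hint : ∀ k, MemLp (fun ω => D (xiProc α γ₁ β ξ₀ X k ω) (X k ω)) 2 μ) (n : ℕ) :
    ∫ ω, (∑ k ∈ Finset.range n, D (xiProc α γ₁ β ξ₀ X k ω) (X k ω)) ^ 2 ∂μ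
      = ∑ k ∈ Finset.range n, ∫ ω, D (xiProc α γ₁ β ξ₀ X k ω) (X k ω) ^ 2 ∂μ := by
  induction n with
  | zero => simp
  | succ n ih =>
    set Y := xiProc α γ₁ β ξ₀ X with hY
    have hS : MemLp (fun ω => ∑ k ∈ Finset.range n, D (Y k ω) (X k ω)) 2 μ :=
      memLp_finsetSum _ fun k _ => hint k
    have hSD : Integrable
        (fun ω => (∑ k ∈ Finset.range n, D (Y k ω) (X k ω)) * D (Y n ω) (X n ω)) μ :=
      hS.integrable_mul (hint n)
    have hYm : ∀ k, Measurable (Y k) := fun k => h.measurable_xiProc k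
    have hcross : ∫ ω, (∑ k ∈ Finset.range n, D (Y k ω) (X k ω)) * D (Y n ω) (X n ω) ∂μ = 0 := by
      let Φ : ℝ × (ℕ → ℝ) → ℝ × ℝ := fun p => (xiIter α γ₁ β p.1 p.2 n,
        ∑ k ∈ Finset.range n, D (xiIter α γ₁ β p.1 p.2 k) (p.2 k))
      have hΦ : Measurable Φ := (measurable_xiIter α γ₁ β n).prodMk
        (Finset.measurable_sum _ fun k _ => hD.comp ((measurable_xiIter α γ₁ β k).prodMk
          ((measurable_pi_apply k).comp measurable_snd)))
      have hind := h.indepFun_of_trunc hΦ n fun a x => by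
        simp only [Φ, Prod.mk.injEq]
        refine ⟨xiIter_congr α γ₁ β a fun _ hi => (truncSeq_of_lt hi x).symm,
          Finset.sum_congr rfl fun k hk => ?_⟩
        have hk' := Finset.mem_range.1 hk
        rw [truncSeq_of_lt hk', xiIter_congr α γ₁ β a (y := truncSeq n x)
          fun _ hi => (truncSeq_of_lt (hi.trans hk') x).symm]
      have hWm : Measurable fun ω => Φ (ξ₀ ω, fun i => X i ω) :=
        hΦ.comp (h.measurable_init.prodMk (measurable_pi_lambda _ h.measurable))
      have hit := integral_eq_iterated_of_indepFun (Ψ := fun q : (ℝ × ℝ) × ℝ => q.1.2 * D q.1.1 q.2)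
        hWm.aemeasurable (h.measurable n).aemeasurable hind
        (by
          have : Measurable fun q : (ℝ × ℝ) × ℝ => D q.1.1 q.2 :=
            hD.comp ((measurable_fst.comp measurable_fst).prodMk measurable_snd)
          fun_prop) hSD
      simp only [h.law n, integral_const_mul, hD0, mul_zero, integral_zero] at hit
      exact hit
    rw [Finset.sum_range_succ, ← ih]
    simp_rw [Finset.sum_range_succ, add_sq, mul_assoc]
    have hi1 : Integrable (fun ω => (∑ k ∈ Finset.range n, D (Y k ω) (X k ω)) ^ 2) μ :=
      hS.integrable_sq
    have hi3 : Integrable (fun ω => D (Y n ω) (X n ω) ^ 2) μ := (hint n).integrable_sq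
    have hi2 := hSD.const_mul 2
    rw [integral_add (f := fun ω => (∑ k ∈ Finset.range n, D (Y k ω) (X k ω)) ^ 2 +
      2 * ((∑ k ∈ Finset.range n, D (Y k ω) (X k ω)) * D (Y n ω) (X n ω))) (hi1.add hi2) hi3,
      integral_add hi1 hi2, integral_const_mul, hcross]
    ring

lemma IsInnovation.integral_comp_le (h : IsInnovation μ P ξ₀ X)
    (hD : Measurable (Function.uncurry D)) {k : ℕ} {κ : ℝ → ℝ}
    (hint : MemLp (fun ω => D (xiProc α γ₁ β ξ₀ X k ω) (X k ω)) 2 μ)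
    (hκ : ∀ y, ∫ x, D y x ^ 2 ∂P ≤ κ y)
    (hκi : Integrable (fun ω => κ (xiProc α γ₁ β ξ₀ X k ω)) μ) :
    ∫ ω, D (xiProc α γ₁ β ξ₀ X k ω) (X k ω) ^ 2 ∂μ
      ≤ ∫ ω, κ (xiProc α γ₁ β ξ₀ X k ω) ∂μ := by
  have hm : Measurable fun q : ℝ × ℝ => D q.1 q.2 ^ 2 := hD.pow_const 2
  have h1 := integral_eq_iterated_of_indepFun
    (h.measurable_xiProc (α := α) (γ₁ := γ₁) (β := β) k).aemeasurable
    (h.measurable k).aemeasurable (h.indepFun_xiProc k) hm hint.integrable_sq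
  have h2 := integrable_integral_of_indepFun
    (h.measurable_xiProc (α := α) (γ₁ := γ₁) (β := β) k).aemeasurable
    (h.measurable k).aemeasurable (h.indepFun_xiProc k) hm hint.integrable_sq
  rw [h.law k] at h1 h2
  rw [h1]
  exact integral_mono h2 hκi fun ω => hκ _

end Martingale

/-! ### Deterministic identities for the scheme -/

/-- Summation by parts; G will be the inverse step, whose increments are small while G itself grows.
-/
lemma sum_mul_sub_succ (G x : ℕ → ℝ) (n : ℕ) :
    ∑ k ∈ Finset.range n, G k * (x k - x (k + 1)) = G 0 * x 0 - G n * x n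
      + ∑ k ∈ Finset.range n, (G (k + 1) - G k) * x (k + 1) := by
  induction n with
  | zero => simp
  | succ n ih => rw [Finset.sum_range_succ, ih, Finset.sum_range_succ]; ring

lemma stepPow_eq_sq (β : ℝ) (n : ℕ) : stepPow β n = stepPow (β / 2) n ^ 2 := by
  unfold stepPow
  rw [← Real.rpow_natCast, ← Real.rpow_mul (by positivity)]
  congr 1; push_cast; ring

lemma stepPow_inv_sub_le {β : ℝ} (hβ0 : 0 ≤ β) (hβ : β ≤ 1) (k : ℕ) :
    (stepPow β (k + 1))⁻¹ - (stepPow β k)⁻¹ ≤ stepPow (1 - β) k := by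
  have h1 : (0 : ℝ) < (k : ℝ) + 1 := by positivity
  unfold stepPow
  push_cast
  rw [Real.rpow_neg (by positivity), Real.rpow_neg h1.le, inv_inv, inv_inv]
  have hB := rpow_one_add_le_one_add_mul_self (s := 1 / ((k : ℝ) + 1)) (p := β)
    (le_trans (by norm_num) (by positivity : (0 : ℝ) ≤ 1 / ((k : ℝ) + 1))) hβ0 hβ
  have h2 : (k : ℝ) + 1 + 1 = (k + 1) * (1 + 1 / ((k : ℝ) + 1)) := by field_simp
  rw [h2, Real.mul_rpow h1.le (by positivity)]
  have h3 : ((k : ℝ) + 1) ^ (-(1 - β)) = ((k : ℝ) + 1) ^ β * (1 / (k + 1)) := by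
    rw [neg_sub, Real.rpow_sub_one h1.ne']; ring
  rw [h3]
  have h4 : 0 < ((k : ℝ) + 1) ^ β := by positivity
  have h5 := mul_le_mul_of_nonneg_left hB h4.le
  have h6 : β * (1 / ((k : ℝ) + 1)) ≤ 1 / ((k : ℝ) + 1) :=
    mul_le_of_le_one_left (by positivity) hβ
  have h7 := mul_le_mul_of_nonneg_left h6 h4.le
  nlinarith

lemma stepPow_inv_mono {β : ℝ} (hβ0 : 0 ≤ β) (k : ℕ) :
    (stepPow β k)⁻¹ ≤ (stepPow β (k + 1))⁻¹ :=
  inv_anti₀ (stepPow_pos _ _) (stepPow_anti hβ0 k.le_succ)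

/-- With step 1/(n+1) the ES recursion is a running mean in disguise. -/
lemma natCast_mul_chiIter (α γ₁ β a : ℝ) (x : ℕ → ℝ) (n : ℕ) :
    n * chiIter α γ₁ β a x n
      = ∑ k ∈ Finset.range n, lossG α (xiIter α γ₁ β a x k) (x k) := by
  induction n with
  | zero => simp
  | succ n ih =>
    rw [Finset.sum_range_succ, ← ih]
    have h1 : (n : ℝ) + 1 ≠ 0 := by positivity
    simp only [chiIter, H₂, lossG]
    push_cast
    field_simp
    ring

lemma sum_Icc_eq_sum_range (x : ℕ → ℝ) (n : ℕ) :
    ∑ k ∈ Finset.Icc 1 n, x k = ∑ k ∈ Finset.range n, x k + (x n - x 0) := by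
  induction n with
  | zero => simp
  | succ n ih => rw [Finset.sum_Icc_succ_top (by omega), ih, Finset.sum_range_succ]; ring

/-! ### First order remainders -/

section Remainder

variable {Ω : Type*} [MeasurableSpace Ω] {μ : Measure Ω} [IsProbabilityMeasure μ]
  {P : Measure ℝ} [IsProbabilityMeasure P] {ξ₀ : Ω → ℝ} {X : ℕ → Ω → ℝ}
  {α γ₁ β ξ s m M L A : ℝ}

/-- The centred gradient increment. -/
def gradNoise (P : Measure ℝ) (α ξ y x : ℝ) : ℝ :=
  H₁ α y x - H₁ α ξ x - (P.real (Iic y) - α) / (1 - α)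

/-- The centred objective increment. -/
def lossNoise (P : Measure ℝ) (α ξ y x : ℝ) : ℝ :=
  lossG α y x - lossG α ξ x - (lawObjective P α y - lawObjective P α ξ)

lemma measurable_gradNoise : Measurable (Function.uncurry (gradNoise P α ξ)) := by
  have h1 : Measurable fun p : ℝ × ℝ => H₁ α p.1 p.2 := measurable_H₁ α
  have h2 : Measurable fun p : ℝ × ℝ => H₁ α ξ p.2 :=
    (measurable_H₁ α).of_uncurry_left.comp measurable_snd
  have h3 : Measurable fun y => P.real (Iic y) := (measureReal_Iic_mono P).measurable
  exact (h1.sub h2).sub (((h3.comp measurable_fst).sub_const α).div_const _)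

lemma measurable_lawObjective : Measurable (lawObjective P α) :=
  ((measurable_lossG α).stronglyMeasurable.integral_prod_right (ν := P)).measurable

lemma measurable_lossNoise : Measurable (Function.uncurry (lossNoise P α ξ)) := by
  have h1 : Measurable fun p : ℝ × ℝ => lossG α p.1 p.2 := measurable_lossG α
  have h2 : Measurable fun p : ℝ × ℝ => lossG α ξ p.2 :=
    (measurable_lossG α).of_uncurry_left.comp measurable_snd
  have h3 : Measurable (lawObjective P α) := measurable_lawObjective
  unfold lossNoise Function.uncurry
  fun_prop

namespace RegularLaw

lemma integral_H₁_self (hα : α ∈ Ioo (0 : ℝ) 1) (h : RegularLaw P α ξ s m M L) :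
    ∫ x, H₁ α ξ x ∂P = 0 := by
  rw [h.integral_H₁ hα, h.quantile]; simp

lemma integral_gradNoise (hα : α ∈ Ioo (0 : ℝ) 1) (h : RegularLaw P α ξ s m M L) (y : ℝ) :
    ∫ x, gradNoise P α ξ y x ∂P = 0 := by
  unfold gradNoise
  rw [integral_sub (f := fun x => H₁ α y x - H₁ α ξ x)
    ((integrable_H₁ hα y).sub (integrable_H₁ hα ξ)) (integrable_const _),
    integral_sub (integrable_H₁ hα y) (integrable_H₁ hα ξ), h.integral_H₁_self hα,
    h.integral_H₁ hα]
  simp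

lemma integral_lossNoise (h : RegularLaw P α ξ s m M L) (y : ℝ) :
    ∫ x, lossNoise P α ξ y x ∂P = 0 := by
  unfold lossNoise
  have hi := integrable_lossG (α := α) h.integrable
  rw [integral_sub (f := fun x => lossG α y x - lossG α ξ x) ((hi y).sub (hi ξ))
    (integrable_const _), integral_sub (hi y) (hi ξ)]
  simp [lawObjective]

lemma abs_gradNoise_le (hα : α ∈ Ioo (0 : ℝ) 1) (h : RegularLaw P α ξ s m M L) (y x : ℝ) :
    |gradNoise P α ξ y x| ≤ 3 * gradBound α := by
  have h1 := abs_H₁_le hα y x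
  have h2 := abs_H₁_le hα ξ x
  have h3 : |(P.real (Iic y) - α) / (1 - α)| ≤ gradBound α := by
    rw [← h.integral_H₁ hα]
    refine (abs_integral_le_integral_abs).trans ?_
    calc _ ≤ ∫ _, gradBound α ∂P :=
          integral_mono (integrable_H₁ hα y).abs (integrable_const _) fun x => abs_H₁_le hα y x
      _ = gradBound α := by simp
  unfold gradNoise
  calc _ ≤ |H₁ α y x - H₁ α ξ x| + |(P.real (Iic y) - α) / (1 - α)| := abs_sub _ _
    _ ≤ (|H₁ α y x| + |H₁ α ξ x|) + |(P.real (Iic y) - α) / (1 - α)| := by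
      gcongr; exact abs_sub _ _
    _ ≤ _ := by linarith

/-- Centring does not increase the second moment, and that of the indicator difference is linear in
|y - ξ|. -/
lemma integral_gradNoise_sq_le (hα : α ∈ Ioo (0 : ℝ) 1) (h : RegularLaw P α ξ s m M L) (y : ℝ) :
    ∫ x, gradNoise P α ξ y x ^ 2 ∂P ≤ (1 - α)⁻¹ ^ 2 * (M * |y - ξ|) := by
  have hmem : MemLp (fun x => H₁ α y x - H₁ α ξ x) 2 P :=
    MemLp.of_bound (((measurable_H₁ α).of_uncurry_left.sub
      (measurable_H₁ α).of_uncurry_left)).aestronglyMeasurable (gradBound α + gradBound α)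
      (ae_of_all _ fun x => (abs_sub _ _).trans
        (add_le_add (abs_H₁_le hα y x) (abs_H₁_le hα ξ x)))
  have h1 := integral_sub_integral_sq_le hmem
  have h2 : ∫ x, (H₁ α y x - H₁ α ξ x) ∂P = (P.real (Iic y) - α) / (1 - α) := by
    rw [integral_sub (integrable_H₁ hα y) (integrable_H₁ hα ξ), h.integral_H₁_self hα,
      h.integral_H₁ hα, sub_zero]
  rw [h2] at h1
  exact h1.trans (h.integral_H₁_sub_sq_le hα y ξ)

lemma abs_lawObjective_sub_le (hα : α ∈ Ioo (0 : ℝ) 1) (h : RegularLaw P α ξ s m M L) (y : ℝ) :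
    |lawObjective P α y - lawObjective P α ξ| ≤ gradBound α * |y - ξ| := by
  have hi := integrable_lossG (α := α) h.integrable
  unfold lawObjective
  rw [← integral_sub (hi y) (hi ξ)]
  refine (abs_integral_le_integral_abs).trans ?_
  calc _ ≤ ∫ _, gradBound α * |y - ξ| ∂P :=
        integral_mono ((hi y).sub (hi ξ)).abs (integrable_const _)
          fun x => abs_lossG_sub_le hα ξ y x
    _ = _ := by simp

lemma abs_lossNoise_le (hα : α ∈ Ioo (0 : ℝ) 1) (h : RegularLaw P α ξ s m M L) (y x : ℝ) :
    |lossNoise P α ξ y x| ≤ 2 * gradBound α * |y - ξ| := by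
  have h1 := abs_lossG_sub_le hα ξ y x
  have h2 := h.abs_lawObjective_sub_le hα y
  unfold lossNoise
  refine (abs_sub _ _).trans ?_
  linarith

lemma linear_const_nonneg (h : RegularLaw P α ξ s m M L) : 0 ≤ L := by
  have := (abs_nonneg _).trans (h.linear (ξ + 1))
  simpa using this

end RegularLaw

lemma sqrt_natCast_rpow (n : ℕ) (r : ℝ) : √((n : ℝ) ^ r) = (n : ℝ) ^ (r / 2) := by
  rw [Real.sqrt_eq_rpow, ← Real.rpow_mul (by positivity)]; ring_nf

lemma memLp_of_sq (h : IsInnovation μ P ξ₀ X)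
    (hsq : ∀ n, Integrable (fun ω => (xiProc α γ₁ β ξ₀ X n ω - ξ) ^ 2) μ) (n : ℕ) :
    MemLp (fun ω => xiProc α γ₁ β ξ₀ X n ω - ξ) 2 μ :=
  (memLp_two_iff_integrable_sq
    ((h.measurable_xiProc n).sub_const ξ).aestronglyMeasurable).2 (hsq n)

lemma integral_abs_xiProc_le (h : IsInnovation μ P ξ₀ X)
    (hsq : ∀ n, Integrable (fun ω => (xiProc α γ₁ β ξ₀ X n ω - ξ) ^ 2) μ)
    (hA : ∀ n, ∫ ω, (xiProc α γ₁ β ξ₀ X n ω - ξ) ^ 2 ∂μ ≤ A * stepPow β n) (n : ℕ) :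
    ∫ ω, |xiProc α γ₁ β ξ₀ X n ω - ξ| ∂μ ≤ √A * stepPow (β / 2) n := by
  refine (integral_abs_le_sqrt (memLp_of_sq h hsq n)).trans ?_
  refine (Real.sqrt_le_sqrt (hA n)).trans ?_
  rw [stepPow_eq_sq, Real.sqrt_mul' _ (sq_nonneg _), Real.sqrt_sq (stepPow_pos _ _).le]

/-- The increments have variance of order E|ξ_k - ξ|, that is k^(-β/2). Summing and taking the
square root leaves n^(1/2 - β/4). -/
lemma integral_abs_sum_gradNoise_le (hα : α ∈ Ioo (0 : ℝ) 1) (hβ : β ∈ Ioo (1 / 2 : ℝ) 1)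
    (h : IsInnovation μ P ξ₀ X) (hP : RegularLaw P α ξ s m M L)
    (hsq : ∀ n, Integrable (fun ω => (xiProc α γ₁ β ξ₀ X n ω - ξ) ^ 2) μ)
    (hA : ∀ n, ∫ ω, (xiProc α γ₁ β ξ₀ X n ω - ξ) ^ 2 ∂μ ≤ A * stepPow β n) (n : ℕ) :
    ∫ ω, |∑ k ∈ Finset.range n, gradNoise P α ξ (xiProc α γ₁ β ξ₀ X k ω) (X k ω)| ∂μ
      ≤ √((1 - α)⁻¹ ^ 2 * M * √A / (1 - β / 2)) * (n : ℝ) ^ (1 / 2 - β / 4) := by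
  have hM := hP.bound_nonneg
  have hβ2 : 0 < 1 - β / 2 := by linarith [hβ.2]
  have hmem : ∀ k, MemLp (fun ω => gradNoise P α ξ (xiProc α γ₁ β ξ₀ X k ω) (X k ω)) 2 μ :=
    fun k => MemLp.of_bound (measurable_gradNoise.comp
      ((h.measurable_xiProc k).prodMk (h.measurable k))).aestronglyMeasurable (3 * gradBound α)
      (ae_of_all _ fun ω => hP.abs_gradNoise_le hα _ _)
  refine (integral_abs_le_sqrt (memLp_finsetSum _ fun k _ => hmem k)).trans ?_
  rw [h.integral_sum_sq measurable_gradNoise (hP.integral_gradNoise hα) hmem]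
  have hk : ∀ k, ∫ ω, gradNoise P α ξ (xiProc α γ₁ β ξ₀ X k ω) (X k ω) ^ 2 ∂μ
      ≤ (1 - α)⁻¹ ^ 2 * M * √A * ((k : ℝ) + 1) ^ (-(β / 2)) := fun k => by
    have habs := ((memLp_of_sq h hsq k).integrable (by norm_num)).abs
    refine (h.integral_comp_le measurable_gradNoise (hmem k)
      (hP.integral_gradNoise_sq_le hα) ((habs.const_mul M).const_mul _)).trans ?_
    rw [integral_const_mul, integral_const_mul]
    have := integral_abs_xiProc_le h hsq hA k
    calc _ ≤ (1 - α)⁻¹ ^ 2 * (M * (√A * stepPow (β / 2) k)) := by gcongr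
      _ = _ := by rw [stepPow]; ring
  calc √(∑ k ∈ Finset.range n, ∫ ω, gradNoise P α ξ (xiProc α γ₁ β ξ₀ X k ω) (X k ω) ^ 2 ∂μ)
      ≤ √((1 - α)⁻¹ ^ 2 * M * √A * ((n : ℝ) ^ (1 - β / 2) / (1 - β / 2))) := by
        refine Real.sqrt_le_sqrt ((Finset.sum_le_sum fun k _ => hk k).trans ?_)
        rw [← Finset.mul_sum]
        exact mul_le_mul_of_nonneg_left
          (sum_rpow_neg_le (by linarith [hβ.1]) (by linarith) n) (by positivity)
    _ = √((1 - α)⁻¹ ^ 2 * M * √A / (1 - β / 2) * (n : ℝ) ^ (1 - β / 2)) := by ring_nf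
    _ = _ := by
        rw [Real.sqrt_mul' _ (by positivity), sqrt_natCast_rpow]; ring_nf

/-- Here the increments are Lipschitz in the iterate, so their variance is of order k^(-β), better
than for the discontinuous gradient. -/
lemma integral_abs_sum_lossNoise_le (hα : α ∈ Ioo (0 : ℝ) 1) (hβ : β ∈ Ioo (1 / 2 : ℝ) 1)
    (h : IsInnovation μ P ξ₀ X) (hP : RegularLaw P α ξ s m M L)
    (hsq : ∀ n, Integrable (fun ω => (xiProc α γ₁ β ξ₀ X n ω - ξ) ^ 2) μ) (hA0 : 0 ≤ A)
    (hA : ∀ n, ∫ ω, (xiProc α γ₁ β ξ₀ X n ω - ξ) ^ 2 ∂μ ≤ A * stepPow β n) (n : ℕ) :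
    ∫ ω, |∑ k ∈ Finset.range n, lossNoise P α ξ (xiProc α γ₁ β ξ₀ X k ω) (X k ω)| ∂μ
      ≤ √((2 * gradBound α) ^ 2 * A / (1 - β)) * (n : ℝ) ^ ((1 - β) / 2) := by
  have hβ2 : 0 < 1 - β := by linarith [hβ.2]
  have hg := gradBound_pos hα
  have hmem : ∀ k, MemLp (fun ω => lossNoise P α ξ (xiProc α γ₁ β ξ₀ X k ω) (X k ω)) 2 μ :=
    fun k => ((memLp_of_sq h hsq k).const_mul (2 * gradBound α)).mono (measurable_lossNoise.comp
      ((h.measurable_xiProc k).prodMk (h.measurable k))).aestronglyMeasurable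
      (ae_of_all _ fun ω => by
        rw [norm_mul, Real.norm_eq_abs, Real.norm_eq_abs, Real.norm_eq_abs,
          abs_of_pos (by positivity : 0 < 2 * gradBound α)]
        exact hP.abs_lossNoise_le hα _ _)
  refine (integral_abs_le_sqrt (memLp_finsetSum _ fun k _ => hmem k)).trans ?_
  rw [h.integral_sum_sq measurable_lossNoise hP.integral_lossNoise hmem]
  have hk : ∀ k, ∫ ω, lossNoise P α ξ (xiProc α γ₁ β ξ₀ X k ω) (X k ω) ^ 2 ∂μ
      ≤ (2 * gradBound α) ^ 2 * A * ((k : ℝ) + 1) ^ (-β) := fun k => by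
    calc _ ≤ ∫ ω, (2 * gradBound α) ^ 2 * (xiProc α γ₁ β ξ₀ X k ω - ξ) ^ 2 ∂μ := by
          refine integral_mono (hmem k).integrable_sq ((hsq k).const_mul _) fun ω => ?_
          simp only
          rw [← mul_pow]
          refine sq_le_sq.2 ((hP.abs_lossNoise_le hα _ _).trans ?_)
          rw [abs_mul, abs_of_pos (by positivity : 0 < 2 * gradBound α)]
      _ ≤ (2 * gradBound α) ^ 2 * (A * stepPow β k) := by
          rw [integral_const_mul]; gcongr; exact hA k
      _ = _ := by rw [stepPow]; ring
  calc √(∑ k ∈ Finset.range n, ∫ ω, lossNoise P α ξ (xiProc α γ₁ β ξ₀ X k ω) (X k ω) ^ 2 ∂μ)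
      ≤ √((2 * gradBound α) ^ 2 * A * ((n : ℝ) ^ (1 - β) / (1 - β))) := by
        refine Real.sqrt_le_sqrt ((Finset.sum_le_sum fun k _ => hk k).trans ?_)
        rw [← Finset.mul_sum]
        exact mul_le_mul_of_nonneg_left
          (sum_rpow_neg_le (by linarith [hβ.1]) (by linarith [hβ.1]) n) (by positivity)
    _ = √((2 * gradBound α) ^ 2 * A / (1 - β) * (n : ℝ) ^ (1 - β)) := by ring_nf
    _ = _ := by
        rw [Real.sqrt_mul' _ (by positivity), sqrt_natCast_rpow]

lemma sum_integral_sq_le (hβ : β ∈ Ioo (1 / 2 : ℝ) 1) (hA0 : 0 ≤ A)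
    (hA : ∀ n, ∫ ω, (xiProc α γ₁ β ξ₀ X n ω - ξ) ^ 2 ∂μ ≤ A * stepPow β n) (n : ℕ) :
    ∑ k ∈ Finset.range n, ∫ ω, (xiProc α γ₁ β ξ₀ X k ω - ξ) ^ 2 ∂μ
      ≤ A / (1 - β) * (n : ℝ) ^ (1 - β) := by
  refine (Finset.sum_le_sum fun k _ => hA k).trans ?_
  rw [← Finset.mul_sum, div_mul_eq_mul_div, mul_div_assoc]
  exact mul_le_mul_of_nonneg_left (sum_rpow_neg_le (by linarith [hβ.1]) hβ.2 n) hA0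

end Remainder

/-! ### L¹ bounds for the two linearization errors -/

section Remainder

variable {Ω : Type*} [MeasurableSpace Ω] {μ : Measure Ω} [IsProbabilityMeasure μ]
  {P : Measure ℝ} [IsProbabilityMeasure P] {ξ₀ : Ω → ℝ} {X : ℕ → Ω → ℝ}
  {α γ₁ β ξ s m M L A : ℝ}

lemma memLp_gradNoise (hα : α ∈ Ioo (0 : ℝ) 1) (h : IsInnovation μ P ξ₀ X)
    (hP : RegularLaw P α ξ s m M L) (k : ℕ) :
    MemLp (fun ω => gradNoise P α ξ (xiProc α γ₁ β ξ₀ X k ω) (X k ω)) 2 μ :=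
  MemLp.of_bound (measurable_gradNoise.comp
    ((h.measurable_xiProc k).prodMk (h.measurable k))).aestronglyMeasurable (3 * gradBound α)
    (ae_of_all _ fun _ => hP.abs_gradNoise_le hα _ _)

lemma memLp_lossNoise (hα : α ∈ Ioo (0 : ℝ) 1) (h : IsInnovation μ P ξ₀ X)
    (hP : RegularLaw P α ξ s m M L)
    (hsq : ∀ n, Integrable (fun ω => (xiProc α γ₁ β ξ₀ X n ω - ξ) ^ 2) μ) (k : ℕ) :
    MemLp (fun ω => lossNoise P α ξ (xiProc α γ₁ β ξ₀ X k ω) (X k ω)) 2 μ := by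
  have hg := gradBound_pos hα
  refine ((memLp_of_sq h hsq k).const_mul (2 * gradBound α)).mono (measurable_lossNoise.comp
    ((h.measurable_xiProc k).prodMk (h.measurable k))).aestronglyMeasurable
    (ae_of_all _ fun ω => ?_)
  rw [norm_mul, Real.norm_eq_abs, Real.norm_eq_abs, Real.norm_eq_abs,
    abs_of_pos (by positivity : 0 < 2 * gradBound α)]
  exact hP.abs_lossNoise_le hα _ _

/-- Replacing ξ_k by ξ in the loss leaves a martingale plus gaps of the objective; these gaps are
nonnegative and quadratic in ξ_k - ξ. -/
lemma integral_abs_loss_remainder_le (hα : α ∈ Ioo (0 : ℝ) 1) (hβ : β ∈ Ioo (1 / 2 : ℝ) 1)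
    (h : IsInnovation μ P ξ₀ X) (hP : RegularLaw P α ξ s m M L)
    (hsq : ∀ n, Integrable (fun ω => (xiProc α γ₁ β ξ₀ X n ω - ξ) ^ 2) μ) (hA0 : 0 ≤ A)
    (hA : ∀ n, ∫ ω, (xiProc α γ₁ β ξ₀ X n ω - ξ) ^ 2 ∂μ ≤ A * stepPow β n) (n : ℕ) :
    ∫ ω, |n * chiIter α γ₁ β (ξ₀ ω) (fun i => X i ω) n
        - ∑ k ∈ Finset.range n, lossG α ξ (X k ω)| ∂μ
      ≤ √((2 * gradBound α) ^ 2 * A / (1 - β)) * (n : ℝ) ^ ((1 - β) / 2)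
        + M / (1 - α) * (A / (1 - β) * (n : ℝ) ^ (1 - β)) := by
  have hα' : 0 < 1 - α := by linarith [hα.2]
  have hM := hP.bound_nonneg
  have hN : Integrable (fun ω => |∑ k ∈ Finset.range n,
      lossNoise P α ξ (xiProc α γ₁ β ξ₀ X k ω) (X k ω)|) μ :=
    (integrable_finsetSum _ fun k _ =>
      (memLp_lossNoise hα h hP hsq k).integrable (by norm_num)).abs
  have hS : Integrable (fun ω => ∑ k ∈ Finset.range n, (xiProc α γ₁ β ξ₀ X k ω - ξ) ^ 2) μ :=
    integrable_finsetSum _ fun k _ => hsq k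
  calc _ ≤ ∫ ω, (|∑ k ∈ Finset.range n,
          lossNoise P α ξ (xiProc α γ₁ β ξ₀ X k ω) (X k ω)|
          + M / (1 - α) * ∑ k ∈ Finset.range n, (xiProc α γ₁ β ξ₀ X k ω - ξ) ^ 2) ∂μ := by
        refine integral_mono_of_nonneg (ae_of_all _ fun _ => abs_nonneg _)
          (hN.add (hS.const_mul _)) (ae_of_all _ fun ω => ?_)
        have e : n * chiIter α γ₁ β (ξ₀ ω) (fun i => X i ω) n
              - ∑ k ∈ Finset.range n, lossG α ξ (X k ω)
            = ∑ k ∈ Finset.range n, lossNoise P α ξ (xiProc α γ₁ β ξ₀ X k ω) (X k ω)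
              + ∑ k ∈ Finset.range n,
                (lawObjective P α (xiProc α γ₁ β ξ₀ X k ω) - lawObjective P α ξ) := by
          rw [natCast_mul_chiIter, ← Finset.sum_sub_distrib, ← Finset.sum_add_distrib]
          refine Finset.sum_congr rfl fun k _ => ?_
          simp only [lossNoise, xiProc]
          ring
        simp only [e]
        refine (abs_add_le _ _).trans (add_le_add le_rfl ?_)
        rw [Finset.abs_sum_of_nonneg fun k _ => hP.lawObjective_sub_nonneg hα _, Finset.mul_sum]
        exact Finset.sum_le_sum fun k _ => hP.lawObjective_sub_le hα _
    _ ≤ _ := by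
        rw [integral_add hN (hS.const_mul _), integral_const_mul,
          integral_finsetSum _ fun k _ => hsq k]
        have h1 := integral_abs_sum_lossNoise_le hα hβ h hP hsq hA0 hA n
        have h2 := sum_integral_sq_le hβ hA0 hA n
        gcongr

/-- The recursion gives `H₁` at the iterate as (ξ_k - ξ_{k+1})/γ_{k+1}. Split that gradient into the
frozen one at ξ, the linear mean field, its nonlinear error and the noise, then sum the left side by
parts. The first term on the right accounts for the average running over 1, …, n instead of 0, …,
n-1. -/
lemma grad_remainder_eq (hα : α ∈ Ioo (0 : ℝ) 1) (hγ₁ : 0 < γ₁) (n : ℕ) (ω : Ω) :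
    s / (1 - α) * ∑ k ∈ Finset.Icc 1 n, (xiProc α γ₁ β ξ₀ X k ω - ξ)
        + ∑ k ∈ Finset.range n, H₁ α ξ (X k ω)
      = s / (1 - α) * ((xiProc α γ₁ β ξ₀ X n ω - ξ) - (xiProc α γ₁ β ξ₀ X 0 ω - ξ))
        + (γ₁⁻¹ * (stepPow β 0)⁻¹ * (xiProc α γ₁ β ξ₀ X 0 ω - ξ)
          - γ₁⁻¹ * (stepPow β n)⁻¹ * (xiProc α γ₁ β ξ₀ X n ω - ξ)
          + ∑ k ∈ Finset.range n, (γ₁⁻¹ * (stepPow β (k + 1))⁻¹ - γ₁⁻¹ * (stepPow β k)⁻¹)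
            * (xiProc α γ₁ β ξ₀ X (k + 1) ω - ξ))
        - (1 - α)⁻¹ * ∑ k ∈ Finset.range n, (P.real (Iic (xiProc α γ₁ β ξ₀ X k ω)) - α
          - s * (xiProc α γ₁ β ξ₀ X k ω - ξ))
        - ∑ k ∈ Finset.range n, gradNoise P α ξ (xiProc α γ₁ β ξ₀ X k ω) (X k ω) := by
  have hα' : 1 - α ≠ 0 := by linarith [hα.2]
  rw [sum_Icc_eq_sum_range fun k => xiProc α γ₁ β ξ₀ X k ω - ξ,
    ← sum_mul_sub_succ (fun k => γ₁⁻¹ * (stepPow β k)⁻¹) fun k => xiProc α γ₁ β ξ₀ X k ω - ξ]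
  have key : ∑ k ∈ Finset.range n, H₁ α ξ (X k ω)
      = ∑ k ∈ Finset.range n, γ₁⁻¹ * (stepPow β k)⁻¹
          * (xiProc α γ₁ β ξ₀ X k ω - ξ - (xiProc α γ₁ β ξ₀ X (k + 1) ω - ξ))
        - (1 - α)⁻¹ * ∑ k ∈ Finset.range n, (P.real (Iic (xiProc α γ₁ β ξ₀ X k ω)) - α
          - s * (xiProc α γ₁ β ξ₀ X k ω - ξ))
        - ∑ k ∈ Finset.range n, gradNoise P α ξ (xiProc α γ₁ β ξ₀ X k ω) (X k ω)
        - s / (1 - α) * ∑ k ∈ Finset.range n, (xiProc α γ₁ β ξ₀ X k ω - ξ) := by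
    rw [Finset.mul_sum, Finset.mul_sum, ← Finset.sum_sub_distrib, ← Finset.sum_sub_distrib,
      ← Finset.sum_sub_distrib]
    refine Finset.sum_congr rfl fun k _ => ?_
    have hg := (stepPow_pos β k).ne'
    rw [xiProc_succ, gradNoise]
    field_simp
    ring
  rw [key]
  ring

lemma stepPow_half_inv_le (hβ0 : 0 ≤ β) (hβ : β ≤ 1) {n : ℕ} (hn : 1 ≤ n) :
    (stepPow (β / 2) n)⁻¹ ≤ 2 * (n : ℝ) ^ (β / 2) := by
  have hn' : (1 : ℝ) ≤ n := by exact_mod_cast hn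
  unfold stepPow
  rw [Real.rpow_neg (by positivity), inv_inv]
  calc ((n : ℝ) + 1) ^ (β / 2) ≤ (2 * (n : ℝ)) ^ (β / 2) :=
        Real.rpow_le_rpow (by positivity) (by linarith) (by linarith)
    _ = 2 ^ (β / 2) * (n : ℝ) ^ (β / 2) := Real.mul_rpow (by norm_num) (by positivity)
    _ ≤ 2 ^ (1 : ℝ) * (n : ℝ) ^ (β / 2) := by
        gcongr
        · norm_num
        · linarith
    _ = _ := by rw [Real.rpow_one]

/-- Sizes of the pieces: the end term γ_n⁻¹ |ξ_n - ξ| and the increments of the inverse step give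
n^(β/2), the quadratic error gives n^(1-β), the noise gives n^(1/2 - β/4). -/
lemma integral_abs_grad_remainder_le (hα : α ∈ Ioo (0 : ℝ) 1) (hγ₁ : 0 < γ₁)
    (hβ : β ∈ Ioo (1 / 2 : ℝ) 1) (h : IsInnovation μ P ξ₀ X) (hm : 0 ≤ m)
    (hP : RegularLaw P α ξ s m M L)
    (hsq : ∀ n, Integrable (fun ω => (xiProc α γ₁ β ξ₀ X n ω - ξ) ^ 2) μ) (hA0 : 0 ≤ A)
    (hA : ∀ n, ∫ ω, (xiProc α γ₁ β ξ₀ X n ω - ξ) ^ 2 ∂μ ≤ A * stepPow β n) {n : ℕ}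
    (hn : 1 ≤ n) :
    ∫ ω, |s / (1 - α) * ∑ k ∈ Finset.Icc 1 n, (xiProc α γ₁ β ξ₀ X k ω - ξ)
        + ∑ k ∈ Finset.range n, H₁ α ξ (X k ω)| ∂μ
      ≤ 2 * (M / (1 - α)) * √A
        + γ₁⁻¹ * √A * (1 + 2 * (n : ℝ) ^ (β / 2) + (n : ℝ) ^ (β / 2) / (β / 2))
        + (1 - α)⁻¹ * L * (A / (1 - β) * (n : ℝ) ^ (1 - β))
        + √((1 - α)⁻¹ ^ 2 * M * √A / (1 - β / 2)) * (n : ℝ) ^ (1 / 2 - β / 4) := by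
  have hα' : 0 < 1 - α := by linarith [hα.2]
  have hβ0 : 0 < β := by linarith [hβ.1]
  have hM := hP.bound_nonneg
  have hL := hP.linear_const_nonneg
  have hs : 0 ≤ s := hm.trans hP.slope
  set x := fun k ω => xiProc α γ₁ β ξ₀ X k ω - ξ with hx
  have hxi : ∀ k, Integrable (fun ω => |x k ω|) μ := fun k =>
    ((memLp_of_sq h hsq k).integrable (by norm_num)).abs
  have hxle : ∀ k, ∫ ω, |x k ω| ∂μ ≤ √A * stepPow (β / 2) k := integral_abs_xiProc_le h hsq hA
  have hxle1 : ∀ k, ∫ ω, |x k ω| ∂μ ≤ √A := fun k =>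
    (hxle k).trans (mul_le_of_le_one_right (Real.sqrt_nonneg _)
      (stepPow_le_one (by linarith) k))
  have hN : Integrable (fun ω => |∑ k ∈ Finset.range n,
      gradNoise P α ξ (xiProc α γ₁ β ξ₀ X k ω) (X k ω)|) μ :=
    (integrable_finsetSum _ fun k _ =>
      (memLp_gradNoise hα h hP k).integrable (by norm_num)).abs
  have hS : Integrable (fun ω => ∑ k ∈ Finset.range n, x k ω ^ 2) μ :=
    integrable_finsetSum _ fun k _ => hsq k
  have hT : Integrable (fun ω => ∑ k ∈ Finset.range n, stepPow (1 - β) k * |x (k + 1) ω|) μ :=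
    integrable_finsetSum _ fun k _ => (hxi (k + 1)).const_mul _
  have i1 : Integrable (fun ω => s / (1 - α) * (|x n ω| + |x 0 ω|)) μ :=
    ((hxi n).add (hxi 0)).const_mul _
  have i2 : Integrable (fun ω => γ₁⁻¹ * (|x 0 ω| + (stepPow β n)⁻¹ * |x n ω|
      + ∑ k ∈ Finset.range n, stepPow (1 - β) k * |x (k + 1) ω|)) μ :=
    (((hxi 0).add ((hxi n).const_mul _)).add hT).const_mul _
  have i3 : Integrable (fun ω => (1 - α)⁻¹ * L * ∑ k ∈ Finset.range n, x k ω ^ 2) μ :=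
    hS.const_mul _
  calc _ ≤ ∫ ω, (s / (1 - α) * (|x n ω| + |x 0 ω|)
        + γ₁⁻¹ * (|x 0 ω| + (stepPow β n)⁻¹ * |x n ω|
          + ∑ k ∈ Finset.range n, stepPow (1 - β) k * |x (k + 1) ω|)
        + (1 - α)⁻¹ * L * ∑ k ∈ Finset.range n, x k ω ^ 2
        + |∑ k ∈ Finset.range n, gradNoise P α ξ (xiProc α γ₁ β ξ₀ X k ω) (X k ω)|) ∂μ := by
        refine integral_mono_of_nonneg (ae_of_all _ fun _ => abs_nonneg _)
          (((i1.add i2).add i3).add hN) (ae_of_all _ fun ω => ?_)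
        simp only
        rw [grad_remainder_eq (P := P) hα hγ₁]
        refine (abs_sub _ _).trans (add_le_add ((abs_sub _ _).trans (add_le_add
          ((abs_add_le _ _).trans (add_le_add ?_ ?_)) ?_)) le_rfl)
        · rw [abs_mul, abs_of_nonneg (by positivity)]
          exact mul_le_mul_of_nonneg_left (abs_sub _ _) (by positivity)
        · have e0 : stepPow β 0 = 1 := by simp [stepPow]
          have hg := stepPow_pos β n
          refine (abs_add_le _ _).trans ?_
          rw [mul_add γ₁⁻¹]
          refine add_le_add ((abs_sub _ _).trans ?_) ((Finset.abs_sum_le_sum_abs _ _).trans ?_)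
          · rw [e0, inv_one, mul_one, abs_mul, abs_mul, abs_of_pos (by positivity : 0 < γ₁⁻¹),
              abs_of_pos (by positivity : 0 < γ₁⁻¹ * (stepPow β n)⁻¹)]
            exact le_of_eq (by ring)
          · rw [Finset.mul_sum]
            refine Finset.sum_le_sum fun k _ => ?_
            rw [← mul_sub, mul_assoc, abs_mul, abs_of_pos (by positivity : 0 < γ₁⁻¹), abs_mul,
              abs_of_nonneg (sub_nonneg.2 (stepPow_inv_mono hβ0.le k))]
            have := stepPow_inv_sub_le hβ0.le hβ.2.le k
            gcongr
        · rw [abs_mul, abs_of_pos (by positivity), mul_assoc]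
          refine mul_le_mul_of_nonneg_left ((Finset.abs_sum_le_sum_abs _ _).trans ?_)
            (by positivity)
          rw [Finset.mul_sum]
          exact Finset.sum_le_sum fun k _ => hP.linear _
    _ = s / (1 - α) * (∫ ω, |x n ω| ∂μ + ∫ ω, |x 0 ω| ∂μ)
        + γ₁⁻¹ * (∫ ω, |x 0 ω| ∂μ + (stepPow β n)⁻¹ * ∫ ω, |x n ω| ∂μ
          + ∑ k ∈ Finset.range n, stepPow (1 - β) k * ∫ ω, |x (k + 1) ω| ∂μ)
        + (1 - α)⁻¹ * L * ∑ k ∈ Finset.range n, ∫ ω, x k ω ^ 2 ∂μ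
        + ∫ ω, |∑ k ∈ Finset.range n,
          gradNoise P α ξ (xiProc α γ₁ β ξ₀ X k ω) (X k ω)| ∂μ := by
        have i12 : Integrable (fun ω => s / (1 - α) * (|x n ω| + |x 0 ω|)
          + γ₁⁻¹ * (|x 0 ω| + (stepPow β n)⁻¹ * |x n ω|
          + ∑ k ∈ Finset.range n, stepPow (1 - β) k * |x (k + 1) ω|)) μ := i1.add i2
        have i123 : Integrable (fun ω => s / (1 - α) * (|x n ω| + |x 0 ω|)
          + γ₁⁻¹ * (|x 0 ω| + (stepPow β n)⁻¹ * |x n ω|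
          + ∑ k ∈ Finset.range n, stepPow (1 - β) k * |x (k + 1) ω|)
          + (1 - α)⁻¹ * L * ∑ k ∈ Finset.range n, x k ω ^ 2) μ := i12.add i3
        have j1 : Integrable (fun ω => |x 0 ω| + (stepPow β n)⁻¹ * |x n ω|) μ :=
          (hxi 0).add ((hxi n).const_mul _)
        rw [integral_add i123 hN, integral_add i12 i3, integral_add i1 i2, integral_const_mul,
          integral_add (hxi n) (hxi 0), integral_const_mul, integral_add j1 hT,
          integral_add (hxi 0) ((hxi n).const_mul _), integral_const_mul, integral_const_mul,
          integral_finsetSum _ fun k _ => (hxi (k + 1)).const_mul _,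
          integral_finsetSum _ fun k _ => hsq k]
        simp_rw [integral_const_mul]
        rfl
    _ ≤ _ := by
        have hp := stepPow_pos (β / 2) n
        have e1 : (stepPow β n)⁻¹ * ∫ ω, |x n ω| ∂μ ≤ √A * (2 * (n : ℝ) ^ (β / 2)) := by
          have hg := stepPow_pos β n
          calc (stepPow β n)⁻¹ * ∫ ω, |x n ω| ∂μ
              ≤ (stepPow β n)⁻¹ * (√A * stepPow (β / 2) n) := by gcongr; exact hxle n
            _ = √A * (stepPow (β / 2) n)⁻¹ := by rw [stepPow_eq_sq]; field_simp
            _ ≤ _ := by gcongr; exact stepPow_half_inv_le hβ0.le hβ.2.le hn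
        -- The increment of the inverse step is at most (k+1)^(-(1-β)) and the iterate error is of
        -- order (k+1)^(-β/2); the product has exponent -(1 - β/2), whose sum is of order n^(β/2).
        have e2 : ∑ k ∈ Finset.range n, stepPow (1 - β) k * ∫ ω, |x (k + 1) ω| ∂μ
            ≤ √A * ((n : ℝ) ^ (β / 2) / (β / 2)) := by
          calc _ ≤ ∑ k ∈ Finset.range n, √A * ((k : ℝ) + 1) ^ (-(1 - β / 2)) := by
                refine Finset.sum_le_sum fun k _ => ?_
                have h1 : ∫ ω, |x (k + 1) ω| ∂μ ≤ √A * stepPow (β / 2) k :=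
                  (hxle (k + 1)).trans (mul_le_mul_of_nonneg_left
                    (stepPow_anti (by linarith) k.le_succ) (Real.sqrt_nonneg _))
                have hg := stepPow_pos (1 - β) k
                calc _ ≤ stepPow (1 - β) k * (√A * stepPow (β / 2) k) := by gcongr
                  _ = √A * (stepPow (1 - β) k * stepPow (β / 2) k) := by ring
                  _ = _ := by
                    unfold stepPow
                    rw [← Real.rpow_add (by positivity)]
                    ring_nf
            _ ≤ _ := by
                rw [← Finset.mul_sum]
                have := sum_rpow_neg_le (s := 1 - β / 2) (by linarith [hβ.2]) (by linarith) n
                rw [sub_sub_cancel] at this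
                gcongr
        have e3 := sum_integral_sq_le hβ hA0 hA n
        have e4 := integral_abs_sum_gradNoise_le hα hβ h hP hsq hA n
        have e5 : s / (1 - α) * (∫ ω, |x n ω| ∂μ + ∫ ω, |x 0 ω| ∂μ)
            ≤ 2 * (M / (1 - α)) * √A := by
          have := hP.slope_le
          calc _ ≤ M / (1 - α) * (√A + √A) := by gcongr <;> exact hxle1 _
            _ = _ := by ring
        have e6 : ∫ ω, |x 0 ω| ∂μ + (stepPow β n)⁻¹ * ∫ ω, |x n ω| ∂μ
            + ∑ k ∈ Finset.range n, stepPow (1 - β) k * ∫ ω, |x (k + 1) ω| ∂μ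
            ≤ √A * (1 + 2 * (n : ℝ) ^ (β / 2) + (n : ℝ) ^ (β / 2) / (β / 2)) := by
          have := hxle1 0
          linarith
        rw [mul_assoc γ₁⁻¹]
        gcongr

end Remainder

/-- Collects the bounds with one constant independent of the law, so that they may be applied along
a varying K. -/
lemma exists_remainder_le {Ω : Type*} [MeasurableSpace Ω] (μ : Measure Ω)
    [IsProbabilityMeasure μ] {α γ₁ β l m M L : ℝ} (hα : α ∈ Ioo (0 : ℝ) 1) (hγ₁ : 0 < γ₁)
    (hβ : β ∈ Ioo (1 / 2 : ℝ) 1) (hl : 0 < l) (hlγ : l * (γ₁ * gradBound α) ≤ 1) (hm : 0 < m)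
    (hM : 0 ≤ M) (hL : 0 ≤ L) (B : ℝ) :
    ∃ C : ℝ, 0 ≤ C ∧ ∀ (P : Measure ℝ) [IsProbabilityMeasure P] (ξ₀ : Ω → ℝ) (X : ℕ → Ω → ℝ)
      (ξ s : ℝ), IsInnovation μ P ξ₀ X → RegularLaw P α ξ s m M L →
      Integrable (fun ω => Real.cosh (l * (ξ₀ ω - ξ))) μ →
      ∫ ω, Real.cosh (l * (ξ₀ ω - ξ)) ∂μ ≤ B → ∀ n : ℕ, 1 ≤ n →
      ∫ ω, |s / (1 - α) * ∑ k ∈ Finset.Icc 1 n, (xiProc α γ₁ β ξ₀ X k ω - ξ)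
        + ∑ k ∈ Finset.range n, H₁ α ξ (X k ω)| ∂μ ≤ C * remOrder β n ∧
      ∫ ω, |n * chiIter α γ₁ β (ξ₀ ω) (fun i => X i ω) n
        - ∑ k ∈ Finset.range n, lossG α ξ (X k ω)| ∂μ ≤ C * remOrder β n := by
  have hα' : 0 < 1 - α := by linarith [hα.2]
  have hβ0 : 0 < β := by linarith [hβ.1]
  have hβ1 : 0 < 1 - β := by linarith [hβ.2]
  obtain ⟨A, hA0, hA⟩ := exists_integral_sq_le μ hα hγ₁ hβ hl hlγ hm B
  set c₁ := 2 * (M / (1 - α)) * √A with hc₁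
  set c₂ := γ₁⁻¹ * √A * (1 + 2 + 1 / (β / 2)) with hc₂
  set c₃ := (1 - α)⁻¹ * L * (A / (1 - β)) with hc₃
  set c₄ := √((1 - α)⁻¹ ^ 2 * M * √A / (1 - β / 2)) with hc₄
  set c₅ := √((2 * gradBound α) ^ 2 * A / (1 - β)) with hc₅
  set c₆ := M / (1 - α) * (A / (1 - β)) with hc₆
  have p1 : 0 ≤ c₁ := by positivity
  have p2 : 0 ≤ c₂ := by positivity
  have p3 : 0 ≤ c₃ := by positivity
  have p4 : 0 ≤ c₄ := by positivity
  have p5 : 0 ≤ c₅ := by positivity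
  have p6 : 0 ≤ c₆ := by positivity
  refine ⟨c₁ + c₂ + c₃ + c₄ + c₅ + c₆, by positivity,
    fun P _ ξ₀ X ξ s h hP h0 hB n hn => ?_⟩
  have hsq := h.integrable_sq hα hγ₁ hβ0.le hl hlγ h0
  have hAn := hA P ξ₀ X ξ s M L h hP h0 hB
  have hn' : (1 : ℝ) ≤ n := by exact_mod_cast hn
  have q1 : 1 ≤ (n : ℝ) ^ (β / 2) := Real.one_le_rpow hn' (by linarith)
  have q2 : 0 ≤ (n : ℝ) ^ (1 - β) := by positivity
  have q3 : 0 ≤ (n : ℝ) ^ (1 / 2 - β / 4) := by positivity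
  have q4 : (n : ℝ) ^ ((1 - β) / 2) ≤ (n : ℝ) ^ (1 / 2 - β / 4) :=
    Real.rpow_le_rpow_of_exponent_le hn' (by linarith)
  have hR : remOrder β n = (n : ℝ) ^ (1 - β) + (n : ℝ) ^ (β / 2) + (n : ℝ) ^ (1 / 2 - β / 4) := rfl
  have r1 : 1 ≤ remOrder β n := by rw [hR]; linarith
  have r2 : (n : ℝ) ^ (β / 2) ≤ remOrder β n := by rw [hR]; linarith
  have r3 : (n : ℝ) ^ (1 - β) ≤ remOrder β n := by rw [hR]; linarith
  have r4 : (n : ℝ) ^ (1 / 2 - β / 4) ≤ remOrder β n := by rw [hR]; linarith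
  have r0 : 0 ≤ remOrder β n := by linarith
  have s1 := mul_le_mul_of_nonneg_left r1 p1
  have s2 := mul_le_mul_of_nonneg_left r2 p2
  have s3 := mul_le_mul_of_nonneg_left r3 p3
  have s4 := mul_le_mul_of_nonneg_left r4 p4
  have s5 := mul_le_mul_of_nonneg_left (q4.trans r4) p5
  have s6 := mul_le_mul_of_nonneg_left r3 p6
  have t1 := mul_nonneg p1 r0
  have t2 := mul_nonneg p2 r0
  have t3 := mul_nonneg p3 r0
  have t4 := mul_nonneg p4 r0
  have t5 := mul_nonneg p5 r0
  have t6 := mul_nonneg p6 r0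
  constructor
  · refine (integral_abs_grad_remainder_le hα hγ₁ hβ h hm.le hP hsq hA0 hAn hn).trans ?_
    have u2 : γ₁⁻¹ * √A * (1 + 2 * (n : ℝ) ^ (β / 2) + (n : ℝ) ^ (β / 2) / (β / 2))
        ≤ c₂ * (n : ℝ) ^ (β / 2) := by
      rw [hc₂, mul_assoc (γ₁⁻¹ * √A)]
      refine mul_le_mul_of_nonneg_left ?_ (by positivity)
      have : (1 + 2 + 1 / (β / 2)) * (n : ℝ) ^ (β / 2)
        = (n : ℝ) ^ (β / 2) + 2 * (n : ℝ) ^ (β / 2) + (n : ℝ) ^ (β / 2) / (β / 2) := by ring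
      linarith
    have u3 : (1 - α)⁻¹ * L * (A / (1 - β) * (n : ℝ) ^ (1 - β)) = c₃ * (n : ℝ) ^ (1 - β) := by
      rw [hc₃]; ring
    linarith
  · refine (integral_abs_loss_remainder_le hα hβ h hP hsq hA0 hAn n).trans ?_
    have u6 : M / (1 - α) * (A / (1 - β) * (n : ℝ) ^ (1 - β)) = c₆ * (n : ℝ) ^ (1 - β) := by
      rw [hc₆]; ring
    linarith

/-! ### Convergence of the nested loss in mean square -/

section Nested

variable {Ω : Type*} [MeasurableSpace Ω] {μ : Measure Ω} [IsProbabilityMeasure μ] {d q : ℕ}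
  {φ : (Fin d → ℝ) → (Fin q → ℝ) → ℝ} {Y : Ω → Fin d → ℝ} {Z : Ω → Fin q → ℝ}
  {Zs : ℕ → Ω → Fin q → ℝ}

lemma measurable_integral_map (hφ : Measurable (Function.uncurry φ)) :
    Measurable fun y => ∫ z, φ y z ∂(μ.map Z) :=
  (hφ.stronglyMeasurable.integral_prod_right (ν := μ.map Z)).measurable

/-- By independence, conditioning on Y amounts to integrating out Z with Y frozen; Fubini checks
this on the events {Y ∈ T}. -/
lemma condLoss_ae_eq (hφ : Measurable (Function.uncurry φ)) (hY : Measurable Y)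
    (hZ : Measurable Z) (hYZ : IndepFun Y Z μ)
    (hint : Integrable (fun ω => φ (Y ω) (Z ω)) μ) :
    (fun ω => ∫ z, φ (Y ω) z ∂(μ.map Z)) =ᵐ[μ] condLoss μ φ Y Z := by
  have hi := integrable_integral_of_indepFun hY.aemeasurable hZ.aemeasurable hYZ hφ hint
  refine ae_eq_condExp_of_forall_setIntegral_eq hY.comap_le hint
    (fun s _ _ => hi.integrableOn) ?_ ?_
  · rintro _ ⟨T, hT, rfl⟩ -
    have hΨ : Measurable fun p : (Fin d → ℝ) × (Fin q → ℝ) => T.indicator 1 p.1 * φ p.1 p.2 :=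
      ((measurable_one.indicator hT).comp measurable_fst).mul hφ
    have hind : ∀ ω, ∀ c : ℝ, T.indicator 1 (Y ω) * c = (Y ⁻¹' T).indicator (fun _ => c) ω := by
      intro ω c
      by_cases h : Y ω ∈ T
      · rw [indicator_of_mem h, indicator_of_mem (show ω ∈ Y ⁻¹' T from h)]; simp
      · rw [indicator_of_notMem h, indicator_of_notMem (show ω ∉ Y ⁻¹' T from h), zero_mul]
    have hΨi : Integrable (fun ω => T.indicator 1 (Y ω) * φ (Y ω) (Z ω)) μ := by
      refine (hint.indicator (hY hT)).congr (ae_of_all _ fun ω => ?_)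
      simp only [hind]
      rfl
    have h := integral_eq_iterated_of_indepFun hY.aemeasurable hZ.aemeasurable hYZ hΨ hΨi
    simp only [integral_const_mul] at h
    simp only [hind] at h
    rw [← integral_indicator (hY hT), ← integral_indicator (hY hT)]
    exact h.symm
  · exact ((measurable_integral_map hφ).comp
      (comap_measurable Y)).stronglyMeasurable.aestronglyMeasurable

/-- Integrability of f is not required: if it fails, the inner integral is 0 by convention and the
outer one is too. This allows centring for every y, even where the section of φ is not integrable.
-/
lemma integral_sub_integral_eq_zero {F : Type*} [MeasurableSpace F] (ν : Measure F)
    [IsProbabilityMeasure ν] (f : F → ℝ) : ∫ z, (f z - ∫ x, f x ∂ν) ∂ν = 0 := by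
  by_cases h : Integrable f ν
  · rw [integral_sub h (integrable_const _)]; simp
  · rw [integral_undef h]; simpa using integral_undef h

lemma identDistrib_prod (hY : Measurable Y) (hZ : Measurable Z) (hYZ : IndepFun Y Z μ)
    (hZs : ∀ k, IdentDistrib (Zs k) Z μ μ) (hYZs : IndepFun Y (fun ω k => Zs k ω) μ) (k : ℕ) :
    IdentDistrib (fun ω => (Y ω, Zs k ω)) (fun ω => (Y ω, Z ω)) μ μ where
  aemeasurable_fst := hY.aemeasurable.prodMk (hZs k).aemeasurable_fst
  aemeasurable_snd := (hY.prodMk hZ).aemeasurable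
  map_eq := by
    have h := hYZs.comp measurable_id (measurable_pi_apply k)
    have h' : IndepFun Y (Zs k) μ := h
    rw [(indepFun_iff_map_prod_eq_prod_map_map hY.aemeasurable (hZs k).aemeasurable_fst).1 h',
      (indepFun_iff_map_prod_eq_prod_map_map hY.aemeasurable hZ.aemeasurable).1 hYZ,
      (hZs k).map_eq]

lemma memLp_condLoss (hmem : MemLp (fun ω => φ (Y ω) (Z ω)) 2 μ) :
    MemLp (condLoss μ φ Y Z) 2 μ := hmem.condExp (by norm_num)

lemma memLp_nestedLoss (hφ : Measurable (Function.uncurry φ)) (hY : Measurable Y)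
    (hZ : Measurable Z) (hYZ : IndepFun Y Z μ) (hmem : MemLp (fun ω => φ (Y ω) (Z ω)) 2 μ)
    (hZs : ∀ k, IdentDistrib (Zs k) Z μ μ) (hYZs : IndepFun Y (fun ω k => Zs k ω) μ) (K : ℕ) :
    MemLp (nestedLoss φ Y Zs K) 2 μ := by
  have h : ∀ k, MemLp (fun ω => φ (Y ω) (Zs k ω)) 2 μ := fun k =>
    ((identDistrib_prod hY hZ hYZ hZs hYZs k).comp hφ).memLp_iff.2 hmem
  have h2 := (memLp_finsetSum (Finset.range K) fun k _ => h k).mul_const (K : ℝ)⁻¹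
  unfold nestedLoss innerMean
  simpa only [div_eq_mul_inv] using h2

/-- The fluctuation of `φ(y, z)` around its conditional mean. -/
def innerNoise (φ : (Fin d → ℝ) → (Fin q → ℝ) → ℝ) (ν : Measure (Fin q → ℝ)) (y : Fin d → ℝ)
    (z : Fin q → ℝ) : ℝ := φ y z - ∫ x, φ y x ∂ν

lemma measurable_innerNoise (hφ : Measurable (Function.uncurry φ)) :
    Measurable (Function.uncurry (innerNoise φ (μ.map Z))) :=
  hφ.sub ((measurable_integral_map hφ).comp measurable_fst)

lemma memLp_innerNoise (hφ : Measurable (Function.uncurry φ)) (hY : Measurable Y)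
    (hZ : Measurable Z) (hYZ : IndepFun Y Z μ) (hmem : MemLp (fun ω => φ (Y ω) (Z ω)) 2 μ) :
    MemLp (fun ω => innerNoise φ (μ.map Z) (Y ω) (Z ω)) 2 μ :=
  hmem.sub ((memLp_congr_ae (condLoss_ae_eq hφ hY hZ hYZ (hmem.integrable (by norm_num)))).2
    (memLp_condLoss hmem))

/-- Given Y and one inner sample, the noise of another inner sample is still centred. -/
lemma integral_innerNoise_mul (hφ : Measurable (Function.uncurry φ)) (hY : Measurable Y)
    (hZ : Measurable Z) (hYZ : IndepFun Y Z μ) (hmem : MemLp (fun ω => φ (Y ω) (Z ω)) 2 μ)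
    (hZs : ∀ k, IdentDistrib (Zs k) Z μ μ) (hZs_indep : iIndepFun Zs μ)
    (hYZs : IndepFun Y (fun ω k => Zs k ω) μ) {j k : ℕ} (hjk : j ≠ k) :
    ∫ ω, innerNoise φ (μ.map Z) (Y ω) (Zs j ω) * innerNoise φ (μ.map Z) (Y ω) (Zs k ω) ∂μ
      = 0 := by
  have := Measure.isProbabilityMeasure_map (μ := μ) hZ.aemeasurable
  have hm := measurable_innerNoise (μ := μ) (Z := Z) hφ
  have hZm := fun k => (hZs k).aemeasurable_fst
  have hmemk : ∀ k, MemLp (fun ω => innerNoise φ (μ.map Z) (Y ω) (Zs k ω)) 2 μ := fun k =>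
    ((identDistrib_prod hY hZ hYZ hZs hYZs k).comp hm).memLp_iff.2
      (memLp_innerNoise hφ hY hZ hYZ hmem)
  have h1 : IndepFun Y (fun ω => (Zs j ω, Zs k ω)) μ :=
    hYZs.comp measurable_id ((measurable_pi_apply j).prodMk (measurable_pi_apply k))
  have h2 := indepFun_assoc hY.aemeasurable (hZm j) (hZm k) h1 (hZs_indep.indepFun hjk)
  have h3 := integral_eq_iterated_of_indepFun
    (Ψ := fun p : ((Fin d → ℝ) × (Fin q → ℝ)) × (Fin q → ℝ) =>
      innerNoise φ (μ.map Z) p.1.1 p.1.2 * innerNoise φ (μ.map Z) p.1.1 p.2)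
    (hY.aemeasurable.prodMk (hZm j)) (hZm k) h2
    ((hm.comp measurable_fst).mul
      (hm.comp ((measurable_fst.comp measurable_fst).prodMk measurable_snd)))
    ((hmemk j).integrable_mul (hmemk k))
  have h0 : ∀ y, ∫ x, innerNoise φ (μ.map Z) y x ∂(μ.map Z) = 0 := fun y =>
    integral_sub_integral_eq_zero _ _
  simp only [integral_const_mul, (hZs k).map_eq, h0, mul_zero, integral_zero] at h3
  exact h3

/-- The difference is an average of K noises, orthogonal and of equal second moment. -/
lemma integral_nestedLoss_sub_sq (hφ : Measurable (Function.uncurry φ)) (hY : Measurable Y)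
    (hZ : Measurable Z) (hYZ : IndepFun Y Z μ) (hmem : MemLp (fun ω => φ (Y ω) (Z ω)) 2 μ)
    (hZs : ∀ k, IdentDistrib (Zs k) Z μ μ) (hZs_indep : iIndepFun Zs μ)
    (hYZs : IndepFun Y (fun ω k => Zs k ω) μ) {K : ℕ} (hK : 1 ≤ K) :
    ∫ ω, (nestedLoss φ Y Zs K ω - condLoss μ φ Y Z ω) ^ 2 ∂μ
      = (∫ ω, innerNoise φ (μ.map Z) (Y ω) (Z ω) ^ 2 ∂μ) / K := by
  have hK' : (K : ℝ) ≠ 0 := by positivity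
  have hm := measurable_innerNoise (μ := μ) (Z := Z) hφ
  have hmemk : ∀ k, MemLp (fun ω => innerNoise φ (μ.map Z) (Y ω) (Zs k ω)) 2 μ := fun k =>
    ((identDistrib_prod hY hZ hYZ hZs hYZs k).comp hm).memLp_iff.2
      (memLp_innerNoise hφ hY hZ hYZ hmem)
  have hae : (fun ω => (nestedLoss φ Y Zs K ω - condLoss μ φ Y Z ω) ^ 2) =ᵐ[μ] fun ω =>
      (K : ℝ)⁻¹ ^ 2 * ∑ j ∈ Finset.range K, ∑ k ∈ Finset.range K,
        innerNoise φ (μ.map Z) (Y ω) (Zs j ω) * innerNoise φ (μ.map Z) (Y ω) (Zs k ω) := by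
    filter_upwards [condLoss_ae_eq hφ hY hZ hYZ (hmem.integrable (by norm_num))] with ω hω
    rw [← hω, ← Finset.sum_mul_sum, ← sq, ← mul_pow]
    congr 1
    simp only [nestedLoss, innerMean, innerNoise, Finset.sum_sub_distrib, Finset.sum_const,
      Finset.card_range, nsmul_eq_mul]
    field_simp
  have hprod : ∀ j k, Integrable (fun ω => innerNoise φ (μ.map Z) (Y ω) (Zs j ω)
      * innerNoise φ (μ.map Z) (Y ω) (Zs k ω)) μ := fun j k => (hmemk j).integrable_mul (hmemk k)
  rw [integral_congr_ae hae, integral_const_mul,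
    integral_finsetSum _ fun j _ => integrable_finsetSum _ fun k _ => hprod j k]
  have hj : ∀ j ∈ Finset.range K, ∫ ω, ∑ k ∈ Finset.range K,
      innerNoise φ (μ.map Z) (Y ω) (Zs j ω) * innerNoise φ (μ.map Z) (Y ω) (Zs k ω) ∂μ
      = ∫ ω, innerNoise φ (μ.map Z) (Y ω) (Z ω) ^ 2 ∂μ := fun j hj => by
    rw [integral_finsetSum _ fun k _ => hprod j k,
      Finset.sum_eq_single_of_mem j hj fun k _ hkj =>
        integral_innerNoise_mul hφ hY hZ hYZ hmem hZs hZs_indep hYZs hkj.symm]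
    simp_rw [← sq]
    exact ((identDistrib_prod hY hZ hYZ hZs hYZs j).comp (hm.pow_const 2)).integral_eq
  rw [Finset.sum_congr rfl hj]
  simp
  field_simp

end Nested

/-! ### Characteristic functions of triangular arrays -/

section CharFun

/-- Removing the linear part, whose mean is 0 for centred variables, leaves a function whose
derivative at t has norm at most |t|. This gains the second order needed to survive multiplication
by K². -/
lemma norm_expSubLinear_sub_le (x y : ℝ) :
    ‖(Complex.exp (x * Complex.I) - x * Complex.I)
      - (Complex.exp (y * Complex.I) - y * Complex.I)‖ ≤ (|x| + |y|) * |x - y| := by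
  have hd : ∀ t : ℝ, HasDerivAt (fun t : ℝ => Complex.exp (t * Complex.I) - t * Complex.I)
      (Complex.exp (t * Complex.I) * (1 * Complex.I) - 1 * Complex.I) t := fun t => by
    have h1 : HasDerivAt (fun t : ℝ => (t : ℂ) * Complex.I) (1 * Complex.I) t :=
      (Complex.ofRealCLM.hasDerivAt (x := t)).mul_const Complex.I
    exact h1.cexp.sub h1
  have h := (convex_uIcc y x).norm_image_sub_le_of_norm_hasDerivWithin_le (C := |x| + |y|)
    (fun t _ => (hd t).hasDerivWithinAt) (fun t ht => ?_) left_mem_uIcc right_mem_uIcc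
  · simpa only [Real.norm_eq_abs] using h
  · have h1 : Complex.exp (t * Complex.I) * (1 * Complex.I) - 1 * Complex.I
        = (Complex.exp (Complex.I * t) - 1) * Complex.I := by rw [mul_comm (t : ℂ)]; ring
    rw [h1, norm_mul, Complex.norm_I, mul_one]
    refine Real.norm_exp_I_mul_ofReal_sub_one_le.trans ?_
    rw [Real.norm_eq_abs]
    have hx := abs_nonneg x
    have hy := abs_nonneg y
    rcases mem_uIcc.1 ht with ⟨h1, h2⟩ | ⟨h1, h2⟩ <;> rw [abs_le] <;> constructor <;>
      linarith [le_abs_self x, neg_abs_le x, le_abs_self y, neg_abs_le y]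

lemma norm_pow_sub_pow_le {z w : ℂ} (hz : ‖z‖ ≤ 1) (hw : ‖w‖ ≤ 1) (n : ℕ) :
    ‖z ^ n - w ^ n‖ ≤ n * ‖z - w‖ := by
  induction n with
  | zero => simp
  | succ n ih =>
    have h : z ^ (n + 1) - w ^ (n + 1) = z ^ n * (z - w) + (z ^ n - w ^ n) * w := by ring
    rw [h]
    refine (norm_add_le _ _).trans ?_
    rw [norm_mul, norm_mul, norm_pow]
    have h1 : ‖z‖ ^ n ≤ 1 := pow_le_one₀ (norm_nonneg _) hz
    have h2 : ‖z‖ ^ n * ‖z - w‖ ≤ 1 * ‖z - w‖ := by gcongr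
    have h3 : ‖z ^ n - w ^ n‖ * ‖w‖ ≤ ‖z ^ n - w ^ n‖ * 1 := by gcongr
    push_cast
    linarith

variable {Ω : Type*} [MeasurableSpace Ω] {μ : Measure Ω} [IsProbabilityMeasure μ]

lemma charFun_map_real {S : Ω → ℝ} (hS : AEMeasurable S μ) (u : ℝ) :
    charFun (μ.map S) u = ∫ ω, Complex.exp (((u * S ω : ℝ) : ℂ) * Complex.I) ∂μ := by
  rw [charFun_apply_real, integral_map hS (by fun_prop)]
  push_cast
  rfl

lemma integrable_exp_mul_I {S : Ω → ℝ} (hS : AEMeasurable S μ) :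
    Integrable (fun ω => Complex.exp ((S ω : ℂ) * Complex.I)) μ := by
  refine Integrable.of_bound (C := 1) (by fun_prop) (ae_of_all _ fun ω => ?_)
  rw [Complex.norm_exp_ofReal_mul_I]

/-- Centring allows the linear terms to be subtracted for free; Young's inequality with weight η
then separates the L² distance from the size of T. -/
lemma norm_charFun_map_sub_le {S T : Ω → ℝ} (hS : MemLp S 2 μ) (hT : MemLp T 2 μ)
    (hS0 : ∫ ω, S ω ∂μ = 0) (hT0 : ∫ ω, T ω ∂μ = 0) {η : ℝ} (hη : 0 < η) (u : ℝ) :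
    ‖charFun (μ.map S) u - charFun (μ.map T) u‖
      ≤ u ^ 2 * ((1 + η⁻¹) * ∫ ω, (S ω - T ω) ^ 2 ∂μ + η * ∫ ω, T ω ^ 2 ∂μ) := by
  have hSm := hS.aestronglyMeasurable.aemeasurable
  have hTm := hT.aestronglyMeasurable.aemeasurable
  have hSi := hS.integrable (by norm_num)
  have hTi := hT.integrable (by norm_num)
  have key : ∀ {V : Ω → ℝ}, MemLp V 2 μ → ∫ ω, V ω ∂μ = 0 →
      Integrable (fun ω => Complex.exp (((u * V ω : ℝ) : ℂ) * Complex.I)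
        - ((u * V ω : ℝ) : ℂ) * Complex.I) μ ∧ charFun (μ.map V) u
      = ∫ ω, (Complex.exp (((u * V ω : ℝ) : ℂ) * Complex.I)
        - ((u * V ω : ℝ) : ℂ) * Complex.I) ∂μ := fun {V} hV hV0 => by
    have hVm := hV.aestronglyMeasurable.aemeasurable
    have hVi : Integrable (fun ω => u * V ω) μ := (hV.integrable (by norm_num)).const_mul u
    have hVi' : Integrable (fun ω => ((u * V ω : ℝ) : ℂ) * Complex.I) μ := hVi.ofReal.mul_const _
    have he := integrable_exp_mul_I (S := fun ω => u * V ω) (μ := μ) (by fun_prop)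
    refine ⟨he.sub hVi', ?_⟩
    rw [integral_sub he hVi', integral_mul_const, integral_complex_ofReal, integral_const_mul, hV0,
      charFun_map_real hVm]
    simp
  obtain ⟨iS, eS⟩ := key hS hS0
  obtain ⟨iT, eT⟩ := key hT hT0
  have hd : Integrable (fun ω => (S ω - T ω) ^ 2) μ := (hS.sub hT).integrable_sq
  have ht : Integrable (fun ω => T ω ^ 2) μ := hT.integrable_sq
  rw [eS, eT, ← integral_sub iS iT, ← integral_const_mul, ← integral_const_mul,
    ← integral_add (hd.const_mul _) (ht.const_mul _), ← integral_const_mul]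
  refine norm_integral_le_of_norm_le (((hd.const_mul _).add (ht.const_mul _)).const_mul _)
    (ae_of_all _ fun ω => ?_)
  refine (norm_expSubLinear_sub_le _ _).trans ?_
  rw [← mul_sub, abs_mul, abs_mul, abs_mul]
  have h1 : (|u| * |S ω| + |u| * |T ω|) * (|u| * |S ω - T ω|)
      = u ^ 2 * ((|S ω| + |T ω|) * |S ω - T ω|) := by rw [← sq_abs u]; ring
  rw [h1]
  refine mul_le_mul_of_nonneg_left ?_ (sq_nonneg u)
  have h2 : |S ω| ≤ |S ω - T ω| + |T ω| := by
    have := abs_add_le (S ω - T ω) (T ω)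
    rwa [sub_add_cancel] at this
  have h3 : (|S ω| + |T ω|) * |S ω - T ω| ≤ (|S ω - T ω| + 2 * |T ω|) * |S ω - T ω| :=
    mul_le_mul_of_nonneg_right (by linarith) (abs_nonneg _)
  have h4 : 2 * |T ω| * |S ω - T ω| ≤ η⁻¹ * |S ω - T ω| ^ 2 + η * |T ω| ^ 2 := by
    have h5 : 0 ≤ η⁻¹ * (|S ω - T ω| - η * |T ω|) ^ 2 := by positivity
    have h6 : η⁻¹ * (|S ω - T ω| - η * |T ω|) ^ 2 = η⁻¹ * |S ω - T ω| ^ 2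
      - 2 * |T ω| * |S ω - T ω| + η * |T ω| ^ 2 := by field_simp; ring
    linarith
  rw [← sq_abs (S ω - T ω), ← sq_abs (T ω)]
  nlinarith

lemma tendsto_charFun_pow_of_memLp {S : Ω → ℝ} (hS : MemLp S 2 μ) (hS0 : ∫ ω, S ω ∂μ = 0) :
    Tendsto (fun n : ℕ => charFun (μ.map S) ((√(n : ℝ))⁻¹) ^ n) atTop
      (𝓝 (Complex.exp (-((∫ ω, S ω ^ 2 ∂μ : ℝ) : ℂ) / 2))) := by
  have hSm := hS.aestronglyMeasurable.aemeasurable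
  set v := ∫ ω, S ω ^ 2 ∂μ with hv
  have hv0 : 0 ≤ v := integral_nonneg fun ω => sq_nonneg _
  rcases hv0.eq_or_lt with h | h
  -- With zero variance there is nothing to normalize; the variable vanishes almost surely.
  · have hae : S =ᵐ[μ] fun _ => 0 := by
      have := (integral_eq_zero_iff_of_nonneg (fun ω => sq_nonneg (S ω)) hS.integrable_sq).1 h.symm
      filter_upwards [this] with ω hω
      simpa using hω
    have h1 : ∀ u, charFun (μ.map S) u = 1 := fun u => by
      rw [Measure.map_congr hae]
      simp
    simp [h1, ← h]
  · have hσ : 0 < √v := Real.sqrt_pos.2 h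
    have h1 := tendsto_charFun_inv_sqrt_mul_pow (P := μ) (X := fun ω => (√v)⁻¹ * S ω)
      (by fun_prop) (by rw [integral_const_mul, hS0, mul_zero])
      (by
        simp only [Pi.pow_apply, mul_pow]
        rw [integral_const_mul, ← hv, inv_pow, Real.sq_sqrt hv0, inv_mul_cancel₀ h.ne']) (√v)
    have h2 : -((√v : ℝ) : ℂ) ^ 2 / 2 = -(v : ℂ) / 2 := by
      rw [← Complex.ofReal_pow, Real.sq_sqrt hv0]
    rw [h2] at h1
    refine h1.congr fun n => ?_
    rw [charFun_map_mul_comp hSm]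
    congr 2
    field_simp

/-- The characteristic functions at `1` of normalized sums of `K ^ 2` independent copies of
centred variables `S K` that converge in mean square. -/
lemma tendsto_charFun_pow_sq {S : ℕ → Ω → ℝ} {T : Ω → ℝ} (hS : ∀ᶠ K in atTop, MemLp (S K) 2 μ)
    (hT : MemLp T 2 μ) (hS0 : ∀ᶠ K in atTop, ∫ ω, S K ω ∂μ = 0) (hT0 : ∫ ω, T ω ∂μ = 0)
    (hlim : Tendsto (fun K => ∫ ω, (S K ω - T ω) ^ 2 ∂μ) atTop (𝓝 0)) :
    Tendsto (fun K : ℕ => charFun (μ.map (S K)) ((K : ℝ)⁻¹) ^ (K ^ 2)) atTop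
      (𝓝 (Complex.exp (-((∫ ω, T ω ^ 2 ∂μ : ℝ) : ℂ) / 2))) := by
  have h1 : Tendsto (fun K : ℕ => charFun (μ.map T) ((K : ℝ)⁻¹) ^ (K ^ 2)) atTop
      (𝓝 (Complex.exp (-((∫ ω, T ω ^ 2 ∂μ : ℝ) : ℂ) / 2))) := by
    refine ((tendsto_charFun_pow_of_memLp hT hT0).comp
      (tendsto_pow_atTop (two_ne_zero))).congr fun K => ?_
    simp [Real.sqrt_sq]
  set e := fun K => ∫ ω, (S K ω - T ω) ^ 2 ∂μ with he
  have he0 : ∀ K, 0 ≤ e K := fun K => integral_nonneg fun ω => sq_nonneg _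
  -- Chosen so that both η and e/η tend to 0; the summand 1/(K+1) keeps η positive when e vanishes.
  set η := fun K : ℕ => √(e K + 1 / ((K : ℝ) + 1)) with hη
  have hηpos : ∀ K, 0 < η K := fun K => Real.sqrt_pos.2 (by have := he0 K; positivity)
  have hηlim : Tendsto η atTop (𝓝 0) := by
    have := (hlim.add tendsto_one_div_add_atTop_nhds_zero_nat).sqrt
    rw [add_zero, Real.sqrt_zero] at this
    exact this
  have hbound : Tendsto (fun K => e K + η K + η K * ∫ ω, T ω ^ 2 ∂μ) atTop (𝓝 0) := by
    simpa using (hlim.add hηlim).add (hηlim.mul_const (∫ ω, T ω ^ 2 ∂μ))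
  have h2 : Tendsto (fun K : ℕ => charFun (μ.map (S K)) ((K : ℝ)⁻¹) ^ (K ^ 2)
      - charFun (μ.map T) ((K : ℝ)⁻¹) ^ (K ^ 2)) atTop (𝓝 0) := by
    refine squeeze_zero_norm' ?_ hbound
    filter_upwards [hS, hS0, eventually_ge_atTop 1] with K hSK hSK0 hK
    have := Measure.isProbabilityMeasure_map (μ := μ) hSK.aestronglyMeasurable.aemeasurable
    have := Measure.isProbabilityMeasure_map (μ := μ) hT.aestronglyMeasurable.aemeasurable
    refine (norm_pow_sub_pow_le (norm_charFun_le_one _) (norm_charFun_le_one _) _).trans ?_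
    have h3 := norm_charFun_map_sub_le hSK hT hSK0 hT0 (hηpos K) ((K : ℝ)⁻¹)
    have hK' : (K : ℝ) ≠ 0 := by positivity
    have h4 : (η K)⁻¹ * e K ≤ η K := by
      rw [inv_mul_le_iff₀ (hηpos K), ← sq, hη, Real.sq_sqrt (by have := he0 K; positivity)]
      have : 0 ≤ 1 / ((K : ℝ) + 1) := by positivity
      linarith
    calc ((K ^ 2 : ℕ) : ℝ) * ‖charFun (μ.map (S K)) ((K : ℝ)⁻¹) - charFun (μ.map T) ((K : ℝ)⁻¹)‖
        ≤ ((K ^ 2 : ℕ) : ℝ) * (((K : ℝ)⁻¹) ^ 2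
          * ((1 + (η K)⁻¹) * e K + η K * ∫ ω, T ω ^ 2 ∂μ)) := by gcongr
      _ = (1 + (η K)⁻¹) * e K + η K * ∫ ω, T ω ^ 2 ∂μ := by push_cast; field_simp
      _ ≤ _ := by linarith
  have h3 := h2.add h1
  simpa using h3

end CharFun

/-! ### Stability of quantiles and biases -/

/-- A perturbation of size b/K forces the root to move by O(1/K): once it falls below m, the cap in
the minimum is inactive. Hence K D² is still negligible. -/
lemma tendsto_scaled_root {D b : ℕ → ℝ} {m v₀ : ℝ} (hm : 0 < m) (hb : Tendsto b atTop (𝓝 v₀))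
    (hd : ∀ᶠ K : ℕ in atTop, m * min |D K| 1 ≤ |b K / K|) :
    Tendsto D atTop (𝓝 0) ∧ Tendsto (fun K : ℕ => (K : ℝ) * D K ^ 2) atTop (𝓝 0) := by
  have hb0 : Tendsto (fun K : ℕ => |b K / K|) atTop (𝓝 0) := by
    simpa using (hb.div_atTop tendsto_natCast_atTop_atTop).abs
  have hle : ∀ᶠ K : ℕ in atTop, |D K| ≤ |b K / K| / m := by
    filter_upwards [hd, hb0.eventually_lt_const hm] with K h1 h2
    rw [le_div_iff₀ hm]
    rcases le_total |D K| 1 with h | h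
    · rw [min_eq_left h] at h1; linarith
    · rw [min_eq_right h] at h1; linarith
  have hD : Tendsto D atTop (𝓝 0) := by
    refine squeeze_zero_norm' hle ?_
    simpa using hb0.div_const m
  refine ⟨hD, squeeze_zero_norm' (a := fun K => |b K| / m * |D K|) ?_ ?_⟩
  · filter_upwards [hle, eventually_ge_atTop 1] with K h1 hK
    have hK' : (0 : ℝ) < K := by exact_mod_cast hK
    rw [Real.norm_of_nonneg (by positivity), ← sq_abs, sq, ← mul_assoc]
    refine mul_le_mul_of_nonneg_right ?_ (abs_nonneg _)
    rw [abs_div, abs_of_pos hK', div_div, le_div_iff₀ (by positivity)] at h1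
    rw [le_div_iff₀ hm]
    linarith
  · simpa using (hb.abs.div_const m).mul hD.abs

/-- Multiply the linearized root equation by K; its quadratic error disappears in the limit. -/
lemma tendsto_scaled_bias {D b s : ℕ → ℝ} {L v₀ s₀ : ℝ} (hs₀ : s₀ ≠ 0)
    (hb : Tendsto b atTop (𝓝 v₀)) (hs : Tendsto s atTop (𝓝 s₀))
    (hD : Tendsto (fun K : ℕ => (K : ℝ) * D K ^ 2) atTop (𝓝 0))
    (hlin : ∀ᶠ K : ℕ in atTop, |b K / K + s K * D K| ≤ L * D K ^ 2) :
    Tendsto (fun K : ℕ => (K : ℝ) * D K) atTop (𝓝 (-(v₀ / s₀))) := by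
  have h1 : Tendsto (fun K : ℕ => b K + s K * (K * D K)) atTop (𝓝 0) := by
    refine squeeze_zero_norm' (a := fun K => L * (K * D K ^ 2)) ?_ (by simpa using hD.const_mul L)
    filter_upwards [hlin, eventually_ge_atTop 1] with K h hK
    have hK' : (0 : ℝ) < K := by exact_mod_cast hK
    rw [Real.norm_eq_abs]
    calc |b K + s K * (K * D K)| = K * |b K / K + s K * D K| := by
          rw [← abs_of_pos hK', ← abs_mul, abs_of_pos hK']; congr 1; field_simp
      _ ≤ K * (L * D K ^ 2) := by gcongr
      _ = _ := by ring
  have h2 := (h1.sub hb).div hs hs₀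
  rw [zero_sub, neg_div] at h2
  refine h2.congr' ?_
  filter_upwards [hs.eventually_ne hs₀] with K hK
  simp only [Pi.div_apply]
  field_simp
  ring

/-! ### Mean-square continuity of the gradient and of the loss -/

section MeanSquare

variable {Ω : Type*} [MeasurableSpace Ω] {μ : Measure Ω} [IsProbabilityMeasure μ]
  {U : ℕ → Ω → ℝ} {U₀ : Ω → ℝ} {q : ℕ → ℝ} {q₀ α : ℝ}

lemma tendsto_integral_sub_sub_sq (hU : ∀ K, MemLp (U K) 2 μ) (hU₀ : MemLp U₀ 2 μ)
    (hlim : Tendsto (fun K => ∫ ω, (U K ω - U₀ ω) ^ 2 ∂μ) atTop (𝓝 0))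
    (hq : Tendsto q atTop (𝓝 q₀)) :
    Tendsto (fun K => ∫ ω, ((U K ω - q K) - (U₀ ω - q₀)) ^ 2 ∂μ) atTop (𝓝 0) := by
  have h1 : Tendsto (fun K => 2 * ∫ ω, (U K ω - U₀ ω) ^ 2 ∂μ + 2 * (q K - q₀) ^ 2) atTop (𝓝 0) := by
    simpa using (hlim.const_mul 2).add (((hq.sub_const q₀).pow 2).const_mul 2)
  refine squeeze_zero (fun K => integral_nonneg fun ω => sq_nonneg _) (fun K => ?_) h1
  have hi : Integrable (fun ω => (U K ω - U₀ ω) ^ 2) μ := ((hU K).sub hU₀).integrable_sq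
  calc _ ≤ ∫ ω, (2 * (U K ω - U₀ ω) ^ 2 + 2 * (q K - q₀) ^ 2) ∂μ := by
        refine integral_mono_of_nonneg (ae_of_all _ fun ω => sq_nonneg _)
          ((hi.const_mul 2).add (integrable_const _)) (ae_of_all _ fun ω => ?_)
        simp only
        nlinarith [sq_nonneg ((U K ω - U₀ ω) + (q K - q₀))]
    _ = _ := by rw [integral_add (hi.const_mul 2) (integrable_const _), integral_const_mul]; simp

/-- If the two indicators disagree, either y lies within η of its threshold or the two centred
variables differ by at least η. The first event is rare by the Lipschitz cdf, the second by
Chebyshev. -/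
lemma H₁_sub_sq_le (hα : α ∈ Ioo (0 : ℝ) 1) {η : ℝ} (hη : 0 < η) (a b x y : ℝ) :
    (H₁ α a x - H₁ α b y) ^ 2 ≤ (1 - α)⁻¹ ^ 2 *
      ((Icc (b - η) (b + η)).indicator 1 y + ((x - a) - (y - b)) ^ 2 / η ^ 2) := by
  have hα' : 0 < 1 - α := by linarith [hα.2]
  have h0 : 0 ≤ ((x - a) - (y - b)) ^ 2 / η ^ 2 := by positivity
  have h01 : 0 ≤ (Icc (b - η) (b + η)).indicator (1 : ℝ → ℝ) y :=
    indicator_nonneg (fun _ _ => zero_le_one) _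
  have h1 : (H₁ α a x - H₁ α b y) ^ 2
      = (1 - α)⁻¹ ^ 2 * ((if b ≤ y then 1 else 0) - (if a ≤ x then 1 else 0)) ^ 2 := by
    unfold H₁; ring
  rw [h1]
  refine mul_le_mul_of_nonneg_left ?_ (by positivity)
  by_cases hy : y ∈ Icc (b - η) (b + η)
  · rw [indicator_of_mem hy]
    simp only [Pi.one_apply]
    split_ifs <;> linarith
  · have hy' : y < b - η ∨ b + η < y := by
      by_contra! h
      exact hy ⟨h.1, h.2⟩
    have h2 : ∀ z : ℝ, η ≤ |z| → 1 ≤ z ^ 2 / η ^ 2 := fun z hz => by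
      rw [one_le_div (by positivity), ← sq_abs z]
      gcongr
    split_ifs with h3 h4 h4
    · linarith
    · have := h2 ((x - a) - (y - b)) (by
        rcases hy' with h | h
        · linarith
        · rw [abs_of_neg] <;> linarith)
      linarith
    · have := h2 ((x - a) - (y - b)) (by
        rcases hy' with h | h
        · rw [abs_of_pos] <;> linarith
        · linarith)
      linarith
    · linarith

lemma tendsto_integral_H₁_sub_sq (hα : α ∈ Ioo (0 : ℝ) 1) {M : ℝ} (hU : ∀ K, MemLp (U K) 2 μ)
    (hU₀ : MemLp U₀ 2 μ) (hlim : Tendsto (fun K => ∫ ω, (U K ω - U₀ ω) ^ 2 ∂μ) atTop (𝓝 0))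
    (hq : Tendsto q atTop (𝓝 q₀))
    (hlip : ∀ x y, |(μ.map U₀).real (Iic x) - (μ.map U₀).real (Iic y)| ≤ M * |x - y|) :
    Tendsto (fun K => ∫ ω, (H₁ α (q K) (U K ω) - H₁ α q₀ (U₀ ω)) ^ 2 ∂μ) atTop (𝓝 0) := by
  have hα' : 0 < 1 - α := by linarith [hα.2]
  have hU₀m := hU₀.aestronglyMeasurable.aemeasurable
  have := Measure.isProbabilityMeasure_map (μ := μ) hU₀m
  have hM : 0 ≤ M := by
    have := (abs_nonneg _).trans (hlip 1 0)
    simpa using this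
  set e := fun K => ∫ ω, ((U K ω - q K) - (U₀ ω - q₀)) ^ 2 ∂μ with he
  have hlim' : Tendsto e atTop (𝓝 0) := tendsto_integral_sub_sub_sq hU hU₀ hlim hq
  have hbound : ∀ K, ∀ η : ℝ, 0 < η → ∫ ω, (H₁ α (q K) (U K ω) - H₁ α q₀ (U₀ ω)) ^ 2 ∂μ
      ≤ (1 - α)⁻¹ ^ 2 * (3 * M * η + e K / η ^ 2) := fun K η hη => by
    have hi : Integrable (fun ω => ((U K ω - q K) - (U₀ ω - q₀)) ^ 2) μ :=
      (((hU K).sub (memLp_const _)).sub (hU₀.sub (memLp_const _))).integrable_sq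
    have hind : Integrable (fun ω => (Icc (q₀ - η) (q₀ + η)).indicator (1 : ℝ → ℝ) (U₀ ω)) μ :=
      (integrable_map_measure ((measurable_one.indicator measurableSet_Icc).aestronglyMeasurable)
        hU₀m).1 ((integrable_const (1 : ℝ)).indicator measurableSet_Icc)
    have hIcc : ∫ ω, (Icc (q₀ - η) (q₀ + η)).indicator (1 : ℝ → ℝ) (U₀ ω) ∂μ ≤ 3 * M * η := by
      rw [← integral_map (f := (Icc (q₀ - η) (q₀ + η)).indicator (1 : ℝ → ℝ)) hU₀m
        (measurable_one.indicator measurableSet_Icc).aestronglyMeasurable,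
        integral_indicator_one measurableSet_Icc]
      -- Enlarging the closed interval to the left avoids discussing its endpoint, whence the factor
      -- 3.
      have h1 : (μ.map U₀).real (Icc (q₀ - η) (q₀ + η)) ≤
          (μ.map U₀).real (Iic (q₀ + η)) - (μ.map U₀).real (Iic (q₀ - 2 * η)) := by
        rw [← measureReal_sdiff (Iic_subset_Iic.2 (by linarith)) measurableSet_Iic, Iic_sdiff_Iic]
        exact measureReal_mono fun z hz => ⟨by linarith [hz.1], hz.2⟩
      have h2 := (le_abs_self _).trans (hlip (q₀ + η) (q₀ - 2 * η))
      rw [show q₀ + η - (q₀ - 2 * η) = 3 * η by ring, abs_of_pos (by positivity)] at h2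
      linarith
    calc _ ≤ ∫ ω, (1 - α)⁻¹ ^ 2 * ((Icc (q₀ - η) (q₀ + η)).indicator (1 : ℝ → ℝ) (U₀ ω)
            + ((U K ω - q K) - (U₀ ω - q₀)) ^ 2 / η ^ 2) ∂μ :=
          integral_mono_of_nonneg (ae_of_all _ fun ω => sq_nonneg _)
            ((hind.add (hi.div_const _)).const_mul _)
            (ae_of_all _ fun ω => H₁_sub_sq_le hα hη _ _ _ _)
      _ ≤ _ := by
          rw [integral_const_mul, integral_add hind (hi.div_const _), integral_div]
          gcongr
  rw [Metric.tendsto_atTop]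
  intro ε hε
  set η := ε / (2 * ((1 - α)⁻¹ ^ 2 * (3 * M + 1))) with hη
  have hηpos : 0 < η := by positivity
  have h1 : (1 - α)⁻¹ ^ 2 * (3 * M * η) ≤ ε / 2 := by
    calc (1 - α)⁻¹ ^ 2 * (3 * M * η) ≤ (1 - α)⁻¹ ^ 2 * ((3 * M + 1) * η) := by gcongr; linarith
      _ = ε / 2 := by rw [hη]; field_simp
  have h2 : ∀ᶠ K in atTop, (1 - α)⁻¹ ^ 2 * (e K / η ^ 2) < ε / 2 := by
    have := (hlim'.div_const (η ^ 2)).const_mul ((1 - α)⁻¹ ^ 2)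
    rw [zero_div, mul_zero] at this
    exact this.eventually_lt_const (by positivity)
  obtain ⟨N, hN⟩ := eventually_atTop.1 h2
  refine ⟨N, fun K hK => ?_⟩
  rw [Real.dist_0_eq_abs, abs_of_nonneg (integral_nonneg fun ω => sq_nonneg _)]
  have h3 := hbound K η hηpos
  have h4 := hN K hK
  linarith

lemma memLp_lossG {V : Ω → ℝ} (hV : MemLp V 2 μ) (a : ℝ) :
    MemLp (fun ω => lossG α a (V ω)) 2 μ :=
  (memLp_const a).add (((hV.sub (memLp_const a)).pos_part).const_mul _)

lemma memLp_H₁ (hα : α ∈ Ioo (0 : ℝ) 1) {V : Ω → ℝ} (hV : AEMeasurable V μ) (a : ℝ) :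
    MemLp (fun ω => H₁ α a (V ω)) 2 μ :=
  MemLp.of_bound ((measurable_H₁ α).of_uncurry_left.comp_aemeasurable hV).aestronglyMeasurable
    (gradBound α) (ae_of_all _ fun _ => abs_H₁_le hα _ _)

lemma lossG_sub_sq_le (a b x y : ℝ) :
    (lossG α a x - lossG α b y) ^ 2
      ≤ 2 * (a - b) ^ 2 + 2 * (1 - α)⁻¹ ^ 2 * ((x - a) - (y - b)) ^ 2 := by
  have h1 : (max (x - a) 0 - max (y - b) 0) ^ 2 ≤ ((x - a) - (y - b)) ^ 2 := by
    refine sq_le_sq.2 ?_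
    simpa using abs_max_sub_max_le_abs (x - a) (y - b) 0
  have h2 : lossG α a x - lossG α b y
      = (a - b) + (1 - α)⁻¹ * (max (x - a) 0 - max (y - b) 0) := by unfold lossG; ring
  rw [h2]
  have h3 := mul_le_mul_of_nonneg_left h1 (sq_nonneg (1 - α)⁻¹)
  nlinarith [sq_nonneg ((a - b) - (1 - α)⁻¹ * (max (x - a) 0 - max (y - b) 0))]

/-- The loss is Lipschitz in the threshold and in the variable, and centring the difference only
decreases its second moment. -/
lemma tendsto_integral_lossG_sub_sq (hU : ∀ K, MemLp (U K) 2 μ)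
    (hU₀ : MemLp U₀ 2 μ) (hlim : Tendsto (fun K => ∫ ω, (U K ω - U₀ ω) ^ 2 ∂μ) atTop (𝓝 0))
    (hq : Tendsto q atTop (𝓝 q₀)) :
    Tendsto (fun K => ∫ ω, ((lossG α (q K) (U K ω) - ∫ x, lossG α (q K) (U K x) ∂μ)
      - (lossG α q₀ (U₀ ω) - ∫ x, lossG α q₀ (U₀ x) ∂μ)) ^ 2 ∂μ) atTop (𝓝 0) := by
  have h1 : Tendsto (fun K => 2 * (q K - q₀) ^ 2 + 2 * (1 - α)⁻¹ ^ 2 *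
      ∫ ω, ((U K ω - q K) - (U₀ ω - q₀)) ^ 2 ∂μ) atTop (𝓝 0) := by
    have := (((hq.sub_const q₀).pow 2).const_mul 2).add
      ((tendsto_integral_sub_sub_sq hU hU₀ hlim hq).const_mul (2 * (1 - α)⁻¹ ^ 2))
    rwa [sub_self, zero_pow two_ne_zero, mul_zero, mul_zero, add_zero] at this
  refine squeeze_zero (fun K => integral_nonneg fun ω => sq_nonneg _) (fun K => ?_) h1
  have hG := memLp_lossG (α := α) (hU K) (q K)
  have hG₀ := memLp_lossG (α := α) hU₀ q₀
  have hi : Integrable (fun ω => ((U K ω - q K) - (U₀ ω - q₀)) ^ 2) μ :=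
    (((hU K).sub (memLp_const _)).sub (hU₀.sub (memLp_const _))).integrable_sq
  have h2 := integral_sub_integral_sq_le (hG.sub hG₀)
  simp only [Pi.sub_apply] at h2
  rw [integral_sub (hG.integrable (by norm_num)) (hG₀.integrable (by norm_num))] at h2
  calc _ = ∫ ω, (lossG α (q K) (U K ω) - lossG α q₀ (U₀ ω)
        - (∫ x, lossG α (q K) (U K x) ∂μ - ∫ x, lossG α q₀ (U₀ x) ∂μ)) ^ 2 ∂μ := by
        congr 1; funext ω; ring
    _ ≤ _ := h2
    _ ≤ ∫ ω, (2 * (q K - q₀) ^ 2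
        + 2 * (1 - α)⁻¹ ^ 2 * ((U K ω - q K) - (U₀ ω - q₀)) ^ 2) ∂μ :=
        integral_mono_of_nonneg (ae_of_all _ fun ω => sq_nonneg _)
          ((integrable_const _).add (hi.const_mul _))
          (ae_of_all _ fun ω => lossG_sub_sq_le _ _ _ _)
    _ = _ := by
        rw [integral_add (integrable_const _) (hi.const_mul _),
          integral_const_mul (2 * (1 - α)⁻¹ ^ 2), integral_const, probReal_univ, one_smul]

end MeanSquare

/-! ### Quantiles and biases of the biased losses -/

section Bias

variable {Ω : Type*} [MeasurableSpace Ω] {μ : Measure Ω} [IsProbabilityMeasure μ]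
  {U : ℕ → Ω → ℝ} {U₀ : Ω → ℝ} {α : ℝ} {v : ℝ → ℝ} {w : ℝ → ℕ → ℝ} {f₀ : ℝ → ℝ} {f : ℕ → ℝ → ℝ}

lemma cdfOf_VaR {X : Ω → ℝ} {g : ℝ → ℝ} (hα : α ∈ Ioo (0 : ℝ) 1) (hX : AEMeasurable X μ)
    (hg : IsContinuousPdf μ X g) (hpos : ∀ x, 0 < g x) : cdfOf μ X (VaR μ X α) = α := by
  have := Measure.isProbabilityMeasure_map (μ := μ) hX
  have hF : cdfOf μ X = fun x => (μ.map X).real (Iic x) := funext fun x => cdfOf_eq_map hX x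
  obtain ⟨y, hy⟩ := exists_measureReal_Iic_eq (P := μ.map X) (continuous_iff_continuousAt.2 fun x =>
    (hasDerivAt_measureReal_Iic hg.continuous hg.nonneg hg.law x).continuousAt) hα
  have hmono : StrictMono (cdfOf μ X) := by
    rw [hF]; exact strictMono_measureReal_Iic hg.continuous hpos hg.law
  have hy' : cdfOf μ X y = α := by rw [hF]; exact hy
  conv_lhs => rw [← hy', VaR_of_strictMono hmono, hy']

/-- The bias of the objective is governed by the tail integral of the bias of the cdf. -/
lemma tendsto_scaled_objective_sub {ξ : ℝ} (hU : ∀ K, Integrable (U K) μ) (hU₀ : Integrable U₀ μ)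
    (hvw : ∀ K : ℕ, 1 ≤ K → ∀ ξ : ℝ,
      cdfOf μ (U K) ξ - cdfOf μ U₀ ξ = v ξ * (1 / (K : ℝ)) + w ξ K * (1 / (K : ℝ)))
    (hv : IntegrableOn v (Ioi ξ)) (hw : Tendsto (fun K : ℕ => ∫ x in Ioi ξ, w x K) atTop (𝓝 0)) :
    Tendsto (fun K : ℕ => (K : ℝ) * (objective μ (U K) α ξ - objective μ U₀ α ξ)) atTop
      (𝓝 (-∫ x in Ioi ξ, v x / (1 - α))) := by
  have key : ∀ V : Ω → ℝ, Integrable V μ → IntegrableOn (fun t => 1 - cdfOf μ V t) (Ioi ξ) ∧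
      ∫ ω, max (V ω - ξ) 0 ∂μ = ∫ t in Ioi ξ, (1 - cdfOf μ V t) := fun V hV => by
    have hVm := hV.aestronglyMeasurable.aemeasurable
    have := Measure.isProbabilityMeasure_map (μ := μ) hVm
    have h := integral_max_sub (μ.map V)
      ((integrable_map_measure aestronglyMeasurable_id hVm).2 hV) ξ
    rw [integral_map hVm (by fun_prop)] at h
    simp_rw [cdfOf_eq_map hVm]
    exact h
  obtain ⟨i0, e0⟩ := key U₀ hU₀
  have h1 : Tendsto (fun K : ℕ => -((1 - α)⁻¹ * ((∫ x in Ioi ξ, v x) + ∫ x in Ioi ξ, w x K))) atTop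
      (𝓝 (-((1 - α)⁻¹ * ((∫ x in Ioi ξ, v x) + 0)))) :=
    ((hw.const_add _).const_mul _).neg
  have h2 : ∫ x in Ioi ξ, v x / (1 - α) = (1 - α)⁻¹ * ((∫ x in Ioi ξ, v x) + 0) := by
    rw [integral_div, add_zero, div_eq_inv_mul]
  rw [h2]
  refine h1.congr' ?_
  filter_upwards [eventually_ge_atTop 1] with K hK
  have hK' : (K : ℝ) ≠ 0 := by positivity
  obtain ⟨i1, e1⟩ := key (U K) (hU K)
  have hpt : ∀ x, v x + w x K = K * ((1 - cdfOf μ U₀ x) - (1 - cdfOf μ (U K) x)) := fun x => by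
    have := hvw K hK x
    rw [sub_sub_sub_cancel_left, this]
    field_simp
  have hsum : IntegrableOn (fun x => v x + w x K) (Ioi ξ) := by
    simp_rw [hpt]; exact (i0.sub i1).const_mul _
  -- Integrability of w follows from that of v and of v + w, the latter being K times a difference
  -- of integrable tails.
  have hwi : IntegrableOn (fun x => w x K) (Ioi ξ) := by
    refine (hsum.sub hv).congr_fun (fun x _ => ?_) measurableSet_Ioi
    simp
  have e2 : (∫ x in Ioi ξ, v x) + ∫ x in Ioi ξ, w x K
      = K * ((∫ t in Ioi ξ, (1 - cdfOf μ U₀ t)) - ∫ t in Ioi ξ, (1 - cdfOf μ (U K) t)) := by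
    rw [← integral_add hv hwi, ← integral_sub i0 i1, ← integral_const_mul]
    simp_rw [hpt]
  simp only [objective]
  rw [e2, e1, e0]
  ring

/-- The quantile q K is a root of a cdf close to that of `U₀`. It is first located roughly, then
expanded to first order, and finally inserted into the objective, where its displacement counts only
to second order. -/
theorem exists_regular_quantiles (hα : α ∈ Ioo (0 : ℝ) 1) (hU : ∀ K, Integrable (U K) μ)
    (hU₀ : Integrable U₀ μ)
    (hvw : ∀ K : ℕ, 1 ≤ K → ∀ ξ : ℝ,
      cdfOf μ (U K) ξ - cdfOf μ U₀ ξ = v ξ * (1 / (K : ℝ)) + w ξ K * (1 / (K : ℝ)))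
    (hv : ∀ ξ ∈ argminObjective μ U₀ α, IntegrableOn v (Set.Ioi ξ))
    (hw : ∀ ξ ∈ argminObjective μ U₀ α,
      Tendsto (fun K : ℕ => w ξ K) atTop (𝓝 0) ∧
      Tendsto (fun K : ℕ => ∫ x in Set.Ioi ξ, w x K) atTop (𝓝 0))
    (hf₀ : IsContinuousPdf μ U₀ f₀) (hf : ∀ K : ℕ, 1 ≤ K → IsContinuousPdf μ (U K) (f K))
    (hf_lim : TendstoLocallyUniformly f f₀ atTop)
    (hf_pos : ∀ R : ℝ, 0 < R → ∃ m : ℝ, 0 < m ∧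
      ∀ ξ ∈ Metric.ball (VaR μ U₀ α) R, m ≤ f₀ ξ ∧ ∀ K : ℕ, 1 ≤ K → m ≤ f K ξ)
    (hf_bdd : ∃ M : ℝ, ∀ ξ, f₀ ξ ≤ M ∧ ∀ K : ℕ, 1 ≤ K → f K ξ ≤ M)
    (hf_lip : ∃ L : ℝ≥0, LipschitzWith L f₀ ∧ ∀ K : ℕ, 1 ≤ K → LipschitzWith L (f K)) :
    ∃ (m M L : ℝ) (q : ℕ → ℝ), 0 < m ∧ 0 ≤ L ∧
      RegularLaw (μ.map U₀) α (VaR μ U₀ α) (f₀ (VaR μ U₀ α)) m M L ∧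
      (∀ᶠ K in atTop, RegularLaw (μ.map (U K)) α (q K) (f K (q K)) m M L) ∧
      Tendsto q atTop (𝓝 (VaR μ U₀ α)) ∧
      Tendsto (fun K => f K (q K)) atTop (𝓝 (f₀ (VaR μ U₀ α))) ∧
      Tendsto (fun K : ℕ => (K : ℝ) * (q K - VaR μ U₀ α)) atTop
        (𝓝 (-(v (VaR μ U₀ α) / f₀ (VaR μ U₀ α)))) ∧
      Tendsto (fun K : ℕ => (K : ℝ) * (lawObjective (μ.map (U K)) α (q K) - ES μ U₀ α)) atTop
        (𝓝 (-∫ x in Ioi (VaR μ U₀ α), v x / (1 - α))) := by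
  have hα' : 0 < 1 - α := by linarith [hα.2]
  set ξ := VaR μ U₀ α with hξ
  -- Radius 3 contains the unit interval around every q K within distance 1 of ξ.
  obtain ⟨m, hm, hmf⟩ := hf_pos 3 (by norm_num)
  obtain ⟨M, hM⟩ := hf_bdd
  obtain ⟨L, hL₀, hL⟩ := hf_lip
  have hUm := fun K => (hU K).aestronglyMeasurable.aemeasurable
  have hU₀m := hU₀.aestronglyMeasurable.aemeasurable
  have hpr : ∀ K, IsProbabilityMeasure (μ.map (U K)) := fun K =>
    Measure.isProbabilityMeasure_map (hUm K)
  have hpr₀ := Measure.isProbabilityMeasure_map (μ := μ) hU₀m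
  have hi : ∀ K, Integrable id (μ.map (U K)) := fun K =>
    (integrable_map_measure aestronglyMeasurable_id (hUm K)).2 (hU K)
  have hi₀ : Integrable id (μ.map U₀) :=
    (integrable_map_measure aestronglyMeasurable_id hU₀m).2 hU₀
  have hpos₀ : ∀ x, 0 < f₀ x := fun x => by
    obtain ⟨m', hm', h⟩ := hf_pos (dist x ξ + 1) (by positivity)
    exact hm'.trans_le (h x (by rw [Metric.mem_ball]; linarith)).1
  have hξα : cdfOf μ U₀ ξ = α := cdfOf_VaR hα hU₀m hf₀ hpos₀
  have hball : ∀ x, |x - ξ| < 3 → x ∈ Metric.ball ξ 3 := fun x hx => by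
    rwa [Metric.mem_ball, Real.dist_eq]
  have R₀ : RegularLaw (μ.map U₀) α ξ (f₀ ξ) m M L :=
    regularLaw_of_density hf₀.continuous hf₀.nonneg hf₀.law (by rw [← cdfOf_eq_map hU₀m, hξα])
      (fun x => (hM x).1) hL₀ (fun x hx => (hmf x (hball x (by linarith))).1) hi₀
  have hargmin : ξ ∈ argminObjective μ U₀ α := fun x => by
    rw [objective_eq_lawObjective hU₀m hU₀, objective_eq_lawObjective hU₀m hU₀]
    linarith [R₀.lawObjective_sub_nonneg hα x]
  obtain ⟨hw1, hw2⟩ := hw ξ hargmin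
  have hq : ∀ K, ∃ x, 1 ≤ K → (μ.map (U K)).real (Iic x) = α := fun K => by
    by_cases hK : 1 ≤ K
    · have hfK := hf K hK
      obtain ⟨x, hx⟩ := exists_measureReal_Iic_eq (P := μ.map (U K))
        (continuous_iff_continuousAt.2 fun x =>
          (hasDerivAt_measureReal_Iic hfK.continuous hfK.nonneg hfK.law x).continuousAt) hα
      exact ⟨x, fun _ => hx⟩
    · exact ⟨0, fun h => absurd h hK⟩
  choose q hq using hq
  set b := fun K => v ξ + w ξ K with hb_def
  have hb : Tendsto b atTop (𝓝 (v ξ)) := by simpa using hw1.const_add (v ξ)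
  have hbK : ∀ K, 1 ≤ K → b K / K = (μ.map (U K)).real (Iic ξ) - α := fun K hK => by
    rw [← cdfOf_eq_map (hUm K), ← hξα, hvw K hK, hb_def]; ring
  -- Here ξ is treated as the quantile of `U K` of its own order F_K(ξ). This gives the drift
  -- inequality at q K before q K is known to be close to ξ.
  have hRξ : ∀ K, 1 ≤ K → RegularLaw (μ.map (U K)) ((μ.map (U K)).real (Iic ξ)) ξ (f K ξ) m M L :=
    fun K hK => regularLaw_of_density (hf K hK).continuous (hf K hK).nonneg (hf K hK).law rfl
      (fun x => (hM x).2 K hK) (hL K hK)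
      (fun x hx => (hmf x (hball x (by linarith))).2 K hK) (hi K)
  obtain ⟨hD, hKD⟩ := tendsto_scaled_root (D := fun K => q K - ξ) hm hb (by
    filter_upwards [eventually_ge_atTop 1] with K hK
    have := (hRξ K hK).drift (q K)
    rwa [hq K hK, abs_sub_comm α, ← hbK K hK] at this)
  have hqlim : Tendsto q atTop (𝓝 ξ) := by simpa using hD.add_const ξ
  have hR : ∀ᶠ K in atTop, RegularLaw (μ.map (U K)) α (q K) (f K (q K)) m M L := by
    have hnear : ∀ᶠ K in atTop, |q K - ξ| < 1 := by
      have := hD.abs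
      rw [abs_zero] at this
      exact this.eventually_lt_const one_pos
    filter_upwards [eventually_ge_atTop 1, hnear] with K hK hqK
    refine regularLaw_of_density (hf K hK).continuous (hf K hK).nonneg (hf K hK).law (hq K hK)
      (fun x => (hM x).2 K hK) (hL K hK) (fun x hx => (hmf x (hball x ?_)).2 K hK) (hi K)
    have := abs_sub_le x (q K) ξ
    linarith
  have hslim : Tendsto (fun K => f K (q K)) atTop (𝓝 (f₀ ξ)) :=
    hf_lim.tendsto_comp hf₀.continuous.continuousAt hqlim
  refine ⟨m, M, L, q, hm, L.coe_nonneg, R₀, hR, hqlim, hslim,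
    tendsto_scaled_bias (L := L) (hpos₀ ξ).ne' hb hslim hKD ?_, ?_⟩
  · filter_upwards [hR, eventually_ge_atTop 1] with K hK hK1
    have := hK.linear ξ
    rw [← hbK K hK1] at this
    calc _ = |b K / K - f K (q K) * (ξ - q K)| := by congr 1; ring
      _ ≤ _ := this
      _ = _ := by ring
  · have h1 := tendsto_scaled_objective_sub (α := α) hU hU₀ hvw (hv ξ hargmin) hw2
    have h2 : Tendsto (fun K : ℕ => (K : ℝ) *
        (lawObjective (μ.map (U K)) α (q K) - objective μ (U K) α ξ)) atTop (𝓝 0) := by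
      refine squeeze_zero_norm' (a := fun K : ℕ => M / (1 - α) * (K * (q K - ξ) ^ 2)) ?_
        (by simpa using hKD.const_mul (M / (1 - α)))
      filter_upwards [hR] with K hK
      have h3 := hK.lawObjective_sub_nonneg hα ξ
      have h4 := hK.lawObjective_sub_le hα ξ
      rw [objective_eq_lawObjective (hUm K) (hU K), Real.norm_eq_abs, abs_mul, Nat.abs_cast,
        abs_sub_comm, abs_of_nonneg h3]
      calc (K : ℝ) * (lawObjective (μ.map (U K)) α ξ - lawObjective (μ.map (U K)) α (q K))
          ≤ K * (M / (1 - α) * (ξ - q K) ^ 2) := by gcongr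
        _ = _ := by ring
    have h3 := h2.add h1
    rw [zero_add] at h3
    refine h3.congr fun K => ?_
    rw [ES_eq_objective hα hU₀m hU₀ hf₀ hpos₀ hξα]
    ring

end Bias

/-! ### Exponential moments of the initial values -/

/-- Converts the moment condition into the initial bound for the Lyapunov recursion, uniformly over
targets r in a bounded set, since the target q K varies with K. -/
lemma exists_integral_cosh_le {Ω : Type*} [MeasurableSpace Ω] {μ : Measure Ω}
    [IsProbabilityMeasure μ] {ξ₀ : ℕ → Ω → ℝ} {c l : ℝ} (hc : 0 < c) (hl : 0 < l) (hlc : l ≤ c)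
    (hξ₀ : ∀ K : ℕ, 1 ≤ K → Measurable (ξ₀ K))
    (hmom : (⨆ K ∈ Set.Ici (1 : ℕ), ∫⁻ ω, ENNReal.ofReal (|ξ₀ K ω| ^ 2 *
      Real.exp (c * |ξ₀ K ω|)) ∂μ) < ∞) (Q : ℝ) :
    ∃ B : ℝ, ∀ K : ℕ, 1 ≤ K → ∀ r : ℝ, |r| ≤ Q →
      Integrable (fun ω => Real.cosh (l * (ξ₀ K ω - r))) μ ∧
      ∫ ω, Real.cosh (l * (ξ₀ K ω - r)) ∂μ ≤ B := by
  set A := ⨆ K ∈ Set.Ici (1 : ℕ), ∫⁻ ω, ENNReal.ofReal (|ξ₀ K ω| ^ 2 *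
      Real.exp (c * |ξ₀ K ω|)) ∂μ with hA
  refine ⟨Real.exp (c * Q) * (Real.exp c + A.toReal), fun K hK r hr => ?_⟩
  have hm := hξ₀ K hK
  have hle : ∫⁻ ω, ENNReal.ofReal (|ξ₀ K ω| ^ 2 * Real.exp (c * |ξ₀ K ω|)) ∂μ ≤ A :=
    le_iSup₂ (f := fun K (_ : K ∈ Set.Ici (1 : ℕ)) =>
      ∫⁻ ω, ENNReal.ofReal (|ξ₀ K ω| ^ 2 * Real.exp (c * |ξ₀ K ω|)) ∂μ) K hK
  have hnn : ∀ ω, 0 ≤ |ξ₀ K ω| ^ 2 * Real.exp (c * |ξ₀ K ω|) := fun ω => by positivity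
  have hg : Integrable (fun ω => |ξ₀ K ω| ^ 2 * Real.exp (c * |ξ₀ K ω|)) μ :=
    (lintegral_ofReal_ne_top_iff_integrable (by fun_prop) (ae_of_all _ hnn)).1
      (hle.trans_lt hmom).ne
  have hgA : ∫ ω, |ξ₀ K ω| ^ 2 * Real.exp (c * |ξ₀ K ω|) ∂μ ≤ A.toReal := by
    rw [integral_eq_lintegral_of_nonneg_ae (ae_of_all _ hnn) (by fun_prop)]
    exact ENNReal.toReal_mono hmom.ne hle
  -- The weight |x|² may vanish near 0; there the exponential is at most e^c.
  have hexp : ∀ x : ℝ, Real.exp (c * |x|) ≤ Real.exp c + |x| ^ 2 * Real.exp (c * |x|) := fun x => by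
    rcases le_total |x| 1 with h | h
    · have h1 : Real.exp (c * |x|) ≤ Real.exp c := Real.exp_le_exp.2 (by nlinarith)
      have : 0 ≤ |x| ^ 2 * Real.exp (c * |x|) := by positivity
      linarith
    · have h1 : 1 * Real.exp (c * |x|) ≤ |x| ^ 2 * Real.exp (c * |x|) := by
        gcongr; exact one_le_pow₀ h
      have := Real.exp_pos c
      linarith
  have hcosh : ∀ ω, Real.cosh (l * (ξ₀ K ω - r))
      ≤ Real.exp (c * Q) * (Real.exp c + |ξ₀ K ω| ^ 2 * Real.exp (c * |ξ₀ K ω|)) := fun ω => by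
    calc Real.cosh (l * (ξ₀ K ω - r)) ≤ Real.exp |l * (ξ₀ K ω - r)| := by
          rw [← Real.cosh_abs, Real.cosh_eq]
          have := Real.exp_le_exp.2 (neg_le_self (abs_nonneg (l * (ξ₀ K ω - r))))
          linarith
      _ ≤ Real.exp (c * Q + c * |ξ₀ K ω|) := by
          rw [Real.exp_le_exp, abs_mul, abs_of_pos hl]
          have := abs_sub (ξ₀ K ω) r
          calc l * |ξ₀ K ω - r| ≤ c * (|ξ₀ K ω| + Q) := by gcongr; linarith
            _ = _ := by ring
      _ ≤ _ := by rw [Real.exp_add]; gcongr; exact hexp _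
  have hi : Integrable (fun ω => Real.exp (c * Q) *
      (Real.exp c + |ξ₀ K ω| ^ 2 * Real.exp (c * |ξ₀ K ω|))) μ :=
    ((integrable_const _).add hg).const_mul _
  have hci : Integrable (fun ω => Real.cosh (l * (ξ₀ K ω - r))) μ := by
    refine hi.mono' (by fun_prop) (ae_of_all _ fun ω => ?_)
    rw [Real.norm_of_nonneg (Real.cosh_pos _).le]
    exact hcosh ω
  refine ⟨hci, (integral_mono hci hi hcosh).trans ?_⟩
  rw [integral_const_mul, integral_add (integrable_const _) hg, integral_const, probReal_univ,
    one_smul]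
  gcongr

/-! ### The central limit theorem for the leading terms -/

/-- The summand of the leading term of a linear combination, with weights `t₀` and `t₁`, of the
two estimators. -/
def leadingTerm (α t₀ t₁ a q χ x : ℝ) : ℝ := -(t₀ * a⁻¹) * H₁ α q x + t₁ * (lossG α q x - χ)

lemma measurable_leadingTerm (α t₀ t₁ a q χ : ℝ) : Measurable (leadingTerm α t₀ t₁ a q χ) := by
  have h1 := (measurable_H₁ α).of_uncurry_left (x := q)
  have h2 := (measurable_lossG α).of_uncurry_left (x := q)
  unfold leadingTerm
  fun_prop

section Leading

variable {Ω : Type*} [MeasurableSpace Ω] {μ : Measure Ω} [IsProbabilityMeasure μ] {α : ℝ}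

/-- With K² terms the normalization √n is exactly K. -/
lemma IsInnovation.charFun_sum {P : Measure ℝ} {ξ₀ : Ω → ℝ} {X : ℕ → Ω → ℝ} {g : ℝ → ℝ}
    (h : IsInnovation μ P ξ₀ X) (hg : Measurable g) (K : ℕ) :
    charFun (μ.map fun ω => (K : ℝ)⁻¹ * ∑ k ∈ Finset.range (K ^ 2), g (X k ω)) 1
      = charFun (P.map g) ((K : ℝ)⁻¹) ^ (K ^ 2) := by
  have hmap : ∀ k, μ.map (fun ω => g (X k ω)) = P.map g := fun k => by
    rw [← h.law k, Measure.map_map hg (h.measurable k)]; rfl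
  have h1 := charFun_inv_sqrt_mul_sum (P := μ) (X := fun k ω => g (X k ω))
    (h.indep.comp (fun _ => g) fun _ => hg)
    (fun k => ⟨(hg.comp (h.measurable k)).aemeasurable, (hg.comp (h.measurable 0)).aemeasurable,
      by rw [hmap, hmap]⟩) (n := K ^ 2) (t := 1)
  rw [hmap] at h1
  simpa [Real.sqrt_sq] using h1

lemma memLp_leadingTerm (hα : α ∈ Ioo (0 : ℝ) 1) {V : Ω → ℝ} (hV : MemLp V 2 μ)
    (t₀ t₁ a q χ : ℝ) : MemLp (fun ω => leadingTerm α t₀ t₁ a q χ (V ω)) 2 μ :=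
  ((memLp_H₁ hα hV.aestronglyMeasurable.aemeasurable q).const_mul _).add
    (((memLp_lossG hV q).sub (memLp_const χ)).const_mul t₁)

lemma integral_lossG_comp {V : Ω → ℝ} (hV : AEMeasurable V μ) (q : ℝ) :
    ∫ ω, lossG α q (V ω) ∂μ = lawObjective (μ.map V) α q := by
  rw [lawObjective, integral_map hV ((measurable_lossG α).of_uncurry_left).aestronglyMeasurable]

lemma integral_H₁_comp (hα : α ∈ Ioo (0 : ℝ) 1) {V : Ω → ℝ} (hV : AEMeasurable V μ)
    {q s m M L : ℝ} (h : RegularLaw (μ.map V) α q s m M L) : ∫ ω, H₁ α q (V ω) ∂μ = 0 := by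
  have := Measure.isProbabilityMeasure_map (μ := μ) hV
  rw [← h.integral_H₁_self hα,
    integral_map hV ((measurable_H₁ α).of_uncurry_left).aestronglyMeasurable]

lemma integral_leadingTerm (hα : α ∈ Ioo (0 : ℝ) 1) {V : Ω → ℝ} (hV : MemLp V 2 μ)
    {q s m M L : ℝ} (h : RegularLaw (μ.map V) α q s m M L) (t₀ t₁ a : ℝ) :
    ∫ ω, leadingTerm α t₀ t₁ a q (lawObjective (μ.map V) α q) (V ω) ∂μ = 0 := by
  have hVm := hV.aestronglyMeasurable.aemeasurable
  have i1 : Integrable (fun ω => H₁ α q (V ω)) μ := (memLp_H₁ hα hVm q).integrable (by norm_num)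
  have i2 : Integrable (fun ω => lossG α q (V ω)) μ := (memLp_lossG hV q).integrable (by norm_num)
  have i3 : Integrable (fun ω => lossG α q (V ω) - lawObjective (μ.map V) α q) μ :=
    i2.sub (integrable_const _)
  simp only [leadingTerm]
  rw [integral_add (i1.const_mul _) (i3.const_mul _), integral_const_mul, integral_const_mul,
    integral_sub i2 (integrable_const _), integral_H₁_comp hα hVm h, integral_lossG_comp hVm]
  simp

/-- Mean-square convergence of the gradient and of the centred loss, together with that of the slope
a, carries over to the summand; the limit theorem for the triangular array then applies. -/
lemma tendsto_charFun_leadingTerm (hα : α ∈ Ioo (0 : ℝ) 1) {U : ℕ → Ω → ℝ} {U₀ : Ω → ℝ}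
    {q a s : ℕ → ℝ} {q₀ a₀ s₀ m M L : ℝ} (hU : ∀ K, MemLp (U K) 2 μ) (hU₀ : MemLp U₀ 2 μ)
    (hlim : Tendsto (fun K => ∫ ω, (U K ω - U₀ ω) ^ 2 ∂μ) atTop (𝓝 0))
    (hq : Tendsto q atTop (𝓝 q₀)) (ha : Tendsto a atTop (𝓝 a₀)) (ha₀ : a₀ ≠ 0)
    (hR : ∀ᶠ K in atTop, RegularLaw (μ.map (U K)) α (q K) (s K) m M L)
    (hR₀ : RegularLaw (μ.map U₀) α q₀ s₀ m M L) (t₀ t₁ : ℝ) :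
    Tendsto (fun K : ℕ => charFun ((μ.map (U K)).map (leadingTerm α t₀ t₁ (a K) (q K)
        (lawObjective (μ.map (U K)) α (q K)))) ((K : ℝ)⁻¹) ^ (K ^ 2)) atTop
      (𝓝 (Complex.exp (-((∫ ω, leadingTerm α t₀ t₁ a₀ q₀
        (lawObjective (μ.map U₀) α q₀) (U₀ ω) ^ 2 ∂μ : ℝ) : ℂ) / 2))) := by
  have hUm := fun K => (hU K).aestronglyMeasurable.aemeasurable
  have hU₀m := hU₀.aestronglyMeasurable.aemeasurable
  set A := fun K ω => H₁ α (q K) (U K ω) with hA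
  set A₀ := fun ω => H₁ α q₀ (U₀ ω) with hA₀
  set W := fun K ω => lossG α (q K) (U K ω) - lawObjective (μ.map (U K)) α (q K) with hW
  set W₀ := fun ω => lossG α q₀ (U₀ ω) - lawObjective (μ.map U₀) α q₀ with hW₀
  have iA : ∀ K, MemLp (A K) 2 μ := fun K => memLp_H₁ hα (hUm K) _
  have iA₀ : MemLp A₀ 2 μ := memLp_H₁ hα hU₀m _
  have iW : ∀ K, MemLp (W K) 2 μ := fun K => (memLp_lossG (hU K) _).sub (memLp_const _)
  have iW₀ : MemLp W₀ 2 μ := (memLp_lossG hU₀ _).sub (memLp_const _)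
  have lA : Tendsto (fun K => ∫ ω, (A K ω - A₀ ω) ^ 2 ∂μ) atTop (𝓝 0) :=
    tendsto_integral_H₁_sub_sq hα hU hU₀ hlim hq hR₀.lip
  have lW : Tendsto (fun K => ∫ ω, (W K ω - W₀ ω) ^ 2 ∂μ) atTop (𝓝 0) := by
    have := tendsto_integral_lossG_sub_sq (α := α) hU hU₀ hlim hq
    simpa only [integral_lossG_comp hU₀m, integral_lossG_comp (hUm _)] using this
  have hainv : Tendsto (fun K => (a K)⁻¹) atTop (𝓝 a₀⁻¹) := ha.inv₀ ha₀
  have hS : Tendsto (fun K => ∫ ω, (leadingTerm α t₀ t₁ (a K) (q K)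
      (lawObjective (μ.map (U K)) α (q K)) (U K ω) - leadingTerm α t₀ t₁ a₀ q₀
        (lawObjective (μ.map U₀) α q₀) (U₀ ω)) ^ 2 ∂μ) atTop (𝓝 0) := by
    have hb : Tendsto (fun K => 3 * (t₀ * (a K)⁻¹) ^ 2 * ∫ ω, (A K ω - A₀ ω) ^ 2 ∂μ
        + 3 * (t₀ * ((a K)⁻¹ - a₀⁻¹)) ^ 2 * ∫ ω, A₀ ω ^ 2 ∂μ
        + 3 * t₁ ^ 2 * ∫ ω, (W K ω - W₀ ω) ^ 2 ∂μ) atTop (𝓝 0) := by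
      have := (((((hainv.const_mul t₀).pow 2).const_mul 3).mul lA).add
        (((((hainv.sub_const a₀⁻¹).const_mul t₀).pow 2).const_mul 3).mul_const
          (∫ ω, A₀ ω ^ 2 ∂μ))).add (lW.const_mul (3 * t₁ ^ 2))
      simpa only [sub_self, mul_zero, zero_mul, add_zero, zero_pow two_ne_zero] using this
    refine squeeze_zero (fun K => integral_nonneg fun ω => sq_nonneg _) (fun K => ?_) hb
    have i1 : Integrable (fun ω => 3 * (t₀ * (a K)⁻¹) ^ 2 * (A K ω - A₀ ω) ^ 2) μ :=
      ((iA K).sub iA₀).integrable_sq.const_mul _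
    have i2 : Integrable (fun ω => 3 * (t₀ * ((a K)⁻¹ - a₀⁻¹)) ^ 2 * A₀ ω ^ 2) μ :=
      iA₀.integrable_sq.const_mul _
    have i3 : Integrable (fun ω => 3 * t₁ ^ 2 * (W K ω - W₀ ω) ^ 2) μ :=
      ((iW K).sub iW₀).integrable_sq.const_mul _
    rw [← integral_const_mul, ← integral_const_mul, ← integral_const_mul, ← integral_add i1 i2,
      ← integral_add (f := fun ω => 3 * (t₀ * (a K)⁻¹) ^ 2 * (A K ω - A₀ ω) ^ 2
        + 3 * (t₀ * ((a K)⁻¹ - a₀⁻¹)) ^ 2 * A₀ ω ^ 2) (i1.add i2) i3]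
    refine integral_mono_of_nonneg (ae_of_all _ fun ω => sq_nonneg _) ((i1.add i2).add i3)
      (ae_of_all _ fun ω => ?_)
    have key : ∀ x y z : ℝ, (x + y + z) ^ 2 ≤ 3 * x ^ 2 + 3 * y ^ 2 + 3 * z ^ 2 := fun x y z => by
      nlinarith [sq_nonneg (x - y), sq_nonneg (y - z), sq_nonneg (x - z)]
    have := key (-(t₀ * (a K)⁻¹) * (A K ω - A₀ ω)) (-(t₀ * ((a K)⁻¹ - a₀⁻¹)) * A₀ ω)
      (t₁ * (W K ω - W₀ ω))
    simp only [leadingTerm]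
    calc _ = (-(t₀ * (a K)⁻¹) * (A K ω - A₀ ω) + -(t₀ * ((a K)⁻¹ - a₀⁻¹)) * A₀ ω
          + t₁ * (W K ω - W₀ ω)) ^ 2 := by simp only [hA, hA₀, hW, hW₀]; ring
      _ ≤ _ := this
      _ = _ := by ring
  have h := tendsto_charFun_pow_sq (Eventually.of_forall fun K => memLp_leadingTerm hα (hU K) t₀ t₁
    (a K) (q K) _) (memLp_leadingTerm hα hU₀ t₀ t₁ a₀ q₀ _)
    (hR.mono fun K hK => integral_leadingTerm hα (hU K) hK t₀ t₁ (a K))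
    (integral_leadingTerm hα hU₀ hR₀ t₀ t₁ a₀) hS
  refine h.congr fun K => ?_
  rw [AEMeasurable.map_map_of_aemeasurable (measurable_leadingTerm _ _ _ _ _ _).aemeasurable
    (hUm K)]
  rfl

/-- Since `H₁` takes two values, its square is affine in it, and its product with (x - q)⁺ is -α/(1
- α) times (x - q)⁺. So the square of the summand is explicit up to multiples of `H₁`, which
integrates to 0. -/
lemma integral_leadingTerm_sq (hα : α ∈ Ioo (0 : ℝ) 1) {V : Ω → ℝ} (hV : MemLp V 2 μ)
    {g : ℝ → ℝ} {q m M L : ℝ} (hm : 0 < m) (h : RegularLaw (μ.map V) α q (g q) m M L) (t₀ t₁ : ℝ) :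
    ∫ ω, leadingTerm α t₀ t₁ (g q / (1 - α)) q (lawObjective (μ.map V) α q) (V ω) ^ 2 ∂μ
      = t₀ ^ 2 * limitCov μ V g α q 0 0 + 2 * t₀ * t₁ * limitCov μ V g α q 0 1
        + t₁ ^ 2 * limitCov μ V g α q 1 1 := by
  have hα' : 1 - α ≠ 0 := by linarith [hα.2]
  have hs : g q ≠ 0 := (hm.trans_le h.slope).ne'
  have hVm := hV.aestronglyMeasurable.aemeasurable
  have iW : MemLp (fun ω => max (V ω - q) 0) 2 μ := (hV.sub (memLp_const q)).pos_part
  have iW1 : Integrable (fun ω => max (V ω - q) 0) μ := iW.integrable (by norm_num)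
  have iA : Integrable (fun ω => H₁ α q (V ω)) μ := (memLp_H₁ hα hVm q).integrable (by norm_num)
  set E := ∫ ω, max (V ω - q) 0 ∂μ with hE
  have hχ : lawObjective (μ.map V) α q = q + (1 - α)⁻¹ * E := by
    rw [← integral_lossG_comp hVm]
    simp only [lossG]
    rw [integral_add (integrable_const _) (iW1.const_mul _), integral_const_mul]
    simp [hE]
  have hvar : variance (fun ω => max (V ω - q) 0) μ = ∫ ω, (max (V ω - q) 0 - E) ^ 2 ∂μ :=
    variance_eq_integral iW.aestronglyMeasurable.aemeasurable
  have iV : Integrable (fun ω => (max (V ω - q) 0 - E) ^ 2) μ :=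
    (iW.sub (memLp_const E)).integrable_sq
  have hpt : ∀ x, leadingTerm α t₀ t₁ (g q / (1 - α)) q (lawObjective (μ.map V) α q) x ^ 2
      = t₀ ^ 2 * (α * (1 - α) / g q ^ 2)
        + 2 * t₀ * t₁ * (α / (1 - α) / g q) * max (x - q) 0
        + (t₀ ^ 2 * ((1 - α) / g q) ^ 2 * (2 - (1 - α)⁻¹) + 2 * t₀ * t₁ / g q * E) * H₁ α q x
        + t₁ ^ 2 * ((1 - α)⁻¹ ^ 2 * (max (x - q) 0 - E) ^ 2) := fun x => by
    rw [hχ]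
    unfold leadingTerm lossG H₁
    split_ifs with hx
    · field_simp
      ring
    · rw [max_eq_right (by linarith)]
      field_simp
      ring
  simp_rw [hpt]
  have j1 : Integrable (fun ω => t₀ ^ 2 * (α * (1 - α) / g q ^ 2)
        + 2 * t₀ * t₁ * (α / (1 - α) / g q) * max (V ω - q) 0) μ :=
    (integrable_const _).add (iW1.const_mul _)
  have j2 : Integrable (fun ω => (t₀ ^ 2 * ((1 - α) / g q) ^ 2 * (2 - (1 - α)⁻¹)
      + 2 * t₀ * t₁ / g q * E) * H₁ α q (V ω)) μ := iA.const_mul _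
  have j3 : Integrable (fun ω => t₁ ^ 2 * ((1 - α)⁻¹ ^ 2 * (max (V ω - q) 0 - E) ^ 2)) μ :=
    (iV.const_mul _).const_mul _
  have j12 : Integrable (fun ω => t₀ ^ 2 * (α * (1 - α) / g q ^ 2)
        + 2 * t₀ * t₁ * (α / (1 - α) / g q) * max (V ω - q) 0 +
        (t₀ ^ 2 * ((1 - α) / g q) ^ 2 * (2 - (1 - α)⁻¹)
      + 2 * t₀ * t₁ / g q * E) * H₁ α q (V ω)) μ := j1.add j2
  rw [integral_add j12 j3, integral_add j1 j2, integral_add (integrable_const _) (iW1.const_mul _),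
    integral_const_mul, integral_const_mul, integral_const_mul, integral_const_mul,
    integral_const_mul, integral_H₁_comp hα hVm h, ← hvar, ← hE, integral_const,
    probReal_univ, one_smul]
  simp only [limitCov, Matrix.of_apply, Matrix.cons_val', Matrix.cons_val_zero, Matrix.cons_val_one,
    Matrix.cons_val_fin_one, ← hE]
  field_simp
  ring

/-- The quadratic form of the matrix is a second moment of the summand. -/
lemma posSemidef_limitCov (hα : α ∈ Ioo (0 : ℝ) 1) {V : Ω → ℝ} (hV : MemLp V 2 μ)
    {g : ℝ → ℝ} {q m M L : ℝ} (hm : 0 < m) (h : RegularLaw (μ.map V) α q (g q) m M L) :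
    (limitCov μ V g α q).PosSemidef := by
  refine Matrix.PosSemidef.of_dotProduct_mulVec_nonneg ?_ fun x => ?_
  · ext i j
    fin_cases i <;> fin_cases j <;> simp [limitCov, Matrix.conjTranspose]
  · have h0 := integral_leadingTerm_sq hα hV hm h (x 0) (x 1)
    have h1 : 0 ≤ ∫ ω, leadingTerm α (x 0) (x 1) (g q / (1 - α)) q (lawObjective (μ.map V) α q)
      (V ω) ^ 2 ∂μ := integral_nonneg fun ω => sq_nonneg _
    rw [h0] at h1
    refine h1.trans_eq ?_
    have h01 : limitCov μ V g α q 1 0 = limitCov μ V g α q 0 1 := by simp [limitCov]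
    simp only [dotProduct, Matrix.mulVec, Fin.sum_univ_two, Pi.star_apply, star_trivial, h01]
    ring

end Leading

/-! ### Convergence of the characteristic functions of the estimators -/

section Estimators

variable {Ω : Type*} [MeasurableSpace Ω] {μ : Measure Ω} [IsProbabilityMeasure μ]
  {α γ₁ β : ℝ}

lemma IsInnovation.integrable_remainder {P : Measure ℝ} [IsProbabilityMeasure P] {ξ₀ : Ω → ℝ}
    {X : ℕ → Ω → ℝ} {ξ s m M L l : ℝ} (hα : α ∈ Ioo (0 : ℝ) 1) (hγ₁ : 0 < γ₁) (hβ : 0 ≤ β)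
    (hl : 0 < l) (hlγ : l * (γ₁ * gradBound α) ≤ 1) (h : IsInnovation μ P ξ₀ X)
    (hP : RegularLaw P α ξ s m M L)
    (h0 : Integrable (fun ω => Real.cosh (l * (ξ₀ ω - ξ))) μ) (n : ℕ) :
    Integrable (fun ω => s / (1 - α) * ∑ k ∈ Finset.Icc 1 n, (xiProc α γ₁ β ξ₀ X k ω - ξ)
        + ∑ k ∈ Finset.range n, H₁ α ξ (X k ω)) μ ∧
    Integrable (fun ω => n * chiIter α γ₁ β (ξ₀ ω) (fun i => X i ω) n
        - ∑ k ∈ Finset.range n, lossG α ξ (X k ω)) μ := by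
  have hξm := fun k => h.measurable_xiProc (α := α) (γ₁ := γ₁) (β := β) k
  have hX := h.measurable
  have hξi : ∀ k, Integrable (fun ω => xiProc α γ₁ β ξ₀ X k ω - ξ) μ := fun k =>
    ((memLp_two_iff_integrable_sq ((hξm k).sub_const ξ).aestronglyMeasurable).2
      (h.integrable_sq hα hγ₁ hβ hl hlγ h0 k)).integrable (by norm_num)
  have hHi : ∀ k, Integrable (fun ω => H₁ α ξ (X k ω)) μ := fun k =>
    (memLp_H₁ hα (hX k).aemeasurable ξ).integrable (by norm_num)
  have hGi : ∀ k, Integrable (fun ω => lossG α ξ (X k ω)) μ := fun k => by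
    refine (integrable_map_measure (f := X k)
      ((measurable_lossG α).of_uncurry_left).aestronglyMeasurable (hX k).aemeasurable).1 ?_
    rw [h.law k]
    exact integrable_lossG hP.integrable ξ
  have hGξ : ∀ k, Integrable (fun ω => lossG α (xiProc α γ₁ β ξ₀ X k ω) (X k ω)) μ := fun k => by
    have hm : Measurable fun ω => lossG α (xiProc α γ₁ β ξ₀ X k ω) (X k ω) :=
      (measurable_lossG α).comp ((hξm k).prodMk (hX k))
    refine ((hGi k).abs.add ((hξi k).abs.const_mul (gradBound α))).mono' hm.aestronglyMeasurable
      (ae_of_all _ fun ω => ?_)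
    have h1 := abs_lossG_sub_le hα ξ (xiProc α γ₁ β ξ₀ X k ω) (X k ω)
    have h2 := abs_sub_abs_le_abs_sub (lossG α (xiProc α γ₁ β ξ₀ X k ω) (X k ω))
      (lossG α ξ (X k ω))
    simp only [Real.norm_eq_abs, Pi.add_apply]
    linarith
  refine ⟨((integrable_finsetSum _ fun k _ => hξi k).const_mul _).add
    (integrable_finsetSum _ fun k _ => hHi k), ?_⟩
  simp_rw [natCast_mul_chiIter]
  exact (integrable_finsetSum _ fun k _ => hGξ k).sub (integrable_finsetSum _ fun k _ => hGi k)

/-- Slutsky's lemma at the level of characteristic functions: an additive remainder R changes the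
expectation by at most E|R|. -/
lemma tendsto_integral_exp_of_remainder {V N R : ℕ → Ω → ℝ} {b : ℕ → ℝ} {b₀ : ℝ} {z : ℂ}
    (hN : ∀ᶠ K in atTop, AEMeasurable (N K) μ) (hR : ∀ᶠ K in atTop, Integrable (R K) μ)
    (hR0 : Tendsto (fun K => ∫ ω, |R K ω| ∂μ) atTop (𝓝 0)) (hb : Tendsto b atTop (𝓝 b₀))
    (hz : Tendsto (fun K => charFun (μ.map (N K)) 1) atTop (𝓝 z))
    (hV : ∀ᶠ K in atTop, ∀ ω, V K ω = N K ω + R K ω + b K) :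
    Tendsto (fun K => ∫ ω, Complex.exp ((V K ω : ℂ) * Complex.I) ∂μ) atTop
      (𝓝 (Complex.exp ((b₀ : ℂ) * Complex.I) * z)) := by
  have h1 : Tendsto (fun K => Complex.exp ((b K : ℂ) * Complex.I) * charFun (μ.map (N K)) 1) atTop
      (𝓝 (Complex.exp ((b₀ : ℂ) * Complex.I) * z)) := by
    refine Tendsto.mul ?_ hz
    have : Continuous fun x : ℝ => Complex.exp ((x : ℂ) * Complex.I) := by fun_prop
    exact (this.tendsto b₀).comp hb
  have h2 : Tendsto (fun K => ∫ ω, Complex.exp ((V K ω : ℂ) * Complex.I) ∂μ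
      - Complex.exp ((b K : ℂ) * Complex.I) * charFun (μ.map (N K)) 1) atTop (𝓝 0) := by
    refine squeeze_zero_norm' ?_ hR0
    filter_upwards [hN, hR, hV] with K hNK hRK hVK
    have hRm := hRK.aestronglyMeasurable.aemeasurable
    have i1 : Integrable (fun ω => Complex.exp ((V K ω : ℂ) * Complex.I)) μ :=
      integrable_exp_mul_I (by
        rw [show V K = fun ω => N K ω + R K ω + b K from funext hVK]
        fun_prop)
    have i2 : Integrable (fun ω => Complex.exp ((b K : ℂ) * Complex.I)
        * Complex.exp (((1 * N K ω : ℝ) : ℂ) * Complex.I)) μ :=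
      (integrable_exp_mul_I (S := fun ω => 1 * N K ω) (by fun_prop)).const_mul _
    rw [charFun_map_real hNK, ← integral_const_mul, ← integral_sub i1 i2]
    refine (norm_integral_le_integral_norm _).trans (integral_mono (i1.sub i2).norm hRK.abs ?_)
    intro ω
    have h3 : Complex.exp ((V K ω : ℂ) * Complex.I) - Complex.exp ((b K : ℂ) * Complex.I)
        * Complex.exp (((1 * N K ω : ℝ) : ℂ) * Complex.I)
        = Complex.exp (((b K + N K ω : ℝ) : ℂ) * Complex.I)
          * (Complex.exp (Complex.I * (R K ω : ℝ)) - 1) := by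
      rw [mul_sub, ← Complex.exp_add, ← Complex.exp_add, hVK, mul_one]
      congr 2 <;> push_cast <;> ring
    refine (congrArg norm h3).trans_le ?_
    rw [norm_mul, Complex.norm_exp_ofReal_mul_I, one_mul]
    exact Real.norm_exp_I_mul_ofReal_sub_one_le
  simpa using h2.add h1

/-- The error of the two estimators with `K` inner samples and `K ^ 2` iterations, scaled
by `K`. -/
def scaledError (α γ₁ β ξ χ : ℝ) (ξ₀ : ℕ → Ω → ℝ) (X : ℕ → ℕ → Ω → ℝ) (K : ℕ) (ω : Ω) :
    EuclideanSpace ℝ (Fin 2) :=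
  (K : ℝ) • !₂[xiAvg α γ₁ β (ξ₀ K ω) (fun n => X K n ω) (K ^ 2) - ξ,
    chiIter α γ₁ β (ξ₀ K ω) (fun n => X K n ω) (K ^ 2) - χ]

lemma measurable_vecTwo {g₀ g₁ : Ω → ℝ} (h₀ : Measurable g₀) (h₁ : Measurable g₁) :
    Measurable fun ω => !₂[g₀ ω, g₁ ω] := by
  refine (PiLp.continuous_toLp 2 fun _ : Fin 2 => ℝ).measurable.comp
    (measurable_pi_iff.2 fun i => ?_)
  fin_cases i
  exacts [h₀, h₁]

lemma measurable_estimators {ξ₀ : Ω → ℝ} {X : ℕ → Ω → ℝ} (hξ₀ : Measurable ξ₀)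
    (hX : ∀ n, Measurable (X n)) (ξ χ : ℝ) (n : ℕ) :
    Measurable fun ω => !₂[xiAvg α γ₁ β (ξ₀ ω) (fun i => X i ω) n - ξ,
      chiIter α γ₁ β (ξ₀ ω) (fun i => X i ω) n - χ] := by
  have hp : Measurable fun ω => (ξ₀ ω, fun i => X i ω) := hξ₀.prodMk (measurable_pi_lambda _ hX)
  exact measurable_vecTwo (((measurable_xiAvg α γ₁ β n).comp hp).sub_const ξ)
    (((measurable_chiIter α γ₁ β n).comp hp).sub_const χ)

lemma measurable_scaledError {ξ₀ : ℕ → Ω → ℝ} {X : ℕ → ℕ → Ω → ℝ}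
    (hξ₀ : ∀ K, 1 ≤ K → Measurable (ξ₀ K)) (hX : ∀ K, 1 ≤ K → ∀ n, Measurable (X K n)) (ξ χ : ℝ)
    (K : ℕ) : Measurable (scaledError α γ₁ β ξ χ ξ₀ X K) := by
  rcases Nat.eq_zero_or_pos K with rfl | hK
  · have : scaledError α γ₁ β ξ χ ξ₀ X 0 = fun _ => 0 := by
      funext ω; simp [scaledError]
    rw [this]
    exact measurable_const
  · exact (measurable_estimators (hξ₀ K hK) (hX K hK) ξ χ (K ^ 2)).const_smul (K : ℝ)

/-- An algebraic identity, valid for any nonzero slope a and any centrings q, χ'; these will be the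
slope, quantile and objective value at level K. -/
lemma inner_scaledError {a q χ' ξ χ : ℝ} {ξ₀ : ℕ → Ω → ℝ} {X : ℕ → ℕ → Ω → ℝ} {K : ℕ}
    (hK : 1 ≤ K) (ha : a ≠ 0) (t : EuclideanSpace ℝ (Fin 2)) (ω : Ω) :
    inner ℝ (scaledError α γ₁ β ξ χ ξ₀ X K ω) t
      = (K : ℝ)⁻¹ * ∑ k ∈ Finset.range (K ^ 2), leadingTerm α (t 0) (t 1) a q χ' (X K k ω)
      + (K : ℝ)⁻¹ * (t 0 * a⁻¹ * (a * ∑ k ∈ Finset.Icc 1 (K ^ 2),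
          (xiProc α γ₁ β (ξ₀ K) (X K) k ω - q)
          + ∑ k ∈ Finset.range (K ^ 2), H₁ α q (X K k ω))
        + t 1 * ((K ^ 2 : ℕ) * chiIter α γ₁ β (ξ₀ K ω) (fun i => X K i ω) (K ^ 2)
          - ∑ k ∈ Finset.range (K ^ 2), lossG α q (X K k ω)))
      + (t 0 * (K * (q - ξ)) + t 1 * (K * (χ' - χ))) := by
  have hK' : (K : ℝ) ≠ 0 := by positivity
  have h1 : inner ℝ (scaledError α γ₁ β ξ χ ξ₀ X K ω) t
      = K * (t 0 * (xiAvg α γ₁ β (ξ₀ K ω) (fun n => X K n ω) (K ^ 2) - ξ)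
        + t 1 * (chiIter α γ₁ β (ξ₀ K ω) (fun n => X K n ω) (K ^ 2) - χ)) := by
    simp only [scaledError, inner_smul_left, PiLp.inner_apply, Fin.sum_univ_two]
    simp
  rw [h1]
  simp only [leadingTerm, Finset.sum_add_distrib, ← Finset.mul_sum, Finset.sum_sub_distrib,
    Finset.sum_const, Finset.card_range, Nat.card_Icc, nsmul_eq_mul, xiAvg, xiProc]
  push_cast [Nat.add_sub_cancel]
  field_simp
  ring

/-- Cramér–Wold: for each t the projected error is a normalized i.i.d. sum plus an L¹-small
remainder plus a convergent bias, and the limit is matched with the Gaussian characteristic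
function. -/
theorem tendsto_charFun_scaledError {U : ℕ → Ω → ℝ} {U₀ : Ω → ℝ} {ξ₀ : ℕ → Ω → ℝ}
    {X : ℕ → ℕ → Ω → ℝ} {q : ℕ → ℝ} {f : ℕ → ℝ → ℝ} {f₀ v : ℝ → ℝ} {ξ χ m M L l B : ℝ}
    (hα : α ∈ Ioo (0 : ℝ) 1) (hγ₁ : 0 < γ₁) (hβ : β ∈ Ioo (1 / 2 : ℝ) 1)
    (hU : ∀ K, MemLp (U K) 2 μ) (hU₀ : MemLp U₀ 2 μ)
    (hlim : Tendsto (fun K => ∫ ω, (U K ω - U₀ ω) ^ 2 ∂μ) atTop (𝓝 0))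
    (hm : 0 < m) (hL : 0 ≤ L) (hR₀ : RegularLaw (μ.map U₀) α ξ (f₀ ξ) m M L)
    (hR : ∀ᶠ K in atTop, RegularLaw (μ.map (U K)) α (q K) (f K (q K)) m M L)
    (hq : Tendsto q atTop (𝓝 ξ)) (hs : Tendsto (fun K => f K (q K)) atTop (𝓝 (f₀ ξ)))
    (hbias₀ : Tendsto (fun K : ℕ => (K : ℝ) * (q K - ξ)) atTop (𝓝 (-(v ξ / f₀ ξ))))
    (hbias₁ : Tendsto (fun K : ℕ => (K : ℝ) * (lawObjective (μ.map (U K)) α (q K) - χ)) atTop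
        (𝓝 (-∫ x in Ioi ξ, v x / (1 - α))))
    (hX : ∀ K, 1 ≤ K → IsInnovation μ (μ.map (U K)) (ξ₀ K) (X K))
    (hl : 0 < l) (hlγ : l * (γ₁ * gradBound α) ≤ 1)
    (hB : ∀ᶠ K in atTop, Integrable (fun ω => Real.cosh (l * (ξ₀ K ω - q K))) μ ∧
      ∫ ω, Real.cosh (l * (ξ₀ K ω - q K)) ∂μ ≤ B) (t : EuclideanSpace ℝ (Fin 2)) :
    Tendsto (fun K => charFun (μ.map (scaledError α γ₁ β ξ χ ξ₀ X K)) t) atTop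
      (𝓝 (charFun (multivariateGaussian (limitMean f₀ v α ξ) (limitCov μ U₀ f₀ α ξ)) t)) := by
  have hα' : 0 < 1 - α := by linarith [hα.2]
  have hβ0 : 0 ≤ β := by linarith [hβ.1]
  have hpr : ∀ K, IsProbabilityMeasure (μ.map (U K)) := fun K =>
    Measure.isProbabilityMeasure_map (hU K).aestronglyMeasurable.aemeasurable
  have hpr₀ : IsProbabilityMeasure (μ.map U₀) :=
    Measure.isProbabilityMeasure_map hU₀.aestronglyMeasurable.aemeasurable
  set a := fun K => f K (q K) / (1 - α) with ha_def
  have ha : Tendsto a atTop (𝓝 (f₀ ξ / (1 - α))) := hs.div_const _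
  have ha₀ : f₀ ξ / (1 - α) ≠ 0 := (div_pos (hm.trans_le hR₀.slope) hα').ne'
  obtain ⟨C, hC, hrem⟩ := exists_remainder_le μ hα hγ₁ hβ hl hlγ hm hR₀.bound_nonneg hL B
  set N := fun (K : ℕ) ω => (K : ℝ)⁻¹ * ∑ k ∈ Finset.range (K ^ 2), leadingTerm α (t 0) (t 1) (a K)
    (q K) (lawObjective (μ.map (U K)) α (q K)) (X K k ω) with hN_def
  set R₁ := fun (K : ℕ) ω => a K * ∑ k ∈ Finset.Icc 1 (K ^ 2),
    (xiProc α γ₁ β (ξ₀ K) (X K) k ω - q K) + ∑ k ∈ Finset.range (K ^ 2), H₁ α (q K) (X K k ω)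
    with hR₁_def
  set R₂ := fun (K : ℕ) ω => (K ^ 2 : ℕ) * chiIter α γ₁ β (ξ₀ K ω) (fun i => X K i ω) (K ^ 2)
          - ∑ k ∈ Finset.range (K ^ 2), lossG α (q K) (X K k ω) with hR₂_def
  set b := fun K : ℕ => t 0 * (K * (q K - ξ)) + t 1 * (K * (lawObjective (μ.map (U K)) α (q K) - χ))
    with hb_def
  have hb := (hbias₀.const_mul (t 0)).add (hbias₁.const_mul (t 1))
  have hNm : ∀ᶠ K in atTop, AEMeasurable (N K) μ := by
    filter_upwards [eventually_ge_atTop 1] with K hK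
    exact ((Finset.measurable_sum _ fun k _ => (measurable_leadingTerm _ _ _ _ _ _).comp
      ((hX K hK).measurable k)).const_mul _).aemeasurable
  have hRi : ∀ᶠ K in atTop, Integrable (R₁ K) μ ∧ Integrable (R₂ K) μ := by
    filter_upwards [eventually_ge_atTop 1, hR, hB] with K hK hRK hBK
    exact (hX K hK).integrable_remainder hα hγ₁ hβ0 hl hlγ hRK hBK.1 (K ^ 2)
  have hRle : ∀ᶠ K in atTop, ∫ ω, |R₁ K ω| ∂μ ≤ C * remOrder β (K ^ 2) ∧
      ∫ ω, |R₂ K ω| ∂μ ≤ C * remOrder β (K ^ 2) := by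
    filter_upwards [eventually_ge_atTop 1, hR, hB] with K hK hRK hBK
    exact hrem _ _ _ _ _ (hX K hK) hRK hBK.1 hBK.2 (K ^ 2) (Nat.one_le_pow _ _ hK)
  have hremlim : Tendsto (fun K : ℕ => (|t 0 * (a K)⁻¹| + |t 1|)
      * (C * (remOrder β (K ^ 2) / K))) atTop (𝓝 0) := by
    -- The factor K is √n for n = K², the scale against which `remOrder` is negligible.
    have h1 : Tendsto (fun K : ℕ => remOrder β (K ^ 2) / K) atTop (𝓝 0) := by
      refine ((tendsto_remOrder_div_sqrt hβ).comp (tendsto_pow_atTop two_ne_zero)).congr fun K => ?_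
      simp [Real.sqrt_sq]
    have := ((((ha.inv₀ ha₀).const_mul (t 0)).abs).add_const (|t 1|)).mul (h1.const_mul C)
    rwa [mul_zero, mul_zero] at this
  have hmain := tendsto_integral_exp_of_remainder (μ := μ)
    (V := fun K ω => inner ℝ (scaledError α γ₁ β ξ χ ξ₀ X K ω) t) (N := N)
    (R := fun K ω => (K : ℝ)⁻¹ * (t 0 * (a K)⁻¹ * R₁ K ω + t 1 * R₂ K ω)) (b := b) hNm
    (hRi.mono fun K h => ((h.1.const_mul _).add (h.2.const_mul _)).const_mul _) ?_ hb
    ((tendsto_charFun_leadingTerm hα hU hU₀ hlim hq ha ha₀ hR hR₀ (t 0) (t 1)).congr' ?_) ?_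
  · have hlimit : Complex.exp (((t 0 * -(v ξ / f₀ ξ) + t 1 * -∫ x in Ioi ξ, v x / (1 - α) : ℝ) : ℂ)
        * Complex.I) * Complex.exp (-((∫ ω, leadingTerm α (t 0) (t 1) (f₀ ξ / (1 - α)) ξ
        (lawObjective (μ.map U₀) α ξ) (U₀ ω) ^ 2 ∂μ : ℝ) : ℂ) / 2)
        = charFun (multivariateGaussian (limitMean f₀ v α ξ) (limitCov μ U₀ f₀ α ξ)) t := by
      rw [charFun_multivariateGaussian (posSemidef_limitCov hα hU₀ hm hR₀),
        integral_leadingTerm_sq hα hU₀ hm hR₀, ← Complex.exp_add]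
      have h01 : limitCov μ U₀ f₀ α ξ 1 0 = limitCov μ U₀ f₀ α ξ 0 1 := by simp [limitCov]
      congr 1
      have e1 : (inner ℝ t (limitMean f₀ v α ξ) : ℝ)
          = t 0 * -(v ξ / f₀ ξ) + t 1 * -∫ x in Ioi ξ, v x / (1 - α) := by
        simp [limitMean, PiLp.inner_apply, Fin.sum_univ_two, mul_comm]
      have e2 : t ⬝ᵥ (limitCov μ U₀ f₀ α ξ).mulVec t
          = t 0 ^ 2 * limitCov μ U₀ f₀ α ξ 0 0 + 2 * t 0 * t 1 * limitCov μ U₀ f₀ α ξ 0 1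
          + t 1 ^ 2 * limitCov μ U₀ f₀ α ξ 1 1 := by
        simp only [dotProduct, Matrix.mulVec, Fin.sum_univ_two, h01]
        ring
      rw [e1, e2]
      push_cast
      ring
    rw [← hlimit]
    refine hmain.congr' ?_
    filter_upwards [eventually_ge_atTop 1] with K hK
    rw [charFun_apply, integral_map (measurable_scaledError (fun K hK => (hX K hK).measurable_init)
      (fun K hK => (hX K hK).measurable) ξ χ K).aemeasurable (by fun_prop)]
  · refine squeeze_zero' (Eventually.of_forall fun K => integral_nonneg fun ω => abs_nonneg _) ?_
      hremlim
    filter_upwards [hRi, hRle, eventually_ge_atTop 1] with K hi hle hK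
    have hK' : (0 : ℝ) < K := by exact_mod_cast hK
    have hi1 : Integrable (fun ω => |t 0 * (a K)⁻¹| * |R₁ K ω|) μ := hi.1.abs.const_mul _
    have hi2 : Integrable (fun ω => |t 1| * |R₂ K ω|) μ := hi.2.abs.const_mul _
    calc _ ≤ ∫ ω, (K : ℝ)⁻¹ * (|t 0 * (a K)⁻¹| * |R₁ K ω| + |t 1| * |R₂ K ω|) ∂μ := by
          refine integral_mono_of_nonneg (ae_of_all _ fun ω => abs_nonneg _)
            ((hi1.add hi2).const_mul _) (ae_of_all _ fun ω => ?_)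
          simp only
          rw [abs_mul, abs_of_pos (inv_pos.2 hK'), ← abs_mul, ← abs_mul]
          gcongr
          exact abs_add_le _ _
      _ = (K : ℝ)⁻¹ * (|t 0 * (a K)⁻¹| * ∫ ω, |R₁ K ω| ∂μ + |t 1| * ∫ ω, |R₂ K ω| ∂μ) := by
          rw [integral_const_mul, integral_add hi1 hi2, integral_const_mul, integral_const_mul]
      _ ≤ (K : ℝ)⁻¹ * (|t 0 * (a K)⁻¹| * (C * remOrder β (K ^ 2))
          + |t 1| * (C * remOrder β (K ^ 2))) := by
          gcongr
          exacts [hle.1, hle.2]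
      _ = _ := by ring
  · filter_upwards [eventually_ge_atTop 1] with K hK
    exact ((hX K hK).charFun_sum (measurable_leadingTerm _ _ _ _ _ _) K).symm
  · have : ∀ᶠ K in atTop, a K ≠ 0 := ha.eventually_ne ha₀
    filter_upwards [eventually_ge_atTop 1, this] with K hK haK ω
    exact inner_scaledError hK haK t ω

end Estimators

/-- The limit law at accuracy `ε`, with `⌈ε⁻¹⌉` inner samples, follows from the limit law along
the numbers of inner samples. -/
lemma tendstoInDistribution_of_scaledError {Ω : Type*} [MeasurableSpace Ω] {μ : Measure Ω}
    [IsProbabilityMeasure μ] {α γ₁ β ξ χ : ℝ} {ξ₀ : ℕ → Ω → ℝ} {X : ℕ → ℕ → Ω → ℝ}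
    {G : Measure (EuclideanSpace ℝ (Fin 2))} [IsProbabilityMeasure G]
    (hξ₀ : ∀ K, 1 ≤ K → Measurable (ξ₀ K)) (hX : ∀ K, 1 ≤ K → ∀ n, Measurable (X K n))
    (h : ∀ t, Tendsto (fun K => charFun (μ.map (scaledError α γ₁ β ξ χ ξ₀ X K)) t) atTop
      (𝓝 (charFun G t))) :
    TendstoInDistribution
      (fun (ε : ℝ) (ω : Ω) => ε⁻¹ •
        !₂[xiAvg α γ₁ β (ξ₀ (innerCount ε) ω) (fun n => X (innerCount ε) n ω) (iterCount ε) - ξ,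
          chiIter α γ₁ β (ξ₀ (innerCount ε) ω) (fun n => X (innerCount ε) n ω) (iterCount ε) - χ])
      (𝓝[>] 0) id (fun _ => μ) G := by
  have hmeas := fun K =>
    (measurable_scaledError (α := α) (γ₁ := γ₁) (β := β) hξ₀ hX ξ χ K).aemeasurable
    (μ := μ)
  have hK : TendstoInDistribution (scaledError α γ₁ β ξ χ ξ₀ X) atTop id (fun _ => μ) G :=
    { forall_aemeasurable := hmeas
      aemeasurable_limit := aemeasurable_id
      tendsto := by
        refine ProbabilityMeasure.tendsto_iff_tendsto_charFun.2 fun t => ?_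
        simpa using h t }
  have hε : TendstoInDistribution (fun ε : ℝ => scaledError α γ₁ β ξ χ ξ₀ X (innerCount ε))
      (𝓝[>] 0) id (fun _ => μ) G :=
    { forall_aemeasurable := fun ε => hmeas _
      aemeasurable_limit := aemeasurable_id
      tendsto := hK.tendsto.comp tendsto_innerCount }
  -- Since ε⁻¹ = K · (Kε)⁻¹, the rescaling is a deterministic factor tending to 1, handled by
  -- Slutsky's lemma.
  have hratio : Tendsto (fun ε : ℝ => ((innerCount ε : ℝ) * ε)⁻¹) (𝓝[>] 0) (𝓝 1) := by
    simpa using tendsto_innerCount_mul.inv₀ one_ne_zero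
  have hmeasure : TendstoInMeasure μ (fun (ε : ℝ) (_ : Ω) => ((innerCount ε : ℝ) * ε)⁻¹) (𝓝[>] 0)
      fun _ => 1 := fun e he => by
    refine tendsto_const_nhds.congr' ?_
    have h1 : Tendsto (fun ε : ℝ => edist ((innerCount ε : ℝ) * ε)⁻¹ 1) (𝓝[>] 0) (𝓝 0) :=
      tendsto_iff_edist_tendsto_0.1 hratio
    filter_upwards [h1.eventually_lt_const he] with ε hε
    have h2 : {x : Ω | e ≤ edist ((innerCount ε : ℝ) * ε)⁻¹ (1 : ℝ)} = ∅ := by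
      ext x
      simpa using hε
    rw [h2, measure_empty]
  have hprod := hε.continuous_comp_prodMk_of_tendstoInMeasure_const
    (g := fun p : EuclideanSpace ℝ (Fin 2) × ℝ => p.2 • p.1) (by fun_prop) hmeasure
    (fun _ => aemeasurable_const)
  have hm : ∀ ε : ℝ, AEMeasurable (fun ω => ε⁻¹ •
      !₂[xiAvg α γ₁ β (ξ₀ (innerCount ε) ω) (fun n => X (innerCount ε) n ω) (iterCount ε) - ξ,
        chiIter α γ₁ β (ξ₀ (innerCount ε) ω) (fun n => X (innerCount ε) n ω) (iterCount ε) - χ])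
      μ := fun ε => by
    refine (Measurable.const_smul ?_ ε⁻¹).aemeasurable
    -- Measurability is required for every real ε. When K = 0, which occurs for ε ≤ 0, there are no
    -- iterations and the estimators are constant, so nothing need be known about `ξ₀ 0` or `X 0`.
    rcases Nat.eq_zero_or_pos (innerCount ε) with h0 | hpos
    · rw [iterCount_eq, h0]
      simp only [xiAvg, chiIter, zero_pow two_ne_zero, Finset.Icc_eq_empty_of_lt zero_lt_one,
        Finset.sum_empty, mul_zero]
      exact measurable_const
    · exact measurable_estimators (hξ₀ _ hpos) (hX _ hpos) ξ χ _
  refine ⟨hm, aemeasurable_id, ?_⟩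
  have hlim := hprod.tendsto
  simp only [one_smul, id_eq] at hlim
  refine hlim.congr' ?_
  filter_upwards [self_mem_nhdsWithin] with ε hε
  have hε' : ε ≠ 0 := (mem_Ioi.1 hε).ne'
  have hK' : (innerCount ε : ℝ) ≠ 0 := by
    have := innerCount_pos (mem_Ioi.1 hε)
    positivity
  refine Subtype.ext (congrArg (fun g => μ.map g) (funext fun ω => ?_))
  simp only [scaledError, iterCount_eq, smul_smul]
  congr 1
  field_simp

end RiskSA

end

/-! ### The main theorem -/

open RiskSA in
theorem theorem2p4
    {Ω : Type*} [MeasurableSpace Ω] (μ : Measure Ω) [IsProbabilityMeasure μ]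
    {d q : ℕ} (α : ℝ) (hα : α ∈ Set.Ioo (0 : ℝ) 1)
    -- the loss `X₀ = E[φ(Y, Z) | Y]`
    (φ : (Fin d → ℝ) → (Fin q → ℝ) → ℝ) (hφ : Measurable (Function.uncurry φ))
    (Y : Ω → Fin d → ℝ) (Z : Ω → Fin q → ℝ) (hY : Measurable Y) (hZ : Measurable Z)
    (hYZ : IndepFun Y Z μ)
    (δ : ℝ) (hδ : 0 < δ)
    (hmom : MemLp (fun ω => φ (Y ω) (Z ω)) (ENNReal.ofReal (2 + δ)) μ)
    -- i.i.d. copies of `Z`, independent of `Y`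
    (Zs : ℕ → Ω → Fin q → ℝ) (hZs : ∀ k, IdentDistrib (Zs k) Z μ μ)
    (hZs_indep : iIndepFun Zs μ) (hYZs : IndepFun Y (fun ω k => Zs k ω) μ)
    -- first order expansion of the cdf of `X_h`, `h = 1 / K`
    (v : ℝ → ℝ) (w : ℝ → ℕ → ℝ)
    (hvw : ∀ K : ℕ, 1 ≤ K → ∀ ξ : ℝ,
      cdfOf μ (nestedLoss φ Y Zs K) ξ - cdfOf μ (condLoss μ φ Y Z) ξ
        = v ξ * (1 / (K : ℝ)) + w ξ K * (1 / (K : ℝ)))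
    (hv : ∀ ξ ∈ argminObjective μ (condLoss μ φ Y Z) α, IntegrableOn v (Set.Ioi ξ))
    (hw : ∀ ξ ∈ argminObjective μ (condLoss μ φ Y Z) α,
      Tendsto (fun K : ℕ => w ξ K) atTop (𝓝 0) ∧
      Tendsto (fun K : ℕ => ∫ x in Set.Ioi ξ, w x K) atTop (𝓝 0))
    -- continuous pdfs `f₀` of `X₀` and `f K` of `X_h`, `h = 1 / K`
    (f₀ : ℝ → ℝ) (f : ℕ → ℝ → ℝ)
    (hf₀ : IsContinuousPdf μ (condLoss μ φ Y Z) f₀)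
    (hf : ∀ K : ℕ, 1 ≤ K → IsContinuousPdf μ (nestedLoss φ Y Zs K) (f K))
    (hf_lim : TendstoLocallyUniformly f f₀ atTop)
    (hf_pos : ∀ R : ℝ, 0 < R → ∃ m : ℝ, 0 < m ∧
      ∀ ξ ∈ Metric.ball (VaR μ (condLoss μ φ Y Z) α) R,
        m ≤ f₀ ξ ∧ ∀ K : ℕ, 1 ≤ K → m ≤ f K ξ)
    (hf_bdd : ∃ M : ℝ, ∀ ξ, f₀ ξ ≤ M ∧ ∀ K : ℕ, 1 ≤ K → f K ξ ≤ M)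
    (hf_lip : ∃ L : ℝ≥0, LipschitzWith L f₀ ∧ ∀ K : ℕ, 1 ≤ K → LipschitzWith L (f K))
    -- for each `h = 1 / K`, the initial value and the i.i.d. innovations with the law of `X_h`
    (ξ₀ : ℕ → Ω → ℝ) (X : ℕ → ℕ → Ω → ℝ)
    (hξ₀ : ∀ K : ℕ, 1 ≤ K → Measurable (ξ₀ K))
    (hX : ∀ K : ℕ, 1 ≤ K → ∀ n, Measurable (X K n))
    (hX_law : ∀ K : ℕ, 1 ≤ K → ∀ n, IdentDistrib (X K n) (nestedLoss φ Y Zs K) μ μ)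
    (hX_indep : ∀ K : ℕ, 1 ≤ K → iIndepFun (X K) μ)
    (hξ₀_indep : ∀ K : ℕ, 1 ≤ K → IndepFun (ξ₀ K) (fun ω n => X K n ω) μ)
    (hξ₀_mom : (⨆ K ∈ Set.Ici (1 : ℕ), ∫⁻ ω, ENNReal.ofReal (|ξ₀ K ω| ^ 2 *
      Real.exp (4 / (1 - α) * max 1 (α / (1 - α)) *
        sSup {y : ℝ | ∃ K' : ℕ, 1 ≤ K' ∧ ∃ x : ℝ, y = f K' x} * |ξ₀ K ω|)) ∂μ) < ∞)
    -- learning rate `γ₁ n ^ (-β)`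
    (γ₁ β : ℝ) (hγ₁ : 0 < γ₁) (hβ : β ∈ Set.Ioo (1 / 2 : ℝ) 1)
    (c : UnitCosts) :
    -- the orders of the parameters
    (biasParam ~[𝓝[>] 0] fun ε : ℝ => ε) ∧
    (∀ ε ∈ Set.Ioo (0 : ℝ) 1, iterCount ε = innerCount ε ^ 2) ∧
    ((fun ε : ℝ => (iterCount ε : ℝ)) ~[𝓝[>] 0] fun ε : ℝ => ε ^ (-2 : ℤ)) ∧
    -- convergence in distribution at rate `ε`
    TendstoInDistribution
      (fun (ε : ℝ) (ω : Ω) => ε⁻¹ •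
        !₂[xiAvg α γ₁ β (ξ₀ (innerCount ε) ω) (fun n => X (innerCount ε) n ω) (iterCount ε)
            - VaR μ (condLoss μ φ Y Z) α,
          chiIter α γ₁ β (ξ₀ (innerCount ε) ω) (fun n => X (innerCount ε) n ω) (iterCount ε)
            - ES μ (condLoss μ φ Y Z) α])
      (𝓝[>] 0) id (fun _ => μ)
      (multivariateGaussian
        (limitMean f₀ v α (VaR μ (condLoss μ φ Y Z) α))
        (limitCov μ (condLoss μ φ Y Z) f₀ α (VaR μ (condLoss μ φ Y Z) α))) ∧
    -- the program computes the estimators from the simulated innovations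
    (∀ (K n : ℕ) (x₀ : ℝ) (y : ℕ → Fin d → ℝ) (z : ℕ → ℕ → Fin q → ℝ),
      (ansaProg c φ α γ₁ β K n x₀ y z).val =
        (xiAvg α γ₁ β x₀ (fun i => innerMean φ K (y i) (z i)) n,
          chiIter α γ₁ β x₀ (fun i => innerMean φ K (y i) (z i)) n)) ∧
    -- and its cost is at most `C ε⁻³`
    ∃ C : ℝ, 0 < C ∧ ∀ ε ∈ Set.Ioo (0 : ℝ) 1,
      ∀ (x₀ : ℝ) (y : ℕ → Fin d → ℝ) (z : ℕ → ℕ → Fin q → ℝ),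
        ((ansaProg c φ α γ₁ β (innerCount ε) (iterCount ε) x₀ y z).cost : ℝ)
          ≤ C * ε ^ (-3 : ℤ) := by
  have hα' : 0 < 1 - α := by linarith [hα.2]
  have hmem : MemLp (fun ω => φ (Y ω) (Z ω)) 2 μ := hmom.mono_exponent (by
    rw [← ENNReal.ofReal_ofNat]
    exact ENNReal.ofReal_le_ofReal (by linarith))
  have hU := memLp_nestedLoss hφ hY hZ hYZ hmem hZs hYZs
  have hU₀ : MemLp (condLoss μ φ Y Z) 2 μ := memLp_condLoss hmem
  have hlim : Tendsto (fun K => ∫ ω, (nestedLoss φ Y Zs K ω - condLoss μ φ Y Z ω) ^ 2 ∂μ) atTop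
      (𝓝 0) := by
    refine ((tendsto_const_nhds (x := ∫ ω, innerNoise φ (μ.map Z) (Y ω) (Z ω) ^ 2 ∂μ)).div_atTop
      tendsto_natCast_atTop_atTop).congr' ?_
    filter_upwards [eventually_ge_atTop 1] with K hK
    exact (integral_nestedLoss_sub_sq hφ hY hZ hYZ hmem hZs hZs_indep hYZs hK).symm
  obtain ⟨m, M, L, q, hm, hL, hR₀, hR, hq, hs, hbias₀, hbias₁⟩ := exists_regular_quantiles hα
    (fun K => (hU K).integrable (by norm_num)) (hU₀.integrable (by norm_num)) hvw hv hw hf₀ hf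
    hf_lim hf_pos hf_bdd hf_lip
  set ξ := VaR μ (condLoss μ φ Y Z) α with hξ
  have hX' : ∀ K, 1 ≤ K → IsInnovation μ (μ.map (nestedLoss φ Y Zs K)) (ξ₀ K) (X K) :=
    fun K hK => ⟨hξ₀ K hK, hX K hK, fun n => (hX_law K hK n).map_eq, hX_indep K hK,
      hξ₀_indep K hK⟩
  have hsup : 0 < sSup {y : ℝ | ∃ K' : ℕ, 1 ≤ K' ∧ ∃ x : ℝ, y = f K' x} := by
    obtain ⟨m', hm', h⟩ := hf_pos 1 one_pos
    obtain ⟨M', hM'⟩ := hf_bdd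
    refine (hm'.trans_le ((h ξ (Metric.mem_ball_self one_pos)).2 1 le_rfl)).trans_le
      (le_csSup ⟨M', ?_⟩ ⟨1, le_rfl, ξ, rfl⟩)
    rintro y ⟨K', hK', x, rfl⟩
    exact (hM' x).2 K' hK'
  set c₀ := 4 / (1 - α) * max 1 (α / (1 - α)) *
    sSup {y : ℝ | ∃ K' : ℕ, 1 ≤ K' ∧ ∃ x : ℝ, y = f K' x} with hc₀
  have hc₀pos : 0 < c₀ :=
    mul_pos (mul_pos (by positivity) (lt_max_of_lt_left one_pos)) hsup
  have hg := mul_pos hγ₁ (gradBound_pos hα)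
  -- The first bound makes the cosine integrable at the initial value, the second keeps every
  -- increment of l ξ_n at most 1, where the second-order expansion is valid.
  set l := min c₀ (γ₁ * gradBound α)⁻¹ with hl_def
  have hl : 0 < l := lt_min hc₀pos (inv_pos.2 hg)
  have hlγ : l * (γ₁ * gradBound α) ≤ 1 := by
    rw [← le_div_iff₀ hg, one_div]
    exact min_le_right _ _
  -- The radius |ξ| + 1 eventually contains the quantiles q K, since they converge to ξ.
  obtain ⟨B, hB⟩ := exists_integral_cosh_le hc₀pos hl (min_le_left _ _) hξ₀ hξ₀_mom (|ξ| + 1)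
  have hB' : ∀ᶠ K in atTop, Integrable (fun ω => Real.cosh (l * (ξ₀ K ω - q K))) μ ∧
      ∫ ω, Real.cosh (l * (ξ₀ K ω - q K)) ∂μ ≤ B := by
    filter_upwards [eventually_ge_atTop 1, hq.abs.eventually_lt_const (lt_add_one |ξ|)]
      with K hK hqK
    exact hB K hK (q K) hqK.le
  exact ⟨biasParam_isEquivalent, fun ε _ => iterCount_eq ε, iterCount_isEquivalent,
    tendstoInDistribution_of_scaledError hξ₀ hX fun t =>
      tendsto_charFun_scaledError hα hγ₁ hβ hU hU₀ hlim hm hL hR₀ hR hq hs hbias₀ hbias₁ hX' hl hlγ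
        hB' t,
    ansaProg_val c φ α γ₁ β, exists_cost_le c φ α γ₁ β⟩
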